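/- Theorem 1 (Small data solutions). Let $1<\alpha<2$, $\beta\in\{-1,0,1\}$, and let $w:\mathbb{R}^3\to\mathbb{R}$ be a short-range potential: $w$ is differentiable on $\mathbb{R}^3\setminus\{0\}$, $\nabla w\in L^1_{\mathrm{loc}}(\mathbb{R}^3)$, and $|\nabla w(x)|\le C_w|x|^{-(\alpha+1)}$ for all sufficiently large $|x|$ (for instance, $|\nabla w(x)|\le C_w|x|^{-(\alpha+1)}$ for all $x\ne0$). Let $\kappa>3$. Write $\langle x\rangle=\sqrt{1+|x|^2}$, and set $v_c(p)=p/\sqrt{1+|p|^2/c^2}$ for $1\le c<\infty$ and $v_\infty(p)=p$. For $f^0\in C^1(\mathbb{R}^3\times\mathbb{R}^3)$ with $f^0\ge 0$ put $$\eta:=\big\|\langle x\rangle^{\kappa}\langle p\rangle^{8}f^0\big\|_{L^\infty_{x,p}}+\big\|\langle x\rangle^{\kappa}\langle p\rangle^{9}\nabla_{(x,p)}f^0\big\|_{L^\infty_{x,p}}.$$ For $1\le c\le\infty$ consider the Vlasov equation $$\partial_tf_c+v_c(p)\cdot\nabla_xf_c+E_c\cdot\nabla_pf_c=0,\qquad f_c(0)=f^0,\qquad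 E_c(t,x)=\beta\iint_{\mathbb{R}^6}\nabla w(x-y)\,f_c(t,y,p)\,dy\,dp .$$ A global solution is a $C^1$ function $f_c$ on $[0,\infty)\times\mathbb{R}^3\times\mathbb{R}^3$ that satisfies the equation and the initial condition pointwise, for which the integral defining $E_c$ converges absolutely and $E_c$ is continuous on $[0,\infty)\times\mathbb{R}^3$ and bounded on $[0,T]\times\mathbb{R}^3$ for every $T>0$. There are constants $\varepsilon>0$ and $C>0$, depending only on $\alpha,\beta,w,\kappa$, such that whenever $\eta<\varepsilon$, for every $1\le c\le\infty$ there is a unique global solution $f_c$; it is non-negative, its force field $E_c(t,\cdot)$ is differentiable for every $t\ge0$, and for every $\eta_0$ with $\eta<\eta_0<\varepsilon$, $$\sup_{t\ge0}\Big\{(1+t)^{\alpha+1}\|E_c(t)\|_{L^\infty_x(\mathbb{R}^3)}+(1+t)^{\alpha+2}\|\nabla_xE_c(t)\|_{L^\infty_x(\mathbb{R}^3)}\Big\}\le C\,\eta_0 .$$ In particular $\varepsilon$ and $C$ do not depend on $c$, $f^0$, $\eta$ or $\eta_0$. -/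

import Mathlib

open MeasureTheory Set
open scoped ENNReal NNReal

noncomputable section

namespace Vlasov

/-- Physical space, and also momentum space: `ℝ³` with the Euclidean norm. -/
abbrev R3 : Type := EuclideanSpace ℝ (Fin 3)

/-- The Japanese bracket `⟨x⟩ = √(1 + |x|²)`. -/
def bracket (x : R3) : ℝ := √(1 + ‖x‖ ^ 2)

/-- The velocity `v_c(p) = p / √(1 + |p|² / c²)` for a finite speed of light `c`, and
`v_∞(p) = p`. -/
def velocity (c : ℝ≥0∞) (p : R3) : R3 :=
  if c = ∞ then p else (√(1 + ‖p‖ ^ 2 / c.toReal ^ 2))⁻¹ • p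

/-- Short-range potentials of order `α`: `w` is differentiable away from the origin, its gradient
is locally integrable on `ℝ³`, and `|∇w(x)| ≤ C |x|^{-(α+1)}` for `|x|` sufficiently large.
(For `α < 2`, local integrability is automatic if the last bound holds for all `x ≠ 0`, because
then `α + 1 < 3`.) -/
structure IsShortRangePotential (α : ℝ) (w : R3 → ℝ) : Prop where
  differentiableAt : ∀ x, x ≠ 0 → DifferentiableAt ℝ w x
  locallyIntegrable : LocallyIntegrable (gradient w) volume
  decay : ∃ C R : ℝ, ∀ x, R ≤ ‖x‖ → ‖gradient w x‖ ≤ C * ‖x‖ ^ (-(α + 1))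

/-- The force field `E(t,x) = β ∬ ∇w(x - y) f(t,y,p) dy dp`. -/
def forceField (β : ℝ) (w : R3 → ℝ) (f : ℝ → R3 → R3 → ℝ) (t : ℝ) (x : R3) : R3 :=
  β • ∫ z : R3 × R3, f t z.1 z.2 • gradient w (x - z.1)

/-- `f` is a global classical solution of
`∂ₜ f + v_c(p) · ∇ₓ f + E · ∇ₚ f = 0`, `f(0) = f⁰`, where `E` is the force field of `f`.
Only the values of `f` at times `t ≥ 0` matter; at `t = 0` the time derivative is one-sided. -/
structure IsGlobalSolution (β : ℝ) (w : R3 → ℝ) (c : ℝ≥0∞) (f₀ : R3 → R3 → ℝ)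
    (f : ℝ → R3 → R3 → ℝ) : Prop where
  initial : ∀ x p, f 0 x p = f₀ x p
  contDiffOn : ContDiffOn ℝ 1 (fun z : ℝ × R3 × R3 => f z.1 z.2.1 z.2.2) (Ici 0 ×ˢ univ)
  /-- The integral defining the force field converges absolutely. -/
  integrable : ∀ t, 0 ≤ t → ∀ x,
    Integrable (fun z : R3 × R3 => f t z.1 z.2 • gradient w (x - z.1)) volume
  field_continuous :
    ContinuousOn (fun z : ℝ × R3 => forceField β w f z.1 z.2) (Ici 0 ×ˢ univ)
  /-- The force field is bounded on bounded time intervals. -/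
  field_bounded : ∀ T : ℝ, ∃ M : ℝ, ∀ t ∈ Icc 0 T, ∀ x, ‖forceField β w f t x‖ ≤ M
  equation : ∀ t, 0 ≤ t → ∀ x p,
    derivWithin (fun s => f s x p) (Ici 0) t
      + inner ℝ (velocity c p) (gradient (fun y => f t y p) x)
      + inner ℝ (forceField β w f t x) (gradient (fun q => f t x q) p) = 0

/-- The Euclidean length `|∇_{(x,p)} f⁰(x,p)|` of the gradient in `ℝ⁶`. -/
def phaseGradNorm (f₀ : R3 → R3 → ℝ) (x p : R3) : ℝ :=
  √(‖gradient (fun y => f₀ y p) x‖ ^ 2 + ‖gradient (fun q => f₀ x q) p‖ ^ 2)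

/-- The size of the initial datum,
`η = ‖⟨x⟩^κ ⟨p⟩^8 f⁰‖_{L^∞} + ‖⟨x⟩^κ ⟨p⟩^9 ∇_{(x,p)} f⁰‖_{L^∞}`. -/
def initialSize (κ : ℝ) (f₀ : R3 → R3 → ℝ) : ℝ≥0∞ :=
  eLpNorm (fun z : R3 × R3 => bracket z.1 ^ κ * bracket z.2 ^ 8 * f₀ z.1 z.2) ∞ volume
    + eLpNorm (fun z : R3 × R3 => bracket z.1 ^ κ * bracket z.2 ^ 9 * phaseGradNorm f₀ z.1 z.2)
        ∞ volume

/-- `sup_{t ≥ 0} { (1+t)^{α+1} ‖E(t)‖_{L^∞} + (1+t)^{α+2} ‖∇ₓ E(t)‖_{L^∞} }`. -/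
def fieldDecayNorm (α : ℝ) (E : ℝ → R3 → R3) : ℝ≥0∞ :=
  ⨆ t : ℝ≥0,
    (ENNReal.ofReal ((1 + (t : ℝ)) ^ (α + 1)) * eLpNorm (E t) ∞ volume
      + ENNReal.ofReal ((1 + (t : ℝ)) ^ (α + 2)) * eLpNorm (fderiv ℝ (E t)) ∞ volume)

end Vlasov

end

/-!
Small data disperse. Along free trajectories `x - t v(p)` and `p` are constant, so a phase-space
density that is initially below `η ⟨x⟩^{-κ} ⟨p⟩^{-5}` and is transported freely stays below the
transported weight `⟨x - t v(p)⟩^{-κ} ⟨p⟩^{-5}`. The change of variables `u = v(p)`, whose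
Jacobian is at least `⟨p⟩^{-5}` for every speed of light `c ≥ 1`, shows that the macroscopic
density of this weight is at most `C (1+t)^{-3}`, while its mass is bounded
(`exists_weight_bound`). Splitting a short-range kernel at the radius `1 + t` turns this into a
field of size `(1+t)^{-(α+1)}` (`IsKernel.exists_field_bound`). One space derivative gains another
factor `(1+t)^{-1}`: the direction `t e` in space differs from a direction in which the free
coordinates barely move by the momentum direction `(Dv)⁻¹ e`, and the momentum derivative is
integrated by parts (`IsDispersed.norm_densityDeriv_le`).

Conversely, fields with `|E| ≤ δ (1+t)^{-(α+1)}` and `|∇E| ≤ δ (1+t)^{-(α+2)}` are perturbations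
of the free flow. As `α > 1`, the force is integrable twice in time, so that the free coordinates
move by at most `1` along a characteristic (`IsDecayField.norm_sub_freeCoord_le`), and the
separation of two characteristics, measured in free coordinates, grows by a bounded factor only
(`IsDecayField.norm_sub_le_exp`). Hence the transported datum obeys the bounds of the free
solution, and depends Lipschitz continuously on the field.

Together, for small data the map from a field to the field of the transported datum is a
contraction that preserves a class of decaying fields (`IsKernel.exists_fieldMap_bound`). The
gradients of these fields share one modulus of continuity, because convolution with the kernel is
equicontinuous on bounded sets of densities; this makes the class closed under uniform
convergence, and the iteration converges in it to a self-consistent field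
(`IsKernel.exists_selfConsistent`). The speed of light only enters through the parameter `a = 1/c²
∈ [0, 1]`, and all constants are uniform in it.

Uniqueness cannot use characteristics, since the field of a competing solution is merely
continuous and bounded. It rests on a maximum principle on backward tubes
(`le_zero_of_transport_le_zero`), which first bounds the competing solution by a growing multiple
of the weight and then improves any such bound on the difference of two solutions by the factor
`1/2` (`IsDecayField.unique`).
-/

noncomputable section

namespace Vlasov

/-! ### Global flows of Lipschitz fields -/

section Flow

open Filter Topology

variable {V : Type*} [NormedAddCommGroup V]

/-- Continuous time-dependent vector fields on `V`, uniformly Lipschitz in space and bounded at the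
origin. -/
structure IsLipField (K M : ℝ) (F : ℝ → V → V) : Prop where
  one_le : 1 ≤ K
  cont : Continuous fun q : ℝ × V => F q.1 q.2
  lip : ∀ t x y, ‖F t x - F t y‖ ≤ K * ‖x - y‖
  bdd : ∀ t, ‖F t 0‖ ≤ M

variable {K M : ℝ} {F : ℝ → V → V}

theorem IsLipField.norm_le (hF : IsLipField K M F) (t : ℝ) (z : V) : ‖F t z‖ ≤ M + K * ‖z‖ := by
  have h1 := hF.lip t z 0
  have h2 := hF.bdd t
  have h3 := norm_le_norm_add_norm_sub' (F t z) (F t 0)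
  rw [sub_zero] at h1
  linarith

variable [NormedSpace ℝ V]

/-- Grönwall's inequality in both time directions. -/
theorem norm_le_gronwallBound_abs {u u' : ℝ → V} {K ε a : ℝ} {t r : ℝ}
    (hu : ∀ s, HasDerivAt u (u' s) s) (ha : ‖u t‖ ≤ a)
    (hb : ∀ s ∈ uIcc t r, ‖u' s‖ ≤ K * ‖u s‖ + ε) :
    ‖u r‖ ≤ gronwallBound a K ε |r - t| := by
  rcases le_total t r with h | h
  · rw [uIcc_of_le h] at hb
    rw [abs_of_nonneg (sub_nonneg.2 h)]
    exact norm_le_gronwallBound_of_norm_deriv_right_le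
      (fun s _ => (hu s).continuousAt.continuousWithinAt)
      (fun s _ => (hu s).hasDerivWithinAt) ha (fun s hs => hb s ⟨hs.1, hs.2.le⟩) r ⟨h, le_rfl⟩
  · rw [uIcc_of_ge h] at hb
    rw [abs_of_nonpos (sub_nonpos.2 h)]
    have hw : ∀ s, HasDerivAt (fun σ => u (t - σ)) (-(u' (t - s))) s := fun s => by
      simpa [Function.comp_def] using (hu (t - s)).scomp s ((hasDerivAt_id s).const_sub t)
    have := norm_le_gronwallBound_of_norm_deriv_right_le (f := fun σ => u (t - σ)) (δ := a)
      (K := K) (ε := ε) (a := 0) (b := t - r)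
      (fun s _ => (hw s).continuousAt.continuousWithinAt)
      (fun s _ => (hw s).hasDerivWithinAt) (by simpa using ha)
      (fun s hs => by
        rw [norm_neg]
        exact hb _ ⟨by linarith [hs.2], by linarith [hs.1]⟩) (t - r) ⟨by linarith, le_rfl⟩
    simpa using this

theorem norm_integral_le_exp_abs {g : ℝ → V} {C l : ℝ} (hl : 0 < l) (hC : 0 ≤ C)
    (hg : ∀ s, ‖g s‖ ≤ C * Real.exp (l * |s|)) (s : ℝ) :
    ‖∫ τ in (0 : ℝ)..s, g τ‖ ≤ C / l * Real.exp (l * |s|) := by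
  have hcont : Continuous fun τ : ℝ => C * Real.exp (l * |τ|) := by fun_prop
  have h1 := intervalIntegral.norm_integral_le_abs_of_norm_le (μ := volume) (a := 0) (b := s)
    (f := g) (g := fun τ => C * Real.exp (l * |τ|)) (Eventually.of_forall fun τ => hg τ)
    (hcont.intervalIntegrable 0 s)
  refine h1.trans ?_
  have key : ∀ r : ℝ, 0 ≤ r → ∫ τ in (0 : ℝ)..r, C * Real.exp (l * |τ|)
      = C / l * (Real.exp (l * r) - 1) := by
    intro r hr
    have : ∫ τ in (0 : ℝ)..r, C * Real.exp (l * |τ|) = ∫ τ in (0 : ℝ)..r, C * Real.exp (l * τ) := by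
      refine intervalIntegral.integral_congr fun τ hτ => ?_
      rw [uIcc_of_le hr] at hτ
      simp [abs_of_nonneg hτ.1]
    rw [this, intervalIntegral.integral_const_mul, intervalIntegral.integral_comp_mul_left _ hl.ne',
      integral_exp]
    simp
    ring
  have key2 : |∫ τ in (0 : ℝ)..s, C * Real.exp (l * |τ|)| = C / l * (Real.exp (l * |s|) - 1) := by
    have hn : 0 ≤ C / l * (Real.exp (l * |s|) - 1) := by
      have : 1 ≤ Real.exp (l * |s|) := Real.one_le_exp (by positivity)
      have : 0 ≤ Real.exp (l * |s|) - 1 := by linarith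
      positivity
    rcases le_total 0 s with h | h
    · rw [key s h, abs_of_nonneg h, abs_of_nonneg]
      rwa [abs_of_nonneg h] at hn
    · have e : ∫ τ in (0 : ℝ)..s, C * Real.exp (l * |τ|)
          = -∫ τ in (0 : ℝ)..(-s), C * Real.exp (l * |τ|) := by
        have := intervalIntegral.integral_comp_neg (a := 0) (b := s)
          (f := fun τ => C * Real.exp (l * |τ|))
        simp only [abs_neg, neg_zero] at this
        rw [this, intervalIntegral.integral_symm]
      rw [e, key (-s) (by linarith), abs_neg, abs_of_nonpos h, abs_of_nonneg]
      rwa [abs_of_nonpos h] at hn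
  rw [key2]
  have : 0 ≤ C / l := by positivity
  nlinarith

/-- Global existence: the Picard map contracts in the norm `sup_s e^{-2K|s|}|u(s)|`. -/
theorem IsLipField.exists_solution_zero [CompleteSpace V] (hF : IsLipField K M F) (z : V) :
    ∃ Z : ℝ → V, Z 0 = z ∧ ∀ s, HasDerivAt Z (F s (Z s)) s := by
  have hK : 0 < K := by linarith [hF.one_le]
  have hM : 0 ≤ M := (norm_nonneg _).trans (hF.bdd 0)
  let l : ℝ := 2 * K
  have hl : 0 < l := by positivity
  let A : BoundedContinuousFunction ℝ V → ℝ → V := fun u s => z + Real.exp (l * |s|) • u s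
  have hA : ∀ u, Continuous (A u) := fun u => by
    have := u.continuous
    fun_prop
  have hG : ∀ u, Continuous fun s => F s (A u s) := fun u =>
    hF.cont.comp (continuous_id.prodMk (hA u))
  have hI : ∀ u s, HasDerivAt (fun s => ∫ τ in (0 : ℝ)..s, F τ (A u τ)) (F s (A u s)) s :=
    fun u s => intervalIntegral.integral_hasDerivAt_right ((hG u).intervalIntegrable _ _)
      ((hG u).stronglyMeasurableAtFilter _ _) (hG u).continuousAt
  have hexp : ∀ s : ℝ, Real.exp (-(l * |s|)) * Real.exp (l * |s|) = 1 := fun s => by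
    rw [← Real.exp_add]; simp
  have hbd : ∀ u s, ‖Real.exp (-(l * |s|)) • ∫ τ in (0 : ℝ)..s, F τ (A u τ)‖
      ≤ (M + K * ‖z‖ + K * ‖u‖) / l := by
    intro u s
    have := norm_integral_le_exp_abs (g := fun τ => F τ (A u τ)) hl
      (C := M + K * ‖z‖ + K * ‖u‖) (by positivity) (fun τ => by
        have h1 := hF.norm_le τ (A u τ)
        have h2 : ‖A u τ‖ ≤ ‖z‖ + Real.exp (l * |τ|) * ‖u‖ := by
          refine (norm_add_le _ _).trans ?_
          rw [norm_smul, Real.norm_of_nonneg (Real.exp_pos _).le]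
          gcongr
          exact u.norm_coe_le_norm τ
        have h3 : 1 ≤ Real.exp (l * |τ|) := Real.one_le_exp (by positivity)
        have h4 : 0 ≤ M + K * ‖z‖ := by positivity
        nlinarith) s
    rw [norm_smul, Real.norm_of_nonneg (Real.exp_pos _).le]
    calc _ ≤ Real.exp (-(l * |s|)) * ((M + K * ‖z‖ + K * ‖u‖) / l * Real.exp (l * |s|)) := by
          gcongr
      _ = (M + K * ‖z‖ + K * ‖u‖) / l * (Real.exp (-(l * |s|)) * Real.exp (l * |s|)) := by ring
      _ = _ := by rw [hexp, mul_one]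
  let G : BoundedContinuousFunction ℝ V → BoundedContinuousFunction ℝ V := fun u =>
    BoundedContinuousFunction.ofNormedAddCommGroup
      (fun s => Real.exp (-(l * |s|)) • ∫ τ in (0 : ℝ)..s, F τ (A u τ))
      (by
        have : Continuous fun s => ∫ τ in (0 : ℝ)..s, F τ (A u τ) :=
          continuous_iff_continuousAt.2 fun s => (hI u s).continuousAt
        fun_prop) _ (hbd u)
  have hGapp : ∀ u s, G u s = Real.exp (-(l * |s|)) • ∫ τ in (0 : ℝ)..s, F τ (A u τ) :=
    fun u s => rfl
  have hcontr : ContractingWith (1 / 2) G := by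
    refine ⟨by norm_num, LipschitzWith.of_dist_le_mul fun u w => ?_⟩
    rw [BoundedContinuousFunction.dist_le (by positivity)]
    intro s
    rw [dist_eq_norm, hGapp, hGapp, ← smul_sub, ← intervalIntegral.integral_sub
      ((hG u).intervalIntegrable _ _) ((hG w).intervalIntegrable _ _), norm_smul,
      Real.norm_of_nonneg (Real.exp_pos _).le]
    have := norm_integral_le_exp_abs (g := fun τ => F τ (A u τ) - F τ (A w τ)) hl
      (C := K * dist u w) (by positivity) (fun τ => by
        refine (hF.lip _ _ _).trans ?_
        have : A u τ - A w τ = Real.exp (l * |τ|) • (u τ - w τ) := by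
          simp [A, smul_sub]
        rw [this, norm_smul, Real.norm_of_nonneg (Real.exp_pos _).le, ← dist_eq_norm]
        have := BoundedContinuousFunction.dist_coe_le_dist (f := u) (g := w) τ
        calc K * (Real.exp (l * |τ|) * dist (u τ) (w τ))
            ≤ K * (Real.exp (l * |τ|) * dist u w) := by gcongr
          _ = _ := by ring) s
    calc _ ≤ Real.exp (-(l * |s|)) * (K * dist u w / l * Real.exp (l * |s|)) := by gcongr
      _ = K / l * dist u w * (Real.exp (-(l * |s|)) * Real.exp (l * |s|)) := by ring
      _ = _ := by
          rw [hexp, mul_one]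
          have : K / l = 1 / 2 := by simp only [l]; field_simp
          rw [this]; simp
  obtain ⟨u, hu⟩ : ∃ u, G u = u := ⟨_, hcontr.fixedPoint_isFixedPt⟩
  have hZ : A u = fun s => z + ∫ τ in (0 : ℝ)..s, F τ (A u τ) := by
    funext s
    have h1 : u s = Real.exp (-(l * |s|)) • ∫ τ in (0 : ℝ)..s, F τ (A u τ) := by
      rw [← hGapp, hu]
    change z + Real.exp (l * |s|) • u s = _
    rw [h1, smul_smul, mul_comm, hexp, one_smul]
  refine ⟨A u, ?_, fun s => ?_⟩
  · rw [hZ]; simp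
  · have := (hI u s).const_add z
    rw [← hZ] at this
    exact this

theorem IsLipField.exists_solution [CompleteSpace V] (hF : IsLipField K M F) (t : ℝ) (z : V) :
    ∃ Z : ℝ → V, Z t = z ∧ ∀ s, HasDerivAt Z (F s (Z s)) s := by
  have hF' : IsLipField K M (fun s => F (s + t)) :=
    ⟨hF.one_le, hF.cont.comp (by fun_prop : Continuous fun q : ℝ × V => (q.1 + t, q.2)),
      fun s => hF.lip (s + t), fun s => hF.bdd (s + t)⟩
  obtain ⟨Z, h0, hZ⟩ := hF'.exists_solution_zero z
  refine ⟨fun s => Z (s - t), by simpa using h0, fun s => ?_⟩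
  simpa [Function.comp_def] using (hZ (s - t)).scomp s ((hasDerivAt_id s).sub_const t)

open Classical in
/-- `flow F t z s` is the position at time `s` of the trajectory of `F` that passes through `z` at
time `t` (and `0` if there is no such global trajectory). -/
def flow (F : ℝ → V → V) (t : ℝ) (z : V) (s : ℝ) : V :=
  if h : ∃ Z : ℝ → V, Z t = z ∧ ∀ s, HasDerivAt Z (F s (Z s)) s then h.choose s else 0

/-- Two trajectories separate at most exponentially. -/
theorem IsLipField.norm_sub_le (hF : IsLipField K M F) {Z W : ℝ → V}
    (hZ : ∀ s, HasDerivAt Z (F s (Z s)) s) (hW : ∀ s, HasDerivAt W (F s (W s)) s) (t s : ℝ) :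
    ‖Z s - W s‖ ≤ ‖Z t - W t‖ * Real.exp (K * |s - t|) := by
  have := norm_le_gronwallBound_abs (u := fun s => Z s - W s) (t := t) (r := s) (K := K) (ε := 0)
    (fun s => (hZ s).sub (hW s)) le_rfl (fun s _ => by simpa using hF.lip s (Z s) (W s))
  rwa [gronwallBound_ε0] at this

variable [CompleteSpace V]

theorem IsLipField.flow_self (hF : IsLipField K M F) (t : ℝ) (z : V) : flow F t z t = z := by
  have h := hF.exists_solution t z
  simp only [flow, h, dite_true]
  exact h.choose_spec.1

theorem IsLipField.hasDerivAt_flow (hF : IsLipField K M F) (t : ℝ) (z : V) (s : ℝ) :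
    HasDerivAt (flow F t z) (F s (flow F t z s)) s := by
  have h := hF.exists_solution t z
  have e : flow F t z = h.choose := by
    funext s
    simp only [flow, h, dite_true]
  rw [e]
  exact h.choose_spec.2 s

theorem IsLipField.flow_unique (hF : IsLipField K M F) {Z : ℝ → V}
    (hZ : ∀ s, HasDerivAt Z (F s (Z s)) s) (t s : ℝ) : flow F t (Z t) s = Z s := by
  have := hF.norm_sub_le (hF.hasDerivAt_flow t (Z t)) hZ t s
  rw [hF.flow_self, sub_self, norm_zero, zero_mul, norm_le_zero_iff, sub_eq_zero] at this
  exact this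

theorem IsLipField.flow_flow (hF : IsLipField K M F) (t r s : ℝ) (z : V) :
    flow F r (flow F t z r) s = flow F t z s :=
  hF.flow_unique (hF.hasDerivAt_flow t z) r s

theorem IsLipField.norm_flow_sub_le (hF : IsLipField K M F) (t s : ℝ) (z w : V) :
    ‖flow F t z s - flow F t w s‖ ≤ ‖z - w‖ * Real.exp (K * |s - t|) := by
  simpa [hF.flow_self] using
    hF.norm_sub_le (hF.hasDerivAt_flow t z) (hF.hasDerivAt_flow t w) t s

theorem IsLipField.norm_flow_sub_self_le (hF : IsLipField K M F) (t s : ℝ) (z : V) :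
    ‖flow F t z s - z‖ ≤ gronwallBound 0 K (M + K * ‖z‖) |s - t| := by
  refine norm_le_gronwallBound_abs (u := fun s => flow F t z s - z) (t := t) (r := s)
    (fun s => (hF.hasDerivAt_flow t z s).sub_const z) (by simp [hF.flow_self]) (fun s _ => ?_)
  have h1 := hF.lip s (flow F t z s) z
  have h2 := hF.norm_le s z
  have h3 := norm_le_norm_add_norm_sub' (F s (flow F t z s)) (F s z)
  linarith

/-- The flow is jointly continuous in the initial time, the initial point and the final time. -/
theorem IsLipField.continuous_flow (hF : IsLipField K M F) :
    Continuous fun q : ℝ × V × ℝ => flow F q.1 q.2.1 q.2.2 := by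
  have hgr : ∀ C : ℝ, Continuous (gronwallBound 0 K C) := fun C =>
    continuous_iff_continuousAt.2 fun x => (hasDerivAt_gronwallBound 0 K C x).continuousAt
  have hK : K ≠ 0 := by linarith [hF.one_le]
  rw [continuous_iff_continuousAt]
  rintro ⟨t₀, z₀, s₀⟩
  rw [ContinuousAt, tendsto_iff_norm_sub_tendsto_zero]
  -- compare `Z(s;t,z)` with `Z(s;t₀,z₀)`, and the latter with `Z(s₀;t₀,z₀)`
  refine squeeze_zero (fun _ => norm_nonneg _) (g := fun q : ℝ × V × ℝ =>
    (gronwallBound 0 K (M + K * ‖q.2.1‖) |t₀ - q.1| + ‖q.2.1 - z₀‖) * Real.exp (K * |q.2.2 - t₀|)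
      + ‖flow F t₀ z₀ q.2.2 - flow F t₀ z₀ s₀‖) (fun q => ?_) ?_
  · obtain ⟨t, z, s⟩ := q
    have h1 := hF.norm_flow_sub_le t₀ s (flow F t z t₀) z₀
    rw [hF.flow_flow] at h1
    have h2 := hF.norm_flow_sub_self_le t t₀ z
    have h3 : ‖flow F t z t₀ - z₀‖ ≤ ‖flow F t z t₀ - z‖ + ‖z - z₀‖ :=
      norm_sub_le_norm_sub_add_norm_sub _ _ _
    have h4 : ‖flow F t z s - flow F t₀ z₀ s₀‖ ≤ ‖flow F t z s - flow F t₀ z₀ s‖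
      + ‖flow F t₀ z₀ s - flow F t₀ z₀ s₀‖ := norm_sub_le_norm_sub_add_norm_sub _ _ _
    have h5 := Real.exp_pos (K * |s - t₀|)
    simp only
    nlinarith
  · have hc : Continuous (flow F t₀ z₀) :=
      continuous_iff_continuousAt.2 fun s => (hF.hasDerivAt_flow t₀ z₀ s).continuousAt
    have : Continuous fun q : ℝ × V × ℝ =>
      (gronwallBound 0 K (M + K * ‖q.2.1‖) |t₀ - q.1| + ‖q.2.1 - z₀‖) * Real.exp (K * |q.2.2 - t₀|)
      + ‖flow F t₀ z₀ q.2.2 - flow F t₀ z₀ s₀‖ := by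
      simp only [gronwallBound_of_K_ne_0 hK]
      fun_prop
    simpa [gronwallBound_x0] using this.tendsto (t₀, z₀, s₀)

end Flow

/-! ### Differentiability of the flow -/

section FlowDiff

open Filter Topology

/-- If the first-order Taylor remainder of `G t` in space is uniformly small, locally uniformly in
`t`, and `G` is continuous, then the space derivative is jointly continuous, being a locally uniform
limit of difference quotients. -/
theorem continuous_deriv_of_uniform_remainder {V W : Type*} [NormedAddCommGroup V]
    [NormedSpace ℝ V] [FiniteDimensional ℝ V] [NormedAddCommGroup W] [NormedSpace ℝ W]
    {G : ℝ → V → W} {G' : ℝ → V → V →L[ℝ] W} (hG : Continuous fun q : ℝ × V => G q.1 q.2)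
    (hG' : ∀ T ε : ℝ, 0 < ε → ∃ d : ℝ, 0 < d ∧ ∀ t z h, |t| ≤ T → ‖h‖ ≤ d →
      ‖G t (z + h) - G t z - G' t z h‖ ≤ ε * ‖h‖) :
    Continuous fun q : ℝ × V => G' q.1 q.2 := by
  rw [continuous_clm_apply]
  intro e
  rw [continuous_iff_continuousAt]
  rintro ⟨t₀, z₀⟩
  rw [Metric.continuousAt_iff]
  intro ε hε
  have he : 0 < ‖e‖ + 1 := by positivity
  obtain ⟨d, hd, H⟩ := hG' (|t₀| + 1) (ε / (4 * (‖e‖ + 1))) (by positivity)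
  let r : ℝ := d / (‖e‖ + 1)
  have hr : 0 < r := by positivity
  have hre : ‖r • e‖ ≤ d := by
    rw [norm_smul, Real.norm_of_nonneg hr.le]
    have : r * (‖e‖ + 1) = d := by simp only [r]; field_simp
    nlinarith
  have key : ∀ t z, |t| ≤ |t₀| + 1 →
      ‖r⁻¹ • (G t (z + r • e) - G t z) - G' t z e‖ ≤ ε / 4 := by
    intro t z ht
    have h1 := H t z (r • e) ht hre
    have h2 : r⁻¹ • (G t (z + r • e) - G t z) - G' t z e
        = r⁻¹ • (G t (z + r • e) - G t z - G' t z (r • e)) := by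
      rw [map_smul, smul_sub r⁻¹ _ (r • _), smul_smul, inv_mul_cancel₀ hr.ne', one_smul]
    rw [h2, norm_smul, norm_inv, Real.norm_of_nonneg hr.le]
    rw [norm_smul, Real.norm_of_nonneg hr.le] at h1
    calc r⁻¹ * ‖G t (z + r • e) - G t z - G' t z (r • e)‖
        ≤ r⁻¹ * (ε / (4 * (‖e‖ + 1)) * (r * ‖e‖)) := by gcongr
      _ = ε / 4 * (‖e‖ / (‖e‖ + 1)) := by field_simp
      _ ≤ ε / 4 * 1 := by
          gcongr
          rw [div_le_one he]; linarith
      _ = ε / 4 := mul_one _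
  have hq : Continuous fun q : ℝ × V => r⁻¹ • (G q.1 (q.2 + r • e) - G q.1 q.2) := by
    have : Continuous fun q : ℝ × V => G q.1 (q.2 + r • e) :=
      hG.comp (by fun_prop : Continuous fun q : ℝ × V => (q.1, q.2 + r • e))
    exact (this.sub hG).const_smul _
  obtain ⟨δ, hδ, Hδ⟩ := Metric.continuousAt_iff.1 (hq.continuousAt (x := (t₀, z₀))) (ε / 4)
    (by positivity)
  refine ⟨min δ 1, by positivity, fun {q} hqd => ?_⟩
  have h1 := Hδ (lt_of_lt_of_le hqd (min_le_left _ _))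
  have h2 : |q.1| ≤ |t₀| + 1 := by
    have : dist q.1 t₀ < 1 :=
      lt_of_le_of_lt (le_max_left _ _) (lt_of_lt_of_le hqd (min_le_right _ _))
    rw [Real.dist_eq] at this
    have := abs_sub_abs_le_abs_sub q.1 t₀
    linarith
  have h3 := key q.1 q.2 h2
  have h4 := key t₀ z₀ (by linarith [abs_nonneg t₀])
  rw [← dist_eq_norm] at h3 h4
  rw [dist_comm] at h3
  calc dist (G' q.1 q.2 e) (G' t₀ z₀ e) ≤ _ := dist_triangle4 _ _ _ _
    _ ≤ ε / 4 + ε / 4 + ε / 4 := add_le_add (add_le_add h3 h1.le) h4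
    _ < ε := by linarith

variable {V : Type*} [NormedAddCommGroup V] [NormedSpace ℝ V]

/-- Lipschitz fields `F` with a continuous space derivative `DF` such that the first-order Taylor
remainder in space is small uniformly on `ℝ × V`. -/
structure IsDiffField (K M : ℝ) (F : ℝ → V → V) (DF : ℝ → V → V →L[ℝ] V) : Prop
    extends IsLipField K M F where
  contD : Continuous fun q : ℝ × V => DF q.1 q.2
  remainder : ∀ ε : ℝ, 0 < ε → ∃ d : ℝ, 0 < d ∧ ∀ t z h, ‖h‖ ≤ d →
    ‖F t (z + h) - F t z - DF t z h‖ ≤ ε * ‖h‖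

/-- A uniformly small first-order remainder gives differentiability. -/
theorem hasFDerivAt_of_remainder {V W : Type*} [NormedAddCommGroup V]
    [NormedSpace ℝ V] [NormedAddCommGroup W] [NormedSpace ℝ W] {g : V → W} {g' : V →L[ℝ] W} {z : V}
    (h : ∀ ε : ℝ, 0 < ε → ∃ d : ℝ, 0 < d ∧ ∀ h, ‖h‖ ≤ d → ‖g (z + h) - g z - g' h‖ ≤ ε * ‖h‖) :
    HasFDerivAt g g' z := by
  rw [hasFDerivAt_iff_isLittleO_nhds_zero, Asymptotics.isLittleO_iff]
  intro ε hε
  obtain ⟨d, hd, H⟩ := h ε hε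
  filter_upwards [Metric.closedBall_mem_nhds (0 : V) hd] with k hk
  exact H k (by simpa using hk)

variable {K M : ℝ} {F : ℝ → V → V} {DF : ℝ → V → V →L[ℝ] V}

theorem IsDiffField.norm_le_K (hF : IsDiffField K M F DF) (t : ℝ) (z : V) : ‖DF t z‖ ≤ K := by
  have h : HasFDerivAt (F t) (DF t z) z := hasFDerivAt_of_remainder fun ε hε => by
    obtain ⟨d, hd, H⟩ := hF.remainder ε hε
    exact ⟨d, hd, fun k hk => H t z k hk⟩
  exact h.le_of_lip' (by linarith [hF.one_le]) (Eventually.of_forall fun x => hF.lip t x z)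

/-- The field of the linearized equation `Y' = DF(s, Z(s)) Y` along the trajectory through `z` at
time `t`. -/
def linField (F : ℝ → V → V) (DF : ℝ → V → V →L[ℝ] V) (t : ℝ) (z : V) :
    ℝ → (V →L[ℝ] V) → (V →L[ℝ] V) :=
  fun s Y => (DF s (flow F t z s)).comp Y

/-- The space derivative of the flow map. -/
def flowDeriv (F : ℝ → V → V) (DF : ℝ → V → V →L[ℝ] V) (t : ℝ) (z : V) (s : ℝ) : V →L[ℝ] V :=
  flow (linField F DF t z) t (ContinuousLinearMap.id ℝ V) s

variable [CompleteSpace V]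

theorem IsDiffField.linField (hF : IsDiffField K M F DF) (t : ℝ) (z : V) :
    IsLipField K 0 (linField F DF t z) := by
  have hc : Continuous fun s => DF s (flow F t z s) :=
    hF.contD.comp (continuous_id.prodMk (continuous_iff_continuousAt.2 fun s =>
      (hF.hasDerivAt_flow t z s).continuousAt))
  refine ⟨hF.one_le, (hc.comp continuous_fst).clm_comp continuous_snd, fun s X Y => ?_, fun s => ?_⟩
  · unfold Vlasov.linField
    rw [← ContinuousLinearMap.comp_sub]
    refine (ContinuousLinearMap.opNorm_comp_le _ _).trans ?_
    gcongr
    exact hF.norm_le_K _ _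
  · simp [Vlasov.linField]

/-- The flow is differentiable with respect to the initial point, with a remainder that is uniform
in the initial point and locally uniform in time. -/
theorem IsDiffField.flow_remainder (hF : IsDiffField K M F DF) (R ε : ℝ) (hε : 0 < ε) :
    ∃ d : ℝ, 0 < d ∧ ∀ t s z h, |s - t| ≤ R → ‖h‖ ≤ d →
      ‖flow F t (z + h) s - flow F t z s - flowDeriv F DF t z s h‖ ≤ ε * ‖h‖ := by
  have hK : 0 < K := by linarith [hF.one_le]
  let e : ℝ := Real.exp (K * R)
  have he : 0 < e := Real.exp_pos _
  obtain ⟨d, hd, H⟩ := hF.remainder (ε * K / (e * e)) (by positivity)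
  refine ⟨d / e, by positivity, fun t s z h hs hh => ?_⟩
  have hle : ∀ r ∈ uIcc t s, Real.exp (K * |r - t|) ≤ e := fun r hr => by
    refine Real.exp_le_exp.2 (mul_le_mul_of_nonneg_left ?_ hK.le)
    exact (abs_sub_left_of_mem_uIcc hr).trans hs
  have hY := fun r => (hF.linField t z).hasDerivAt_flow t (ContinuousLinearMap.id ℝ V) r
  have hw : ∀ r, HasDerivAt
      (fun r => flow F t (z + h) r - flow F t z r - flowDeriv F DF t z r h)
      (F r (flow F t (z + h) r) - F r (flow F t z r)
        - DF r (flow F t z r) (flowDeriv F DF t z r h)) r := fun r =>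
    ((hF.hasDerivAt_flow t (z + h) r).sub (hF.hasDerivAt_flow t z r)).sub
      (by simpa using! (hY r).clm_apply (hasDerivAt_const r h))
  have hb := norm_le_gronwallBound_abs (t := t) (r := s) (K := K)
    (ε := ε * K / (e * e) * (‖h‖ * e)) (a := 0) hw
    (by simp [hF.flow_self, flowDeriv, (hF.linField t z).flow_self]) (fun r hr => ?_)
  · refine hb.trans ?_
    rw [gronwallBound_of_K_ne_0 hK.ne']
    have h1 := hle s right_mem_uIcc
    calc 0 * Real.exp (K * |s - t|)
          + ε * K / (e * e) * (‖h‖ * e) / K * (Real.exp (K * |s - t|) - 1)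
        ≤ 0 + ε * K / (e * e) * (‖h‖ * e) / K * e := by
          gcongr
          · simp
          · linarith
      _ = ε * ‖h‖ := by field_simp; ring
  · have h1 := hF.norm_flow_sub_le t r (z + h) z
    rw [add_sub_cancel_left] at h1
    have h2 : ‖flow F t (z + h) r - flow F t z r‖ ≤ ‖h‖ * e :=
      h1.trans (mul_le_mul_of_nonneg_left (hle r hr) (norm_nonneg _))
    have h3 := H r (flow F t z r) (flow F t (z + h) r - flow F t z r)
      (h2.trans (by rwa [le_div_iff₀ he] at hh))
    rw [add_sub_cancel] at h3
    have h4 := (DF r (flow F t z r)).le_of_opNorm_le (hF.norm_le_K r (flow F t z r))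
      (flow F t (z + h) r - flow F t z r - flowDeriv F DF t z r h)
    rw [map_sub] at h4
    have h5 : F r (flow F t (z + h) r) - F r (flow F t z r)
        - DF r (flow F t z r) (flowDeriv F DF t z r h)
        = (F r (flow F t (z + h) r) - F r (flow F t z r)
          - DF r (flow F t z r) (flow F t (z + h) r - flow F t z r))
          + (DF r (flow F t z r) (flow F t (z + h) r - flow F t z r)
            - DF r (flow F t z r) (flowDeriv F DF t z r h)) := by abel
    rw [h5]
    refine (norm_add_le _ _).trans ?_
    have h6 : ε * K / (e * e) * ‖flow F t (z + h) r - flow F t z r‖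
        ≤ ε * K / (e * e) * (‖h‖ * e) := by gcongr
    linarith

/-- Differentiability of the flow in the initial time and point, near the final time. -/
theorem IsLipField.hasFDerivAt_flow_near (hF : IsLipField K M F) (t : ℝ) (z : V) :
    HasFDerivAt (fun q : ℝ × V => flow F q.1 q.2 t)
      (ContinuousLinearMap.snd ℝ ℝ V - (ContinuousLinearMap.fst ℝ ℝ V).smulRight (F t z))
      (t, z) := by
  refine HasFDerivAt.of_isLittleO ?_
  rw [Asymptotics.isLittleO_iff]
  intro ε hε
  have hc : Continuous fun q : ℝ × V × ℝ => F q.2.2 (flow F q.1 q.2.1 q.2.2) :=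
    hF.cont.comp ((continuous_snd.comp continuous_snd).prodMk hF.continuous_flow)
  obtain ⟨δ, hδ, H⟩ := Metric.continuousAt_iff.1 (hc.continuousAt (x := (t, z, t))) ε hε
  filter_upwards [Metric.ball_mem_nhds (t, z) hδ] with q hq
  obtain ⟨r, w⟩ := q
  have hq1 : dist r t < δ := lt_of_le_of_lt (le_max_left _ _) hq
  have hq2 : dist w z < δ := lt_of_le_of_lt (le_max_right _ _) hq
  have hb := (convex_uIcc r t).norm_image_sub_le_of_norm_hasDerivWithin_le
    (f := fun s => flow F r w s - s • F t z) (f' := fun s => F s (flow F r w s) - F t z) (C := ε)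
    (x := r) (y := t)
    (fun s _ => ((hF.hasDerivAt_flow r w s).sub
      (by simpa using (hasDerivAt_id s).smul_const (F t z))).hasDerivWithinAt)
    (fun s hs => by
      have : dist (r, w, s) (t, z, t) < δ := by
        simp only [Prod.dist_eq, max_lt_iff]
        refine ⟨hq1, hq2, lt_of_le_of_lt ?_ hq1⟩
        rw [Real.dist_eq, Real.dist_eq, abs_sub_comm s t, abs_sub_comm r t]
        exact abs_sub_right_of_mem_uIcc hs
      have := H this
      simp only [hF.flow_self] at this
      rw [← dist_eq_norm]
      exact this.le) left_mem_uIcc right_mem_uIcc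
  simp only [hF.flow_self] at hb ⊢
  have e1 : flow F r w t - z - (ContinuousLinearMap.snd ℝ ℝ V
      - (ContinuousLinearMap.fst ℝ ℝ V).smulRight (F t z)) ((r, w) - (t, z))
      = flow F r w t - t • F t z - (w - r • F t z) := by
    simp [sub_smul]
    abel
  rw [e1]
  refine hb.trans ?_
  gcongr
  rw [norm_sub_rev]
  exact le_max_left _ _

/-- The map `(t, z) ↦ Z(0; t, z)` is differentiable. -/
theorem IsDiffField.hasFDerivAt_flow_zero (hF : IsDiffField K M F DF) (t : ℝ) (z : V) :
    HasFDerivAt (fun q : ℝ × V => flow F q.1 q.2 0)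
      ((flowDeriv F DF t z 0).comp (ContinuousLinearMap.snd ℝ ℝ V
        - (ContinuousLinearMap.fst ℝ ℝ V).smulRight (F t z))) (t, z) := by
  have h1 : HasFDerivAt (fun w => flow F t w 0) (flowDeriv F DF t z 0) (flow F t z t) := by
    rw [hF.flow_self]
    refine hasFDerivAt_of_remainder fun ε hε => ?_
    obtain ⟨d, hd, H⟩ := hF.flow_remainder |0 - t| ε hε
    exact ⟨d, hd, fun h hh => H t 0 z h le_rfl hh⟩
  have h2 := h1.comp (t, z) (f := fun q : ℝ × V => flow F q.1 q.2 t) (hF.hasFDerivAt_flow_near t z)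
  refine h2.congr_of_eventuallyEq (Eventually.of_forall fun q => ?_)
  exact (hF.flow_flow q.1 t 0 q.2).symm

theorem IsDiffField.continuous_flowDeriv [FiniteDimensional ℝ V] (hF : IsDiffField K M F DF) :
    Continuous fun q : ℝ × V => flowDeriv F DF q.1 q.2 0 := by
  refine continuous_deriv_of_uniform_remainder (G := fun t z => flow F t z 0)
    (G' := fun t z => flowDeriv F DF t z 0) ?_ ?_
  · exact hF.continuous_flow.comp
      (by fun_prop : Continuous fun q : ℝ × V => (q.1, q.2, (0 : ℝ)))
  · intro T ε hε
    obtain ⟨d, hd, H⟩ := hF.flow_remainder T ε hε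
    exact ⟨d, hd, fun t z h ht hh => H t 0 z h (by simpa using ht) hh⟩

theorem IsDiffField.contDiff_flow_zero [FiniteDimensional ℝ V] (hF : IsDiffField K M F DF) :
    ContDiff ℝ 1 fun q : ℝ × V => flow F q.1 q.2 0 := by
  rw [contDiff_one_iff_hasFDerivAt]
  refine ⟨_, ?_, fun q => hF.hasFDerivAt_flow_zero q.1 q.2⟩
  refine hF.continuous_flowDeriv.clm_comp (continuous_const.sub ?_)
  exact (ContinuousLinearMap.smulRightL ℝ (ℝ × V) V
    (ContinuousLinearMap.fst ℝ ℝ V)).continuous.comp hF.cont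

end FlowDiff

/-! ### The relativistic velocity -/

section Velocity

/-- The Lorentz factor `γ(p) = √(1 + a|p|²)`, where `a = 1/c²`. -/
def lorentz (a : ℝ) (p : R3) : ℝ := √(1 + a * ‖p‖ ^ 2)

/-- The velocity `p / γ(p)`, parametrized by `a = 1/c² ∈ [0, 1]`, so that `a = 0` is `c = ∞`. -/
def vel (a : ℝ) (p : R3) : R3 := (lorentz a p)⁻¹ • p

theorem velocity_eq_vel {c : ℝ≥0∞} (hc : 1 ≤ c) :
    ∃ a : ℝ, 0 ≤ a ∧ a ≤ 1 ∧ velocity c = vel a := by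
  by_cases h : c = ∞
  · refine ⟨0, le_rfl, zero_le_one, ?_⟩
    funext p
    simp [velocity, vel, lorentz, h]
  · have h1 : 1 ≤ c.toReal := by
      rw [← ENNReal.toReal_one]
      exact ENNReal.toReal_mono h hc
    refine ⟨(c.toReal ^ 2)⁻¹, by positivity, inv_le_one_of_one_le₀ (one_le_pow₀ h1), ?_⟩
    funext p
    simp only [velocity, vel, lorentz, h, if_false, div_eq_inv_mul]

variable {a : ℝ}

theorem lorentz_sq (ha : 0 ≤ a) (p : R3) : lorentz a p ^ 2 = 1 + a * ‖p‖ ^ 2 :=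
  Real.sq_sqrt (by positivity)

theorem one_le_lorentz (ha : 0 ≤ a) (p : R3) : 1 ≤ lorentz a p :=
  Real.one_le_sqrt.2 (by nlinarith [mul_nonneg ha (sq_nonneg ‖p‖)])

theorem lorentz_pos (ha : 0 ≤ a) (p : R3) : 0 < lorentz a p :=
  one_pos.trans_le (one_le_lorentz ha p)

theorem lorentz_le_bracket (ha1 : a ≤ 1) (p : R3) : lorentz a p ≤ bracket p :=
  Real.sqrt_le_sqrt (by nlinarith [sq_nonneg ‖p‖])

theorem one_le_bracket (p : R3) : 1 ≤ bracket p :=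
  Real.one_le_sqrt.2 (by nlinarith [sq_nonneg ‖p‖])

theorem bracket_pos (p : R3) : 0 < bracket p := one_pos.trans_le (one_le_bracket p)

theorem bracket_sq (p : R3) : bracket p ^ 2 = 1 + ‖p‖ ^ 2 := Real.sq_sqrt (by positivity)

theorem norm_le_bracket (p : R3) : ‖p‖ ≤ bracket p :=
  Real.le_sqrt_of_sq_le (by linarith)

theorem continuous_bracket : Continuous bracket := by
  unfold bracket; fun_prop

theorem bracket_le_mul (x y : R3) : bracket y ≤ (1 + ‖y - x‖) * bracket x := by
  have h1 := norm_le_norm_add_norm_sub' y x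
  have h2 := one_le_bracket x
  have h3 := norm_le_bracket x
  have h4 : bracket y ≤ bracket x + ‖y - x‖ := by
    refine Real.sqrt_le_iff.2 ⟨by positivity, ?_⟩
    have := bracket_sq x
    have h0 := norm_nonneg (y - x)
    have h5 : ‖y‖ ^ 2 ≤ (‖x‖ + ‖y - x‖) ^ 2 := by gcongr
    nlinarith
  nlinarith [norm_nonneg (y - x)]

theorem hasFDerivAt_lorentz (ha : 0 ≤ a) (p : R3) :
    HasFDerivAt (lorentz a) ((a / lorentz a p) • innerSL ℝ p) p := by
  have h1 : HasFDerivAt (fun p : R3 => 1 + a * ‖p‖ ^ 2) (a • (2 • innerSL ℝ p)) p :=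
    ((hasStrictFDerivAt_norm_sq p).hasFDerivAt.const_mul a).const_add 1
  have h2 := h1.sqrt (by positivity)
  convert! h2 using 1
  ext h
  simp [lorentz]
  ring

/-- The derivative `h ↦ (h - a v (v · h)) / γ` of the velocity. -/
def velDeriv (a : ℝ) (p : R3) : R3 →L[ℝ] R3 :=
  (lorentz a p)⁻¹ • (ContinuousLinearMap.id ℝ R3
    - a • (innerSL ℝ (vel a p)).smulRight (vel a p))

theorem velDeriv_apply (a : ℝ) (p h : R3) :
    velDeriv a p h = (lorentz a p)⁻¹ • (h - (a * inner ℝ (vel a p) h) • vel a p) := by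
  simp [velDeriv, smul_smul]

theorem hasFDerivAt_vel (ha : 0 ≤ a) (p : R3) : HasFDerivAt (vel a) (velDeriv a p) p := by
  have hg := lorentz_pos ha p
  have h1 := (hasDerivAt_inv hg.ne').comp_hasFDerivAt p (hasFDerivAt_lorentz ha p)
  have h2 := h1.smul (hasFDerivAt_id p)
  convert! h2 using 1
  ext1 h
  rw [velDeriv_apply]
  simp only [vel, id, add_apply, smul_apply,
    ContinuousLinearMap.smulRight_apply, ContinuousLinearMap.id_apply,
    innerSL_apply_apply, inner_smul_left, smul_smul, smul_eq_mul, sub_eq_add_neg, ← neg_smul]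
  simp
  field_simp
  rw [smul_smul]
  congr 1
  field_simp

theorem mul_norm_vel_sq_le (ha : 0 ≤ a) (p : R3) : a * ‖vel a p‖ ^ 2 ≤ 1 := by
  have hg := lorentz_pos ha p
  rw [vel, norm_smul, norm_inv, Real.norm_of_nonneg hg.le, mul_pow, inv_pow, lorentz_sq ha]
  rw [mul_left_comm, inv_mul_le_one₀ (by positivity)]
  linarith

theorem norm_sub_proj_le (ha : 0 ≤ a) (p h : R3) :
    ‖h - (a * inner ℝ (vel a p) h) • vel a p‖ ≤ ‖h‖ := by
  have h1 := mul_norm_vel_sq_le ha p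
  refine le_of_sq_le_sq ?_ (norm_nonneg _)
  rw [norm_sub_sq_real, inner_smul_right, norm_smul, mul_pow, Real.norm_eq_abs, sq_abs,
    real_inner_comm]
  have h2 : 0 ≤ a * inner ℝ h (vel a p) ^ 2 := by positivity
  nlinarith

theorem norm_velDeriv_apply_le (ha : 0 ≤ a) (p h : R3) : ‖velDeriv a p h‖ ≤ ‖h‖ := by
  rw [velDeriv_apply, norm_smul, norm_inv, Real.norm_of_nonneg (lorentz_pos ha p).le]
  have := norm_sub_proj_le ha p h
  exact (mul_le_of_le_one_left (norm_nonneg _) (inv_le_one_of_one_le₀ (one_le_lorentz ha p))).trans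
    this

theorem norm_vel_sub_le (ha : 0 ≤ a) (p q : R3) : ‖vel a p - vel a q‖ ≤ ‖p - q‖ := by
  have := convex_univ.norm_image_sub_le_of_norm_hasFDerivWithin_le (C := 1) (f := vel a)
    (fun p _ => (hasFDerivAt_vel ha p).hasFDerivWithinAt)
    (fun p _ => ContinuousLinearMap.opNorm_le_bound _ zero_le_one fun h => by
      simpa using norm_velDeriv_apply_le ha p h) (mem_univ q) (mem_univ p)
  simpa using this

theorem abs_lorentz_inv_sub_le (ha : 0 ≤ a) (ha1 : a ≤ 1) (p q : R3) :
    |(lorentz a p)⁻¹ - (lorentz a q)⁻¹| ≤ ‖p - q‖ := by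
  have hp := one_le_lorentz ha p
  have hq := one_le_lorentz ha q
  have h1 : |lorentz a q - lorentz a p| ≤ ‖p - q‖ := by
    have := convex_univ.norm_image_sub_le_of_norm_hasFDerivWithin_le (C := 1) (f := lorentz a)
      (fun p _ => (hasFDerivAt_lorentz ha p).hasFDerivWithinAt)
      (fun p _ => by
        have hg := lorentz_pos ha p
        rw [norm_smul, innerSL_apply_norm, Real.norm_of_nonneg (by positivity), div_mul_eq_mul_div,
          div_le_one hg]
        refine Real.le_sqrt_of_sq_le ?_
        nlinarith [sq_nonneg ‖p‖, mul_nonneg ha (sq_nonneg ‖p‖)]) (mem_univ p) (mem_univ q)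
    rw [norm_sub_rev]
    simpa using this
  rw [inv_sub_inv (by positivity) (by positivity), abs_div]
  refine (div_le_self (abs_nonneg _) ?_).trans h1
  rw [abs_of_pos (by positivity)]
  nlinarith

/-- The derivative of the velocity is Lipschitz, uniformly in the speed of light. -/
theorem norm_velDeriv_sub_le (ha : 0 ≤ a) (ha1 : a ≤ 1) (p q h : R3) :
    ‖velDeriv a p h - velDeriv a q h‖ ≤ 3 * ‖p - q‖ * ‖h‖ := by
  have hgq := one_le_lorentz ha q
  -- with `u = √a v`, the derivative is `γ⁻¹ (h - u (u · h))`, and `|u| ≤ 1`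
  let s : ℝ := √a
  have hs : s * s = a := Real.mul_self_sqrt ha
  have hs0 : 0 ≤ s := Real.sqrt_nonneg a
  have hs1 : s ≤ 1 := Real.sqrt_le_one.2 ha1
  have hu : ∀ r, ‖s • vel a r‖ ≤ 1 := fun r => by
    rw [norm_smul, Real.norm_of_nonneg hs0]
    refine le_of_sq_le_sq ?_ zero_le_one
    rw [mul_pow, pow_two s, hs]
    simpa using mul_norm_vel_sq_le ha r
  have hd : ‖s • vel a p - s • vel a q‖ ≤ ‖p - q‖ := by
    rw [← smul_sub, norm_smul, Real.norm_of_nonneg hs0]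
    have := norm_vel_sub_le ha p q
    nlinarith [norm_nonneg (vel a p - vel a q)]
  have hform : ∀ r, (a * inner ℝ (vel a r) h) • vel a r
      = inner ℝ (s • vel a r) h • (s • vel a r) := fun r => by
    rw [inner_smul_left, smul_smul, ← hs]; congr 1; simp; ring
  have e1 : velDeriv a p h - velDeriv a q h
      = ((lorentz a p)⁻¹ - (lorentz a q)⁻¹) • (h - (a * inner ℝ (vel a p) h) • vel a p)
        - (lorentz a q)⁻¹ • (inner ℝ (s • vel a p) h • (s • vel a p - s • vel a q)
          + inner ℝ (s • vel a p - s • vel a q) h • (s • vel a q)) := by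
    rw [velDeriv_apply, velDeriv_apply, hform p, hform q, inner_sub_left, sub_smul, sub_smul,
      smul_sub (inner ℝ (s • vel a p) h)]
    generalize inner ℝ (s • vel a p) h • (s • vel a p) = A
    generalize inner ℝ (s • vel a q) h • (s • vel a q) = B
    generalize inner ℝ (s • vel a p) h • (s • vel a q) = C
    simp only [smul_sub, smul_add]
    abel
  rw [e1]
  refine (norm_sub_le _ _).trans ?_
  have b1 : ‖((lorentz a p)⁻¹ - (lorentz a q)⁻¹) • (h - (a * inner ℝ (vel a p) h) • vel a p)‖
      ≤ ‖p - q‖ * ‖h‖ := by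
    rw [norm_smul]
    exact mul_le_mul (abs_lorentz_inv_sub_le ha ha1 p q) (norm_sub_proj_le ha p h)
      (norm_nonneg _) (norm_nonneg _)
  have b2 : ‖inner ℝ (s • vel a p) h • (s • vel a p - s • vel a q)‖ ≤ ‖p - q‖ * ‖h‖ := by
    rw [norm_smul, mul_comm]
    refine mul_le_mul hd ?_ (norm_nonneg _) (norm_nonneg _)
    exact (norm_inner_le_norm _ _).trans (mul_le_of_le_one_left (norm_nonneg _) (hu p))
  have b3 : ‖inner ℝ (s • vel a p - s • vel a q) h • (s • vel a q)‖ ≤ ‖p - q‖ * ‖h‖ := by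
    rw [norm_smul]
    refine (mul_le_of_le_one_right (norm_nonneg _) (hu q)).trans ?_
    exact (norm_inner_le_norm _ _).trans (by gcongr)
  have b4 : ‖(lorentz a q)⁻¹ • (inner ℝ (s • vel a p) h • (s • vel a p - s • vel a q)
          + inner ℝ (s • vel a p - s • vel a q) h • (s • vel a q))‖ ≤ 2 * (‖p - q‖ * ‖h‖) := by
    rw [norm_smul, norm_inv, Real.norm_of_nonneg (by positivity)]
    refine (mul_le_of_le_one_left (norm_nonneg _) (inv_le_one_of_one_le₀ hgq)).trans ?_
    exact (norm_add_le _ _).trans (by linarith)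
  linarith

theorem continuous_vel (ha : 0 ≤ a) : Continuous (vel a) :=
  continuous_iff_continuousAt.2 fun p => (hasFDerivAt_vel ha p).continuousAt

theorem continuous_lorentz (ha : 0 ≤ a) : Continuous (lorentz a) :=
  continuous_iff_continuousAt.2 fun p => (hasFDerivAt_lorentz ha p).continuousAt

theorem continuous_velDeriv (ha : 0 ≤ a) : Continuous (velDeriv a) := by
  rw [continuous_clm_apply]
  intro h
  simp only [velDeriv_apply]
  have h1 := continuous_vel ha
  have h2 : Continuous fun p => (lorentz a p)⁻¹ :=
    (continuous_lorentz ha).inv₀ fun p => (lorentz_pos ha p).ne'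
  exact h2.smul (by fun_prop)

/-- The field `A(p) e`, where `A(p)` is the inverse of the derivative of the velocity. -/
def velInv (a : ℝ) (e p : R3) : R3 := lorentz a p • (e + (a * inner ℝ p e) • p)

theorem velDeriv_velInv (ha : 0 ≤ a) (e p : R3) : velDeriv a p (velInv a e p) = e := by
  have hg := lorentz_pos ha p
  have hsq := lorentz_sq ha p
  rw [velDeriv_apply]
  simp only [velInv, vel, inner_smul_left, inner_smul_right, inner_add_right, smul_sub, smul_smul,
    smul_add, real_inner_self_eq_norm_sq, RCLike.conj_to_real]
  rw [inv_mul_cancel₀ hg.ne', one_smul, add_sub_assoc, ← sub_smul]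
  convert add_zero e using 2
  rw [smul_eq_zero]
  left
  field_simp
  rw [hsq]
  ring

theorem norm_velInv_le (ha : 0 ≤ a) (ha1 : a ≤ 1) (e p : R3) :
    ‖velInv a e p‖ ≤ bracket p ^ 3 * ‖e‖ := by
  have h0 := bracket_sq p
  rw [velInv, norm_smul, Real.norm_of_nonneg (lorentz_pos ha p).le]
  have h1 : ‖e + (a * inner ℝ p e) • p‖ ≤ bracket p ^ 2 * ‖e‖ := by
    rw [h0]
    refine (norm_add_le _ _).trans ?_
    rw [norm_smul, norm_mul, Real.norm_of_nonneg ha]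
    have h2 := norm_inner_le_norm (𝕜 := ℝ) p e
    have : a * ‖inner ℝ p e‖ * ‖p‖ ≤ 1 * (‖p‖ * ‖e‖) * ‖p‖ := by gcongr
    linarith
  calc _ ≤ bracket p * (bracket p ^ 2 * ‖e‖) := by
        gcongr
        · exact (bracket_pos p).le
        · exact lorentz_le_bracket ha1 p
    _ = _ := by ring

/-- The derivative of `p ↦ A(p) e`. -/
def velInvDeriv (a : ℝ) (e p : R3) : R3 →L[ℝ] R3 :=
  ((a / lorentz a p) • innerSL ℝ p).smulRight (e + (a * inner ℝ p e) • p)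
    + lorentz a p • ((a * inner ℝ p e) • ContinuousLinearMap.id ℝ R3
      + (a • innerSL ℝ e).smulRight p)

theorem hasFDerivAt_velInv (ha : 0 ≤ a) (e p : R3) :
    HasFDerivAt (velInv a e) (velInvDeriv a e p) p := by
  have h1 : HasFDerivAt (fun p : R3 => a * inner ℝ p e) (a • innerSL ℝ e) p := by
    have := (innerSL ℝ e).hasFDerivAt (x := p)
    simp only [real_inner_comm e]
    exact this.const_mul a
  have h2 := (hasFDerivAt_lorentz ha p).smul ((h1.smul (hasFDerivAt_id p)).const_add e)
  convert! h2 using 1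
  ext1 h
  simp [velInvDeriv]
  abel

theorem norm_velInvDeriv_le (ha : 0 ≤ a) (ha1 : a ≤ 1) (e p : R3) :
    ‖velInvDeriv a e p‖ ≤ 3 * bracket p ^ 3 * ‖e‖ := by
  have hg := lorentz_pos ha p
  have h0 := bracket_sq p
  have hb1 := one_le_bracket p
  have hin := norm_inner_le_norm (𝕜 := ℝ) p e
  have h1 : ‖e + (a * inner ℝ p e) • p‖ ≤ bracket p ^ 2 * ‖e‖ := by
    rw [h0]
    refine (norm_add_le _ _).trans ?_
    rw [norm_smul, norm_mul, Real.norm_of_nonneg ha]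
    have : a * ‖inner ℝ p e‖ * ‖p‖ ≤ 1 * (‖p‖ * ‖e‖) * ‖p‖ := by gcongr
    linarith
  have hap : a / lorentz a p * ‖p‖ ≤ 1 := by
    rw [div_mul_eq_mul_div, div_le_one hg]
    refine Real.le_sqrt_of_sq_le ?_
    nlinarith [sq_nonneg ‖p‖, mul_nonneg ha (sq_nonneg ‖p‖)]
  have t1 : ‖((a / lorentz a p) • innerSL ℝ p).smulRight (e + (a * inner ℝ p e) • p)‖
      ≤ bracket p ^ 2 * ‖e‖ := by
    rw [ContinuousLinearMap.norm_smulRight_apply, norm_smul, innerSL_apply_norm,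
      Real.norm_of_nonneg (by positivity)]
    exact (mul_le_of_le_one_left (norm_nonneg _) hap).trans h1
  have t2 : ‖(a * inner ℝ p e) • ContinuousLinearMap.id ℝ R3‖ ≤ bracket p * ‖e‖ := by
    rw [norm_smul, norm_mul, Real.norm_of_nonneg ha]
    have h3 := ContinuousLinearMap.norm_id_le (𝕜 := ℝ) (E := R3)
    calc a * ‖inner ℝ p e‖ * ‖ContinuousLinearMap.id ℝ R3‖ ≤ 1 * (bracket p * ‖e‖) * 1 := by
          gcongr
          exact hin.trans (by gcongr; exact norm_le_bracket p)
      _ = _ := by ring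
  have t3 : ‖(a • innerSL ℝ e).smulRight p‖ ≤ bracket p * ‖e‖ := by
    rw [ContinuousLinearMap.norm_smulRight_apply, norm_smul, innerSL_apply_norm,
      Real.norm_of_nonneg ha]
    calc a * ‖e‖ * ‖p‖ ≤ 1 * ‖e‖ * bracket p := by gcongr; exact norm_le_bracket p
      _ = _ := by ring
  have t4 : ‖lorentz a p • ((a * inner ℝ p e) • ContinuousLinearMap.id ℝ R3
      + (a • innerSL ℝ e).smulRight p)‖ ≤ bracket p * (bracket p * ‖e‖ + bracket p * ‖e‖) := by
    rw [norm_smul, Real.norm_of_nonneg hg.le]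
    gcongr
    · exact lorentz_le_bracket ha1 p
    · exact (norm_add_le _ _).trans (add_le_add t2 t3)
  refine (norm_add_le _ _).trans ((add_le_add t1 t4).trans ?_)
  have h4 : bracket p ^ 2 ≤ bracket p ^ 3 := pow_le_pow_right₀ hb1 (by norm_num)
  nlinarith [norm_nonneg e]

theorem vel_injective (ha : 0 ≤ a) : Function.Injective (vel a) := by
  intro p q h
  have hp := lorentz_pos ha p
  have hq := lorentz_pos ha q
  have h1 : ‖vel a p‖ ^ 2 * lorentz a p ^ 2 = ‖p‖ ^ 2 := by
    rw [vel, norm_smul, norm_inv, Real.norm_of_nonneg hp.le]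
    field_simp
  have h2 : ‖vel a q‖ ^ 2 * lorentz a q ^ 2 = ‖q‖ ^ 2 := by
    rw [vel, norm_smul, norm_inv, Real.norm_of_nonneg hq.le]
    field_simp
  have h3 : lorentz a p ^ 2 = lorentz a q ^ 2 := by
    rw [← h, lorentz_sq ha] at h2
    rw [lorentz_sq ha] at h1
    rw [lorentz_sq ha, lorentz_sq ha]
    have h4 : (‖p‖ ^ 2 - ‖q‖ ^ 2) * (1 - a * ‖vel a p‖ ^ 2) = 0 := by linear_combination -h1 + h2
    have h5 : a * ‖vel a p‖ ^ 2 < 1 := by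
      have : a * ‖vel a p‖ ^ 2 * lorentz a p ^ 2 < lorentz a p ^ 2 := by
        rw [lorentz_sq ha, mul_assoc, h1]; linarith
      have hl : 0 < lorentz a p ^ 2 := by positivity
      nlinarith
    rcases mul_eq_zero.1 h4 with h6 | h6
    · rw [sub_eq_zero.1 h6]
    · linarith
  have h6 : lorentz a p = lorentz a q := (sq_eq_sq₀ hp.le hq.le).1 h3
  have h7 : (lorentz a p)⁻¹ • p = (lorentz a p)⁻¹ • q := by
    have := h
    simp only [vel] at this
    rw [this, h6]
  exact smul_right_injective _ (inv_ne_zero hp.ne') h7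

theorem det_velDeriv (ha : 0 ≤ a) (p : R3) : (velDeriv a p).det = (lorentz a p ^ 5)⁻¹ := by
  have hp := lorentz_pos ha p
  have hsq := lorentz_sq ha p
  rw [EuclideanSpace.norm_sq_eq, Fin.sum_univ_three] at hsq
  simp only [Real.norm_eq_abs, sq_abs] at hsq
  have h1 : (velDeriv a p).det = LinearMap.det (velDeriv a p : R3 →ₗ[ℝ] R3) := rfl
  rw [h1, ← LinearMap.det_toMatrix (EuclideanSpace.basisFun (Fin 3) ℝ).toBasis,
    Matrix.det_fin_three]
  simp only [LinearMap.toMatrix_apply, OrthonormalBasis.coe_toBasis,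
    OrthonormalBasis.coe_toBasis_repr_apply, EuclideanSpace.basisFun_apply,
    EuclideanSpace.basisFun_repr, ContinuousLinearMap.coe_coe, velDeriv_apply]
  simp [vel, EuclideanSpace.inner_single_right]
  field_simp
  linear_combination (lorentz a p ^ 4) * hsq

end Velocity

/-! ### Dispersion of freely transported weights -/

section Density

/-- The weight `⟨x - t v(p)⟩^{-κ} ⟨p⟩^{-5}`: the profile `⟨x⟩^{-κ} ⟨p⟩^{-5}` transported by the free
flow. -/
def weight (κ a t : ℝ) (x p : R3) : ℝ :=
  bracket (x - t • vel a p) ^ (-κ) * (bracket p ^ 5)⁻¹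

variable {κ a : ℝ}

theorem weight_pos (t : ℝ) (x p : R3) : 0 < weight κ a t x p := by
  have := bracket_pos (x - t • vel a p)
  have := bracket_pos p
  unfold weight
  positivity

theorem bracket_rpow_le_one (hκ : 0 < κ) (x : R3) : bracket x ^ (-κ) ≤ 1 :=
  Real.rpow_le_one_of_one_le_of_nonpos (one_le_bracket x) (by linarith)

theorem weight_le (hκ : 0 < κ) (t : ℝ) (x p : R3) : weight κ a t x p ≤ (bracket p ^ 5)⁻¹ := by
  have := bracket_pos p
  exact mul_le_of_le_one_left (by positivity) (bracket_rpow_le_one hκ _)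

theorem continuous_bracket_rpow : Continuous fun x : R3 => bracket x ^ (-κ) :=
  continuous_bracket.rpow_const fun x => Or.inl (bracket_pos x).ne'

theorem continuous_weight (ha : 0 ≤ a) :
    Continuous fun q : ℝ × R3 × R3 => weight κ a q.1 q.2.1 q.2.2 := by
  have h1 := continuous_vel ha
  have h2 := continuous_bracket
  refine (continuous_bracket_rpow.comp
    (by fun_prop : Continuous fun q : ℝ × R3 × R3 => q.2.1 - q.1 • vel a q.2.2)).mul ?_
  refine Continuous.inv₀ (by fun_prop) fun q => ?_
  have := bracket_pos q.2.2
  positivity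

theorem integrable_bracket_rpow (hκ : 3 < κ) : Integrable fun x : R3 => bracket x ^ (-κ) := by
  have := integrable_rpow_neg_one_add_norm_sq (E := R3) (μ := volume) (r := κ) (by simpa using hκ)
  refine this.congr (Filter.Eventually.of_forall fun x => ?_)
  simp only [bracket]
  rw [Real.sqrt_eq_rpow, ← Real.rpow_mul (by positivity)]
  congr 1
  ring

theorem integrable_bracket_pow_inv {n : ℕ} (hn : 3 < n) :
    Integrable fun x : R3 => (bracket x ^ n)⁻¹ := by
  have := integrable_bracket_rpow (κ := n) (by exact_mod_cast hn)
  refine this.congr (Filter.Eventually.of_forall fun x => ?_)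
  simp only
  rw [Real.rpow_neg (bracket_pos x).le, Real.rpow_natCast]

theorem lintegral_ofReal_eq_ofReal_integral {α : Type*} [MeasurableSpace α] {μ : Measure α}
    {f : α → ℝ}
    (hf : Integrable f μ) (h0 : ∀ x, 0 ≤ f x) :
    ∫⁻ x, ENNReal.ofReal (f x) ∂μ = ENNReal.ofReal (∫ x, f x ∂μ) :=
  (ofReal_integral_eq_lintegral_ofReal hf (Filter.Eventually.of_forall h0)).symm

theorem lintegral_comp_sub_smul {φ : R3 → ℝ≥0∞} (hφ : Measurable φ) (x : R3) {t : ℝ} (ht : 0 < t) :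
    ∫⁻ u, φ (x - t • u) = ENNReal.ofReal ((t ^ 3)⁻¹) * ∫⁻ y, φ y := by
  have h1 : ∫⁻ u, φ (x - t • u) = ∫⁻ y, φ (x - y) ∂(Measure.map (fun u : R3 => t • u) volume) := by
    rw [lintegral_map (f := fun y => φ (x - y)) (hφ.comp (measurable_const.sub measurable_id))
      (measurable_const_smul t)]
  rw [h1, Measure.map_addHaar_smul _ ht.ne', lintegral_smul_measure,
    lintegral_sub_left_eq_self φ x]
  simp [abs_of_pos ht]

/-- Change of variables `u = v(p)`: the Jacobian of `v` is at least `⟨p⟩^{-5}`. -/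
theorem lintegral_comp_vel_le (ha : 0 ≤ a) (ha1 : a ≤ 1) (φ : R3 → ℝ≥0∞) :
    ∫⁻ p, ENNReal.ofReal ((bracket p ^ 5)⁻¹) * φ (vel a p) ≤ ∫⁻ u, φ u := by
  have h1 := lintegral_image_eq_lintegral_abs_det_fderiv_mul volume MeasurableSet.univ
    (fun p _ => (hasFDerivAt_vel ha p).hasFDerivWithinAt) (vel_injective ha).injOn φ
  rw [Measure.restrict_univ] at h1
  calc _ ≤ ∫⁻ p, ENNReal.ofReal |(velDeriv a p).det| * φ (vel a p) := by
        refine lintegral_mono fun p => mul_le_mul_left ?_ _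
        have hp := lorentz_pos ha p
        rw [det_velDeriv ha, abs_of_pos (by positivity)]
        refine ENNReal.ofReal_le_ofReal (inv_anti₀ (by positivity) ?_)
        have := lorentz_le_bracket ha1 p
        gcongr
    _ = ∫⁻ u in vel a '' univ, φ u := h1.symm
    _ ≤ _ := setLIntegral_le_lintegral _ _

/-- The freely transported weight has a density of size `(1 + t)^{-3}` and a finite mass, uniformly
in the speed of light. -/
theorem exists_weight_bound (hκ : 3 < κ) :
    ∃ C : ℝ, 0 < C ∧ ∀ a : ℝ, 0 ≤ a → a ≤ 1 → ∀ t : ℝ, 0 ≤ t →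
    (∀ x, ∫⁻ p, ENNReal.ofReal (weight κ a t x p) ≤ ENNReal.ofReal (C * ((1 + t) ^ 3)⁻¹)) ∧
    ∫⁻ x, ∫⁻ p, ENNReal.ofReal (weight κ a t x p) ≤ ENNReal.ofReal C := by
  let J : ℝ := ∫ x : R3, bracket x ^ (-κ)
  let I : ℝ := ∫ p : R3, (bracket p ^ 5)⁻¹
  have hJ0 : ∀ x : R3, 0 ≤ bracket x ^ (-κ) := fun x => Real.rpow_nonneg (bracket_pos x).le _
  have hI0 : ∀ x : R3, 0 ≤ (bracket x ^ 5)⁻¹ := fun x => by have := bracket_pos x; positivity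
  have hJ := lintegral_ofReal_eq_ofReal_integral (integrable_bracket_rpow hκ) hJ0
  have hI := lintegral_ofReal_eq_ofReal_integral
    (integrable_bracket_pow_inv (n := 5) (by norm_num)) hI0
  have hJn : 0 ≤ J := integral_nonneg hJ0
  have hIn : 0 ≤ I := integral_nonneg hI0
  have hmeas : Measurable fun x : R3 => ENNReal.ofReal (bracket x ^ (-κ)) :=
    (continuous_bracket_rpow.measurable).ennreal_ofReal
  refine ⟨8 * (I + J) + I * J + 1, by positivity, fun a ha ha1 t ht => ⟨fun x => ?_, ?_⟩⟩
  · rcases le_total t 1 with h | h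
    · calc ∫⁻ p, ENNReal.ofReal (weight κ a t x p)
          ≤ ∫⁻ p, ENNReal.ofReal ((bracket p ^ 5)⁻¹) :=
            lintegral_mono fun p => ENNReal.ofReal_le_ofReal (weight_le (by linarith) t x p)
        _ = ENNReal.ofReal I := hI
        _ ≤ _ := by
            refine ENNReal.ofReal_le_ofReal ?_
            rw [← div_eq_mul_inv, le_div_iff₀ (by positivity)]
            have : (1 + t) ^ 3 ≤ 2 ^ 3 := by gcongr; linarith
            nlinarith [mul_nonneg hIn hJn]
    · have ht0 : 0 < t := by linarith
      calc ∫⁻ p, ENNReal.ofReal (weight κ a t x p)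
          = ∫⁻ p, ENNReal.ofReal ((bracket p ^ 5)⁻¹)
              * ENNReal.ofReal (bracket (x - t • vel a p) ^ (-κ)) := by
            refine lintegral_congr fun p => ?_
            rw [weight, mul_comm, ENNReal.ofReal_mul (hI0 p)]
        _ ≤ ∫⁻ u, ENNReal.ofReal (bracket (x - t • u) ^ (-κ)) :=
            lintegral_comp_vel_le ha ha1 fun u => ENNReal.ofReal (bracket (x - t • u) ^ (-κ))
        _ = ENNReal.ofReal ((t ^ 3)⁻¹) * ENNReal.ofReal J := by
            rw [lintegral_comp_sub_smul hmeas x ht0, hJ]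
        _ ≤ _ := by
            rw [← ENNReal.ofReal_mul (by positivity)]
            refine ENNReal.ofReal_le_ofReal ?_
            rw [← div_eq_mul_inv, inv_mul_eq_div, div_le_div_iff₀ (by positivity) (by positivity)]
            have h2 : (1 + t) ^ 3 ≤ (2 * t) ^ 3 := by gcongr; linarith
            calc J * (1 + t) ^ 3 ≤ J * (2 * t) ^ 3 := by gcongr
              _ = 8 * J * t ^ 3 := by ring
              _ ≤ _ := by gcongr; nlinarith [mul_nonneg hIn hJn]
  · have hm : Measurable fun q : R3 × R3 => ENNReal.ofReal (weight κ a t q.1 q.2) :=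
      ((continuous_weight ha).comp (by fun_prop : Continuous fun q : R3 × R3 =>
        (t, q.1, q.2))).measurable.ennreal_ofReal
    rw [lintegral_lintegral_swap hm.aemeasurable]
    have : ∀ p : R3, ∫⁻ x, ENNReal.ofReal (weight κ a t x p)
        = ENNReal.ofReal J * ENNReal.ofReal ((bracket p ^ 5)⁻¹) := fun p => by
      simp only [weight]
      simp_rw [fun x => ENNReal.ofReal_mul (q := (bracket p ^ 5)⁻¹) (hJ0 (x - t • vel a p))]
      rw [lintegral_mul_const' _ _ ENNReal.ofReal_ne_top,
        lintegral_sub_right_eq_self (fun x => ENNReal.ofReal (bracket x ^ (-κ))) (t • vel a p), hJ]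
    simp_rw [this]
    rw [lintegral_const_mul' _ _ ENNReal.ofReal_ne_top, hI, ← ENNReal.ofReal_mul hJn]
    refine ENNReal.ofReal_le_ofReal ?_
    change J * I ≤ _
    nlinarith

/-- The transported weight varies by a bounded factor when its arguments move by a bounded
amount. -/
theorem bracket_weight_le (hκ : 0 < κ) {r : ℝ} (n : ℕ) {x y p q : R3} (hx : ‖x - y‖ ≤ r)
    (hp : ‖p - q‖ ≤ r) : bracket y ^ (-κ) * (bracket q ^ n)⁻¹
      ≤ ((1 + r) ^ κ * (1 + r) ^ n) * (bracket x ^ (-κ) * (bracket p ^ n)⁻¹) := by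
  have hr : 0 ≤ r := (norm_nonneg _).trans hx
  have h1 : bracket x ≤ (1 + r) * bracket y :=
    (bracket_le_mul y x).trans (mul_le_mul_of_nonneg_right (by linarith) (bracket_pos y).le)
  have h2 : bracket p ≤ (1 + r) * bracket q :=
    (bracket_le_mul q p).trans (mul_le_mul_of_nonneg_right (by linarith) (bracket_pos q).le)
  have bx := bracket_pos x
  have by' := bracket_pos y
  have bp := bracket_pos p
  have bq := bracket_pos q
  have h3 : bracket y ^ (-κ) ≤ (1 + r) ^ κ * bracket x ^ (-κ) := by
    rw [Real.rpow_neg by'.le, Real.rpow_neg bx.le, ← div_eq_mul_inv, le_div_iff₀ (by positivity),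
      inv_mul_le_iff₀ (by positivity), mul_comm, ← Real.mul_rpow (by positivity) by'.le]
    exact Real.rpow_le_rpow bx.le h1 hκ.le
  have h4 : (bracket q ^ n)⁻¹ ≤ (1 + r) ^ n * (bracket p ^ n)⁻¹ := by
    rw [← div_eq_mul_inv, le_div_iff₀ (by positivity),
      inv_mul_le_iff₀ (by positivity), mul_comm, ← mul_pow]
    gcongr
  calc _ ≤ ((1 + r) ^ κ * bracket x ^ (-κ)) * ((1 + r) ^ n * (bracket p ^ n)⁻¹) := by gcongr
    _ = _ := by ring

end Density

/-! ### Convolution with a short-range kernel -/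

section Kernel

open Filter Topology

/-- Locally integrable kernels that decay like `|x|^{-(α+1)}` at infinity. -/
structure IsKernel (α : ℝ) (K : R3 → R3) : Prop where
  locallyIntegrable : LocallyIntegrable K volume
  decay : ∃ C R : ℝ, ∀ x, R ≤ ‖x‖ → ‖K x‖ ≤ C * ‖x‖ ^ (-(α + 1))

variable {α : ℝ} {K : R3 → R3}

theorem IsKernel.decay_pos (hK : IsKernel α K) :
    ∃ C R : ℝ, 0 < C ∧ 1 ≤ R ∧ ∀ x, R ≤ ‖x‖ → ‖K x‖ ≤ C * ‖x‖ ^ (-(α + 1)) := by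
  obtain ⟨C, R, h⟩ := hK.decay
  refine ⟨max C 1, max R 1, by positivity, le_max_right _ _, fun x hx => ?_⟩
  refine (h x ((le_max_left _ _).trans hx)).trans ?_
  gcongr
  exact le_max_left _ _

theorem IsKernel.integrableOn_closedBall (hK : IsKernel α K) (R : ℝ) :
    IntegrableOn K (Metric.closedBall 0 R) :=
  hK.locallyIntegrable.integrableOn_isCompact (isCompact_closedBall 0 R)

theorem IsKernel.aestronglyMeasurable_sub_left (hK : IsKernel α K) (x : R3) :
    AEStronglyMeasurable (fun y => K (x - y)) volume :=
  hK.locallyIntegrable.aestronglyMeasurable.comp_quasiMeasurePreserving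
    (quasiMeasurePreserving_sub_left volume x)

/-- `∫_{|z| ≤ s} |z|^{-(α+1)} dz` is of order `s^{2-α}`. -/
theorem lintegral_ball_rpow (hα : α < 2) : ∃ C : ℝ, 0 < C ∧ ∀ s : ℝ, 0 < s →
    ∫⁻ z in Metric.closedBall (0 : R3) s, ENNReal.ofReal (‖z‖ ^ (-(α + 1)))
      ≤ ENNReal.ofReal (C * s ^ (2 - α)) := by
  have hint : IntegrableOn (fun z : R3 => ‖z‖ ^ (-(α + 1))) (Metric.ball 0 2) := by
    rw [integrableOn_fun_norm_addHaar volume (f := fun r : ℝ => r ^ (-(α + 1)))]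
    refine ((intervalIntegral.integrableOn_Ioo_rpow_iff (s := 1 - α) two_pos).2
      (by linarith)).congr_fun (fun r hr => ?_) measurableSet_Ioo
    have h0 : 0 < r := hr.1
    simp only [finrank_euclideanSpace, Fintype.card_fin, smul_eq_mul]
    rw [← Real.rpow_natCast, ← Real.rpow_add h0]
    congr 1
    push_cast
    ring
  let D : ℝ := ∫ z in Metric.ball (0 : R3) 2, ‖z‖ ^ (-(α + 1))
  have hn : ∀ z : R3, 0 ≤ ‖z‖ ^ (-(α + 1)) := fun z => Real.rpow_nonneg (norm_nonneg _) _
  have hD0 : 0 ≤ D := integral_nonneg hn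
  have hD : ∫⁻ z in Metric.ball (0 : R3) 2, ENNReal.ofReal (‖z‖ ^ (-(α + 1))) = ENNReal.ofReal D :=
    lintegral_ofReal_eq_ofReal_integral hint hn
  have hmeas : Measurable fun z : R3 => ENNReal.ofReal (‖z‖ ^ (-(α + 1))) := by fun_prop
  refine ⟨D + 1, by positivity, fun s hs => ?_⟩
  let φ : R3 → ℝ≥0∞ := (Metric.closedBall (0 : R3) s).indicator
    fun z => ENNReal.ofReal (‖z‖ ^ (-(α + 1)))
  have hφ : Measurable φ := hmeas.indicator Metric.isClosed_closedBall.measurableSet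
  have h1 := lintegral_comp_sub_smul hφ 0 hs
  -- rescale to the unit ball
  have h2 : ∀ u : R3, φ (0 - s • u) ≤ ENNReal.ofReal (s ^ (-(α + 1)))
      * (Metric.ball (0 : R3) 2).indicator (fun z => ENNReal.ofReal (‖z‖ ^ (-(α + 1)))) u := by
    intro u
    by_cases hu : s • u ∈ Metric.closedBall (0 : R3) s
    · have hu1 : u ∈ Metric.ball (0 : R3) 2 := by
        simp only [mem_closedBall_zero_iff, norm_smul, Real.norm_of_nonneg hs.le] at hu
        rw [mem_ball_zero_iff]
        nlinarith
      have hu2 : -(s • u) ∈ Metric.closedBall (0 : R3) s := by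
        rwa [mem_closedBall_zero_iff, norm_neg, ← mem_closedBall_zero_iff]
      simp only [φ]
      rw [zero_sub, indicator_of_mem hu1, indicator_of_mem hu2, norm_neg, norm_smul,
        Real.norm_of_nonneg hs.le, Real.mul_rpow hs.le (norm_nonneg _),
        ENNReal.ofReal_mul (by positivity)]
    · have hu2 : -(s • u) ∉ Metric.closedBall (0 : R3) s := by
        rwa [mem_closedBall_zero_iff, norm_neg, ← mem_closedBall_zero_iff]
      simp only [φ]
      rw [zero_sub, indicator_of_notMem hu2]
      exact zero_le
  have h3 : ENNReal.ofReal ((s ^ 3)⁻¹) * ∫⁻ y, φ y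
      ≤ ENNReal.ofReal (s ^ (-(α + 1))) * ENNReal.ofReal D := by
    rw [← h1, ← hD, ← lintegral_indicator Metric.isOpen_ball.measurableSet,
      ← lintegral_const_mul' _ _ ENNReal.ofReal_ne_top]
    exact lintegral_mono h2
  rw [← lintegral_indicator Metric.isClosed_closedBall.measurableSet]
  change ∫⁻ y, φ y ≤ _
  calc ∫⁻ y, φ y = ENNReal.ofReal (s ^ 3) * (ENNReal.ofReal ((s ^ 3)⁻¹) * ∫⁻ y, φ y) := by
        rw [← mul_assoc, ← ENNReal.ofReal_mul (by positivity), mul_inv_cancel₀ (by positivity)]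
        simp
    _ ≤ ENNReal.ofReal (s ^ 3) * (ENNReal.ofReal (s ^ (-(α + 1))) * ENNReal.ofReal D) := by gcongr
    _ = ENNReal.ofReal (D * s ^ (2 - α)) := by
        rw [← ENNReal.ofReal_mul (by positivity), ← ENNReal.ofReal_mul (by positivity)]
        congr 1
        rw [show 2 - α = (3 : ℕ) + (-(α + 1)) by push_cast; ring, Real.rpow_add hs,
          Real.rpow_natCast]
        ring
    _ ≤ _ := by
        refine ENNReal.ofReal_le_ofReal ?_
        gcongr
        linarith

/-- Interpolation between the near field, controlled by the supremum of `φ`, and the far field,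
controlled by its mass; `r` is the splitting radius. -/
theorem IsKernel.exists_lintegral_le (hα₁ : 1 < α) (hα₂ : α < 2) (hK : IsKernel α K) :
    ∃ C : ℝ, 0 < C ∧ ∀ (A B r : ℝ) (φ : R3 → ℝ≥0∞), 0 ≤ A → 0 ≤ B → 1 ≤ r → AEMeasurable φ →
      (∀ y, φ y ≤ ENNReal.ofReal A) → ∫⁻ y, φ y ≤ ENNReal.ofReal B → ∀ x,
      ∫⁻ y, ‖K (x - y)‖ₑ * φ y ≤ ENNReal.ofReal (C * (r ^ (2 - α) * A + r ^ (-(α + 1)) * B)) := by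
  obtain ⟨C₀, R, hC₀, hR, hd⟩ := hK.decay_pos
  obtain ⟨C₁, hC₁, hb⟩ := lintegral_ball_rpow hα₂
  let N : ℝ := ∫ z in Metric.closedBall (0 : R3) R, ‖K z‖
  have hN0 : 0 ≤ N := integral_nonneg fun _ => norm_nonneg _
  have hN : ∫⁻ z in Metric.closedBall (0 : R3) R, ‖K z‖ₑ = ENNReal.ofReal N :=
    (ofReal_integral_norm_eq_lintegral_enorm (hK.integrableOn_closedBall R)).symm
  refine ⟨N + C₀ * (C₁ * R ^ (2 - α)) + C₀, by positivity, ?_⟩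
  intro A B r φ hA hB hr hφ hφA hφB x
  have hRr : R ≤ R * r := le_mul_of_one_le_right (by linarith) hr
  have hRr0 : 0 < R * r := by positivity
  have hr0 : 0 < r := by linarith
  -- the mass of the kernel in the ball of radius `R r`
  have hball : ∫⁻ z in Metric.closedBall (0 : R3) (R * r), ‖K z‖ₑ
      ≤ ENNReal.ofReal ((N + C₀ * (C₁ * R ^ (2 - α))) * r ^ (2 - α)) := by
    have hsub : Metric.closedBall (0 : R3) (R * r) ⊆ Metric.closedBall 0 R
        ∪ (Metric.closedBall (0 : R3) (R * r) \ Metric.closedBall 0 R) := by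
      rw [union_sdiff_self]; exact subset_union_right
    calc _ ≤ ∫⁻ z in Metric.closedBall (0 : R3) R ∪ (Metric.closedBall (0 : R3) (R * r)
            \ Metric.closedBall 0 R), ‖K z‖ₑ := lintegral_mono_set hsub
      _ ≤ (∫⁻ z in Metric.closedBall (0 : R3) R, ‖K z‖ₑ) + ∫⁻ z in
            (Metric.closedBall (0 : R3) (R * r) \ Metric.closedBall 0 R), ‖K z‖ₑ :=
          lintegral_union_le _ _ _
      _ ≤ ENNReal.ofReal N + ∫⁻ z in Metric.closedBall (0 : R3) (R * r),
            ENNReal.ofReal C₀ * ENNReal.ofReal (‖z‖ ^ (-(α + 1))) := by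
          rw [hN]
          refine add_le_add_right (le_trans (setLIntegral_mono' (g := fun z : R3 =>
            ENNReal.ofReal C₀ * ENNReal.ofReal (‖z‖ ^ (-(α + 1)))) ?_ fun z hz => ?_)
            (lintegral_mono_set sdiff_subset)) _
          · exact Metric.isClosed_closedBall.measurableSet.diff
              Metric.isClosed_closedBall.measurableSet
          · have : R ≤ ‖z‖ := by
              have := hz.2
              rw [mem_closedBall_zero_iff, not_le] at this
              exact this.le
            rw [← ENNReal.ofReal_mul hC₀.le, ← ofReal_norm]
            exact ENNReal.ofReal_le_ofReal (hd z this)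
      _ ≤ ENNReal.ofReal N + ENNReal.ofReal C₀ * ENNReal.ofReal (C₁ * (R * r) ^ (2 - α)) := by
          rw [lintegral_const_mul' _ _ ENNReal.ofReal_ne_top]
          gcongr
          exact hb _ hRr0
      _ ≤ _ := by
          rw [← ENNReal.ofReal_mul hC₀.le, ← ENNReal.ofReal_add hN0 (by positivity)]
          refine ENNReal.ofReal_le_ofReal ?_
          rw [Real.mul_rpow (by positivity) hr0.le]
          have : 1 ≤ r ^ (2 - α) := Real.one_le_rpow hr (by linarith)
          nlinarith
  -- the tail is bounded pointwise
  have htail : ∀ z, z ∉ Metric.closedBall (0 : R3) (R * r) →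
      ‖K z‖ₑ ≤ ENNReal.ofReal (C₀ * r ^ (-(α + 1))) := fun z hz => by
    rw [mem_closedBall_zero_iff, not_le] at hz
    rw [← ofReal_norm]
    refine ENNReal.ofReal_le_ofReal ((hd z (hRr.trans hz.le)).trans ?_)
    gcongr C₀ * ?_
    exact Real.rpow_le_rpow_of_nonpos hr0 ((le_mul_of_one_le_left hr0.le hR).trans hz.le)
      (by linarith)
  let κ : R3 → ℝ≥0∞ := (Metric.closedBall (0 : R3) (R * r)).indicator fun z => ‖K z‖ₑ
  have hpt : ∀ y, ‖K (x - y)‖ₑ * φ y ≤ κ (x - y) * ENNReal.ofReal A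
      + ENNReal.ofReal (C₀ * r ^ (-(α + 1))) * φ y := by
    intro y
    by_cases hy : x - y ∈ Metric.closedBall (0 : R3) (R * r)
    · refine le_add_right ?_
      simp only [κ]
      rw [indicator_of_mem hy]
      gcongr
      exact hφA y
    · refine le_add_left ?_
      gcongr
      exact htail _ hy
  calc ∫⁻ y, ‖K (x - y)‖ₑ * φ y ≤ ∫⁻ y, (κ (x - y) * ENNReal.ofReal A
      + ENNReal.ofReal (C₀ * r ^ (-(α + 1))) * φ y) := lintegral_mono hpt
    _ = (∫⁻ y, κ (x - y) * ENNReal.ofReal A)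
        + ∫⁻ y, ENNReal.ofReal (C₀ * r ^ (-(α + 1))) * φ y :=
        lintegral_add_right' _ (hφ.const_mul _)
    _ = (∫⁻ z in Metric.closedBall (0 : R3) (R * r), ‖K z‖ₑ) * ENNReal.ofReal A
        + ENNReal.ofReal (C₀ * r ^ (-(α + 1))) * ∫⁻ y, φ y := by
        rw [lintegral_mul_const' _ _ ENNReal.ofReal_ne_top, lintegral_sub_left_eq_self κ x,
          lintegral_indicator Metric.isClosed_closedBall.measurableSet,
          lintegral_const_mul' _ _ ENNReal.ofReal_ne_top]
    _ ≤ ENNReal.ofReal ((N + C₀ * (C₁ * R ^ (2 - α))) * r ^ (2 - α)) * ENNReal.ofReal A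
        + ENNReal.ofReal (C₀ * r ^ (-(α + 1))) * ENNReal.ofReal B := by gcongr
    _ ≤ _ := by
        rw [← ENNReal.ofReal_mul (by positivity), ← ENNReal.ofReal_mul (by positivity),
          ← ENNReal.ofReal_add (by positivity) (by positivity)]
        refine ENNReal.ofReal_le_ofReal ?_
        have h1 : 0 ≤ C₀ * (r ^ (2 - α) * A) := by positivity
        have h2 : 0 ≤ (N + C₀ * (C₁ * R ^ (2 - α))) * (r ^ (-(α + 1)) * B) := by positivity
        nlinarith

/-- The kernel is approximated by continuous kernels of compact support, uniformly when convolved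
with bounded integrable densities. -/
theorem IsKernel.exists_approx (hα₁ : 1 < α) (hK : IsKernel α K) {ε : ℝ} (hε : 0 < ε) :
    ∃ k : R3 → R3, Continuous k ∧ HasCompactSupport k ∧
      ∀ (A B : ℝ) (φ : R3 → ℝ≥0∞), 0 ≤ A → 0 ≤ B → AEMeasurable φ →
      (∀ y, φ y ≤ ENNReal.ofReal A) → ∫⁻ y, φ y ≤ ENNReal.ofReal B → ∀ x,
      ∫⁻ y, ‖K (x - y) - k (x - y)‖ₑ * φ y ≤ ENNReal.ofReal (ε * (A + B)) := by
  obtain ⟨C, R, hC, hR, hd⟩ := hK.decay_pos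
  have hlim : Tendsto (fun r : ℝ => C * r ^ (-(α + 1))) atTop (𝓝 (C * 0)) :=
    (tendsto_rpow_neg_atTop (by linarith)).const_mul C
  rw [mul_zero] at hlim
  obtain ⟨r, hr⟩ := ((hlim.eventually_le_const hε).and (eventually_ge_atTop R)).exists
  have hr0 : 0 < r := by linarith [hr.2]
  obtain ⟨k, hk1, hk2, hk3, -⟩ := ((integrable_indicator_iff
    (Metric.isClosed_closedBall.measurableSet)).2
    (hK.integrableOn_closedBall r)).exists_hasCompactSupport_lintegral_sub_le
    (ε := ENNReal.ofReal ε) (by simpa using hε)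
  refine ⟨k, hk3, hk1, fun A B φ hA hB hφ hφA hφB x => ?_⟩
  let κ : R3 → ℝ≥0∞ := fun z => ‖(Metric.closedBall (0 : R3) r).indicator K z - k z‖ₑ
  have hpt : ∀ y, ‖K (x - y) - k (x - y)‖ₑ * φ y
      ≤ κ (x - y) * ENNReal.ofReal A + ENNReal.ofReal ε * φ y := by
    intro y
    have h1 : ‖K (x - y) - k (x - y)‖ₑ ≤ κ (x - y) + ENNReal.ofReal ε := by
      by_cases hy : x - y ∈ Metric.closedBall (0 : R3) r
      · refine le_add_right ?_
        simp only [κ]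
        rw [indicator_of_mem hy]
      · have h2 : κ (x - y) = ‖k (x - y)‖ₑ := by
          simp only [κ]
          rw [indicator_of_notMem hy, zero_sub, enorm_neg]
        rw [h2, add_comm]
        refine (enorm_sub_le).trans ?_
        gcongr
        rw [mem_closedBall_zero_iff, not_le] at hy
        rw [← ofReal_norm]
        refine ENNReal.ofReal_le_ofReal ((hd _ (hr.2.trans hy.le)).trans (le_trans ?_ hr.1))
        gcongr C * ?_
        exact Real.rpow_le_rpow_of_nonpos hr0 hy.le (by linarith)
    calc _ ≤ (κ (x - y) + ENNReal.ofReal ε) * φ y := by gcongr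
      _ = κ (x - y) * φ y + ENNReal.ofReal ε * φ y := add_mul _ _ _
      _ ≤ _ := by gcongr; exact hφA y
  calc _ ≤ ∫⁻ y, (κ (x - y) * ENNReal.ofReal A + ENNReal.ofReal ε * φ y) := lintegral_mono hpt
    _ = (∫⁻ z, κ z) * ENNReal.ofReal A + ENNReal.ofReal ε * ∫⁻ y, φ y := by
        rw [lintegral_add_right' _ (hφ.const_mul _), lintegral_mul_const' _ _ ENNReal.ofReal_ne_top,
          lintegral_sub_left_eq_self κ x, lintegral_const_mul' _ _ ENNReal.ofReal_ne_top]
    _ ≤ ENNReal.ofReal ε * ENNReal.ofReal A + ENNReal.ofReal ε * ENNReal.ofReal B := by gcongr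
    _ = _ := by
        rw [← ENNReal.ofReal_mul hε.le, ← ENNReal.ofReal_mul hε.le,
          ← ENNReal.ofReal_add (by positivity) (by positivity)]
        congr 1; ring

/-- Continuous densities with supremum at most `A` and mass at most `B`. -/
structure IsDensity {W : Type*} [NormedAddCommGroup W] (A B : ℝ) (g : R3 → W) : Prop where
  nonneg_sup : 0 ≤ A
  nonneg_mass : 0 ≤ B
  cont : Continuous g
  sup_le : ∀ y, ‖g y‖ ≤ A
  mass_le : ∫⁻ y, ‖g y‖ₑ ≤ ENNReal.ofReal B

variable {W : Type*} [NormedAddCommGroup W] {A B : ℝ} {g : R3 → W}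

theorem IsDensity.enorm_le (hg : IsDensity A B g) (y : R3) : ‖g y‖ₑ ≤ ENNReal.ofReal A := by
  rw [← ofReal_norm]
  exact ENNReal.ofReal_le_ofReal (hg.sup_le y)

theorem IsDensity.aemeasurable (hg : IsDensity A B g) : AEMeasurable fun y => ‖g y‖ₑ :=
  hg.cont.enorm.aemeasurable

variable {Z : Type*} [NormedSpace ℝ W] [NormedAddCommGroup Z] [NormedSpace ℝ Z]
  {L : W →L[ℝ] R3 →L[ℝ] Z}

/-- The convolution `∫ L(g(y), K(x - y)) dy` with respect to a bilinear map `L`. -/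
def conv (L : W →L[ℝ] R3 →L[ℝ] Z) (K : R3 → R3) (g : R3 → W) (x : R3) : Z :=
  ∫ y, L (g y) (K (x - y))

theorem enorm_bilin_le (hL : ∀ u k, ‖L u k‖ ≤ ‖u‖ * ‖k‖) (u : W) (k : R3) :
    ‖L u k‖ₑ ≤ ‖k‖ₑ * ‖u‖ₑ := by
  rw [← ofReal_norm, ← ofReal_norm, ← ofReal_norm, ← ENNReal.ofReal_mul (norm_nonneg _)]
  refine ENNReal.ofReal_le_ofReal ?_
  exact (hL u k).trans_eq (mul_comm _ _)

theorem IsKernel.aestronglyMeasurable_bilin (hK : IsKernel α K) (hg : IsDensity A B g) (x : R3) :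
    AEStronglyMeasurable (fun y => L (g y) (K (x - y))) volume :=
  L.aestronglyMeasurable_comp₂ hg.cont.aestronglyMeasurable (hK.aestronglyMeasurable_sub_left x)

theorem IsKernel.integrable_bilin (hα₁ : 1 < α) (hα₂ : α < 2) (hK : IsKernel α K)
    (hL : ∀ u k, ‖L u k‖ ≤ ‖u‖ * ‖k‖) (hg : IsDensity A B g) (x : R3) :
    Integrable (fun y => L (g y) (K (x - y))) volume := by
  obtain ⟨C, hC, h⟩ := hK.exists_lintegral_le hα₁ hα₂
  refine ⟨hK.aestronglyMeasurable_bilin hg x, ?_⟩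
  have := h A B 1 (fun y => ‖g y‖ₑ) hg.nonneg_sup hg.nonneg_mass le_rfl hg.aemeasurable
    hg.enorm_le hg.mass_le x
  exact lt_of_le_of_lt ((lintegral_mono fun y => enorm_bilin_le hL _ _).trans this)
    ENNReal.ofReal_lt_top

theorem norm_integral_le_of_lintegral_le {β : Type*} [MeasurableSpace β] {μ : Measure β}
    {h : β → Z} {c : ℝ} (hc : 0 ≤ c) (H : ∫⁻ y, ‖h y‖ₑ ∂μ ≤ ENNReal.ofReal c) :
    ‖∫ y, h y ∂μ‖ ≤ c := by
  have := (enorm_integral_le_lintegral_enorm h).trans H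
  rw [← ofReal_norm] at this
  exact (ENNReal.ofReal_le_ofReal_iff hc).1 this

/-- The quantitative decay of the convolution, with splitting radius `r`. -/
theorem IsKernel.exists_norm_conv_le (hα₁ : 1 < α) (hα₂ : α < 2) (hK : IsKernel α K) :
    ∃ C : ℝ, 0 < C ∧ ∀ {W Z : Type} [NormedAddCommGroup W] [NormedSpace ℝ W] [NormedAddCommGroup Z]
      [NormedSpace ℝ Z] (L : W →L[ℝ] R3 →L[ℝ] Z) (g : R3 → W) (A B r : ℝ),
      (∀ u k, ‖L u k‖ ≤ ‖u‖ * ‖k‖) →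
      IsDensity A B g → 1 ≤ r → ∀ x,
      ‖conv L K g x‖ ≤ C * (r ^ (2 - α) * A + r ^ (-(α + 1)) * B) := by
  obtain ⟨C, hC, h⟩ := hK.exists_lintegral_le hα₁ hα₂
  refine ⟨C, hC, fun L g A B r hL hg hr x => ?_⟩
  have h1 := hg.nonneg_sup
  have h2 := hg.nonneg_mass
  refine norm_integral_le_of_lintegral_le (by positivity) ?_
  exact (lintegral_mono fun y => enorm_bilin_le hL _ _).trans
    (h A B r _ h1 h2 hr hg.aemeasurable hg.enorm_le hg.mass_le x)

theorem IsDensity.integrable_smooth_bilin (hg : IsDensity A B g) {k : R3 → R3} (hk : Continuous k)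
    (hkc : HasCompactSupport k) (x : R3) : Integrable (fun y => L (g y) (k (x - y))) volume := by
  refine Continuous.integrable_of_hasCompactSupport ?_ ?_
  · have := hg.cont
    fun_prop
  · have h1 : HasCompactSupport fun y => k (x - y) := hkc.comp_homeomorph (Homeomorph.subLeft x)
    exact h1.mono' fun y hy => subset_tsupport _ fun h => hy (by simp [h])

/-- Approximation of the convolution by convolutions with continuous compactly supported kernels. -/
theorem IsKernel.exists_conv_approx (hα₁ : 1 < α) (hα₂ : α < 2) (hK : IsKernel α K) {ε : ℝ}
    (hε : 0 < ε) : ∃ k : R3 → R3, Continuous k ∧ HasCompactSupport k ∧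
    ∀ {W Z : Type} [NormedAddCommGroup W] [NormedSpace ℝ W] [NormedAddCommGroup Z]
      [NormedSpace ℝ Z] (L : W →L[ℝ] R3 →L[ℝ] Z) (g : R3 → W) (A B : ℝ),
      (∀ u k, ‖L u k‖ ≤ ‖u‖ * ‖k‖) →
      IsDensity A B g → ∀ x, ‖conv L K g x - conv L k g x‖ ≤ ε * (A + B) := by
  obtain ⟨k, hk1, hk2, h⟩ := hK.exists_approx hα₁ hε
  refine ⟨k, hk1, hk2, fun L g A B hL hg x => ?_⟩
  have h1 := hg.nonneg_sup
  have h2 := hg.nonneg_mass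
  rw [conv, conv, ← integral_sub (hK.integrable_bilin hα₁ hα₂ hL hg x)
    (hg.integrable_smooth_bilin hk1 hk2 x)]
  refine norm_integral_le_of_lintegral_le (by positivity) ?_
  simp_rw [← map_sub]
  exact (lintegral_mono fun y => enorm_bilin_le hL _ _).trans
    (h A B _ h1 h2 hg.aemeasurable hg.enorm_le hg.mass_le x)

theorem conv_eq_swap (L : W →L[ℝ] R3 →L[ℝ] Z) (k : R3 → R3) (g : R3 → W) (x : R3) :
    conv L k g x = ∫ z, L (g (x - z)) (k z) := by
  rw [conv, ← integral_sub_left_eq_self _ volume x]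
  simp

theorem uniform_limit_of_approx {X Z : Type*} [NormedAddCommGroup Z] {c : ℝ}
    {F : ℕ → X → Z} {f : X → Z} (h : ∀ n x, ‖f x - F n x‖ ≤ 1 / ((n : ℝ) + 1) * c) :
    TendstoUniformly F f atTop := by
  rw [Metric.tendstoUniformly_iff]
  intro ε hε
  have : Tendsto (fun n : ℕ => 1 / ((n : ℝ) + 1) * c) atTop (𝓝 (0 * c)) :=
    tendsto_one_div_add_atTop_nhds_zero_nat.mul_const c
  rw [zero_mul] at this
  filter_upwards [this.eventually_lt_const hε] with n hn x
  rw [dist_eq_norm]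
  exact (h n x).trans_lt hn

/-- Joint continuity of the convolution with a family of densities with uniform bounds. -/
theorem IsKernel.continuous_conv (hα₁ : 1 < α) (hα₂ : α < 2) (hK : IsKernel α K)
    {W Z : Type} [NormedAddCommGroup W] [NormedSpace ℝ W] [NormedAddCommGroup Z]
    [NormedSpace ℝ Z] {L : W →L[ℝ] R3 →L[ℝ] Z} (hL : ∀ u k, ‖L u k‖ ≤ ‖u‖ * ‖k‖) {g : ℝ → R3 → W}
    (hgc : Continuous fun q : ℝ × R3 => g q.1 q.2) (hg : ∀ t, IsDensity A B (g t)) :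
    Continuous fun q : ℝ × R3 => conv L K (g q.1) q.2 := by
  choose k hk1 hk2 hk using fun n : ℕ => hK.exists_conv_approx hα₁ hα₂
    (ε := 1 / ((n : ℝ) + 1)) (by positivity)
  have hu : TendstoUniformly (fun n (q : ℝ × R3) => conv L (k n) (g q.1) q.2)
      (fun q : ℝ × R3 => conv L K (g q.1) q.2) atTop :=
    uniform_limit_of_approx fun n q => hk n L (g q.1) A B hL (hg q.1) q.2
  refine hu.continuous (Frequently.of_forall fun n => ?_)
  simp only [conv_eq_swap]
  refine continuous_of_dominated (bound := fun z => A * ‖k n z‖) (fun q => ?_) (fun q => ?_) ?_ ?_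
  · have := (hg q.1).cont
    have := hk1 n
    refine Continuous.aestronglyMeasurable ?_
    fun_prop
  · refine Eventually.of_forall fun z => ?_
    calc ‖L (g q.1 (q.2 - z)) (k n z)‖ ≤ ‖g q.1 (q.2 - z)‖ * ‖k n z‖ := hL _ _
      _ ≤ A * ‖k n z‖ := by gcongr; exact (hg q.1).sup_le _
  · exact ((hk1 n).integrable_of_hasCompactSupport (hk2 n)).norm.const_mul A
  · refine Eventually.of_forall fun z => ?_
    have : Continuous fun q : ℝ × R3 => g q.1 (q.2 - z) :=
      hgc.comp (by fun_prop : Continuous fun q : ℝ × R3 => (q.1, q.2 - z))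
    fun_prop

/-- The bilinear map `(c, k) ↦ c k`. -/
def smulL : ℝ →L[ℝ] R3 →L[ℝ] R3 := ContinuousLinearMap.lsmul ℝ ℝ

/-- The bilinear map `(ℓ, k) ↦ (h ↦ ℓ(h) k)`. -/
def gradL : (R3 →L[ℝ] ℝ) →L[ℝ] R3 →L[ℝ] R3 →L[ℝ] R3 := ContinuousLinearMap.smulRightL ℝ R3 R3

theorem norm_smulL_le (u : ℝ) (k : R3) : ‖smulL u k‖ ≤ ‖u‖ * ‖k‖ := (norm_smul u k).le

theorem norm_gradL_le (u : R3 →L[ℝ] ℝ) (k : R3) : ‖gradL u k‖ ≤ ‖u‖ * ‖k‖ :=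
  (ContinuousLinearMap.norm_smulRight_apply u k).le

/-- The derivative of the convolution falls on the density. -/
theorem IsKernel.hasFDerivAt_conv (hα₁ : 1 < α) (hα₂ : α < 2) (hK : IsKernel α K) {A' B' : ℝ}
    {ρ : R3 → ℝ} {ρ' : R3 → R3 →L[ℝ] ℝ} (hρ : IsDensity A B ρ) (hρ' : IsDensity A' B' ρ')
    (hd : ∀ x, HasFDerivAt ρ (ρ' x) x) (x : R3) :
    HasFDerivAt (conv smulL K ρ) (conv gradL K ρ' x) x := by
  choose k hk1 hk2 hk using fun n : ℕ => hK.exists_conv_approx hα₁ hα₂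
    (ε := 1 / ((n : ℝ) + 1)) (by positivity)
  have hu : TendstoUniformly (fun n => conv smulL (k n) ρ) (conv smulL K ρ) atTop :=
    uniform_limit_of_approx fun n x => hk n smulL ρ A B norm_smulL_le hρ x
  have hu' : TendstoUniformly (fun n => conv gradL (k n) ρ') (conv gradL K ρ') atTop :=
    uniform_limit_of_approx fun n x => hk n gradL ρ' A' B' norm_gradL_le hρ' x
  refine hasFDerivAt_of_tendstoUniformly hu' (fun n x => ?_) (fun x => hu.tendsto_at x) x
  have h1 : conv smulL (k n) ρ = fun x => ∫ z, smulL (ρ (x - z)) (k n z) := by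
    funext x; exact conv_eq_swap _ _ _ _
  rw [h1, conv_eq_swap]
  have hkc := hk1 n
  have hρc := hρ.cont
  have hρc' := hρ'.cont
  refine hasFDerivAt_integral_of_dominated_of_fderiv_le (bound := fun z => A' * ‖k n z‖)
    (F := fun x z => smulL (ρ (x - z)) (k n z)) (F' := fun x z => gradL (ρ' (x - z)) (k n z))
    univ_mem (Eventually.of_forall fun x => ?_) ?_ ?_ (Eventually.of_forall fun z x _ => ?_)
    ((hkc.integrable_of_hasCompactSupport (hk2 n)).norm.const_mul A')
    (Eventually.of_forall fun z x _ => ?_)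
  · exact Continuous.aestronglyMeasurable (by fun_prop)
  · refine Continuous.integrable_of_hasCompactSupport (by fun_prop) ?_
    exact (hk2 n).mono' fun y hy => subset_tsupport _ fun h => hy (by simp [h])
  · exact Continuous.aestronglyMeasurable (by fun_prop)
  · refine (norm_gradL_le _ _).trans ?_
    gcongr
    exact hρ'.sup_le _
  · have h2 : HasFDerivAt (fun x => ρ (x - z)) (ρ' (x - z)) x := by
      simpa using! (hd (x - z)).comp x ((hasFDerivAt_id x).sub_const z)
    exact h2.smul_const (k n z)

/-- Convolutions with bounded integrable densities are equicontinuous. -/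
theorem IsKernel.exists_conv_modulus (hα₁ : 1 < α) (hα₂ : α < 2) (hK : IsKernel α K) {ε : ℝ}
    (hε : 0 < ε) : ∃ d : ℝ, 0 < d ∧
    ∀ {W Z : Type} [NormedAddCommGroup W] [NormedSpace ℝ W] [NormedAddCommGroup Z]
      [NormedSpace ℝ Z] (L : W →L[ℝ] R3 →L[ℝ] Z) (g : R3 → W) (A B : ℝ),
      (∀ u k, ‖L u k‖ ≤ ‖u‖ * ‖k‖) →
      IsDensity A B g → ∀ x y, ‖x - y‖ ≤ d → ‖conv L K g x - conv L K g y‖ ≤ ε * (A + B) := by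
  obtain ⟨k, hk1, hk2, h⟩ := hK.exists_conv_approx hα₁ hα₂ (ε := ε / 3) (by positivity)
  obtain ⟨d, hd, H⟩ := Metric.uniformContinuous_iff.1
    (hk2.uniformContinuous_of_continuous hk1) (ε / 3) (by positivity)
  refine ⟨d / 2, by positivity, fun L g A B hL hg x y hxy => ?_⟩
  have hA := hg.nonneg_sup
  have hB := hg.nonneg_mass
  have h1 := h L g A B hL hg x
  have h2 := h L g A B hL hg y
  have h3 : ‖conv L k g x - conv L k g y‖ ≤ ε / 3 * B := by
    rw [conv, conv, ← integral_sub (hg.integrable_smooth_bilin hk1 hk2 x)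
      (hg.integrable_smooth_bilin hk1 hk2 y)]
    refine norm_integral_le_of_lintegral_le (by positivity) ?_
    simp_rw [← map_sub]
    calc ∫⁻ z, ‖L (g z) (k (x - z) - k (y - z))‖ₑ ≤ ∫⁻ z, ENNReal.ofReal (ε / 3) * ‖g z‖ₑ := by
          refine lintegral_mono fun z => (enorm_bilin_le hL _ _).trans ?_
          gcongr
          rw [← ofReal_norm, ← dist_eq_norm]
          refine ENNReal.ofReal_le_ofReal (H ?_).le
          rw [dist_sub_right, dist_eq_norm]
          linarith
      _ ≤ _ := by
          rw [lintegral_const_mul' _ _ ENNReal.ofReal_ne_top, ENNReal.ofReal_mul (by positivity)]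
          gcongr
          exact hg.mass_le
  have e : conv L K g x - conv L K g y = (conv L K g x - conv L k g x)
      + (conv L k g x - conv L k g y) - (conv L K g y - conv L k g y) := by abel
  rw [e]
  refine (norm_sub_le _ _).trans ((add_le_add_left (norm_add_le _ _) _).trans ?_)
  nlinarith [mul_nonneg hε.le hA, mul_nonneg hε.le hB]

end Kernel

/-! ### Characteristics of a decaying force field -/

section Characteristics

open Filter Topology

/-- A uniformly small oscillation of the derivative bounds the first-order Taylor remainder. -/
theorem norm_remainder_le {V W : Type*} [NormedAddCommGroup V] [NormedSpace ℝ V]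
    [NormedAddCommGroup W] [NormedSpace ℝ W] {g : V → W} {g' : V → V →L[ℝ] W} {z : V} {d ε : ℝ}
    (hg : ∀ y, HasFDerivAt g (g' y) y) (h : ∀ y, ‖y - z‖ ≤ d → ‖g' y - g' z‖ ≤ ε) {k : V}
    (hk : ‖k‖ ≤ d) : ‖g (z + k) - g z - g' z k‖ ≤ ε * ‖k‖ := by
  have := (convex_closedBall z d).norm_image_sub_le_of_norm_hasFDerivWithin_le' (f := g)
    (φ := g' z) (C := ε) (x := z) (y := z + k) (fun y _ => (hg y).hasFDerivWithinAt)
    (fun y hy => h y (by rwa [← dist_eq_norm]))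
    (Metric.mem_closedBall_self ((norm_nonneg k).trans hk)) (by simpa using hk)
  simpa using this

/-- Continuous force fields with `|E| ≤ δ (1+|t|)^{-(α+1)}` and `|∇E| ≤ δ (1+|t|)^{-(α+2)}`, such
that `d` is a modulus of continuity of `∇E(t, ·)` for every `t`. The fields are defined for negative
times as well, which makes the flow a map on the whole space-time. -/
structure IsDecayField (α δ : ℝ) (d : ℝ → ℝ) (E : ℝ → R3 → R3) : Prop where
  cont : Continuous fun q : ℝ × R3 => E q.1 q.2
  bound : ∀ t x, ‖E t x‖ ≤ δ * (1 + |t|) ^ (-(α + 1))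
  diff : ∀ t, Differentiable ℝ (E t)
  bound_deriv : ∀ t x, ‖fderiv ℝ (E t) x‖ ≤ δ * (1 + |t|) ^ (-(α + 2))
  modulus_pos : ∀ ε, 0 < ε → 0 < d ε
  modulus : ∀ ε, 0 < ε → ∀ t x y, ‖x - y‖ ≤ d ε → ‖fderiv ℝ (E t) x - fderiv ℝ (E t) y‖ ≤ ε

/-- The vector field `(v(p), E(t, x))` of the characteristic system. -/
def phaseField (a : ℝ) (E : ℝ → R3 → R3) (t : ℝ) (z : R3 × R3) : R3 × R3 := (vel a z.2, E t z.1)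

/-- The derivative of `phaseField` in phase space. -/
def phaseDeriv (a : ℝ) (E : ℝ → R3 → R3) (t : ℝ) (z : R3 × R3) : R3 × R3 →L[ℝ] R3 × R3 :=
  ((velDeriv a z.2).comp (ContinuousLinearMap.snd ℝ R3 R3)).prod
    ((fderiv ℝ (E t) z.1).comp (ContinuousLinearMap.fst ℝ R3 R3))

variable {α δ a : ℝ} {d : ℝ → ℝ} {E : ℝ → R3 → R3}

theorem one_add_abs_rpow_le_one {q : ℝ} (hq : 0 ≤ q) (t : ℝ) : (1 + |t|) ^ (-q) ≤ 1 :=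
  Real.rpow_le_one_of_one_le_of_nonpos (by linarith [abs_nonneg t]) (by linarith)

theorem IsDecayField.delta_nonneg (hE : IsDecayField α δ d E) : 0 ≤ δ := by
  have := (norm_nonneg _).trans (hE.bound 0 0)
  simpa using this

theorem IsDecayField.norm_sub_le (hE : IsDecayField α δ d E) (t : ℝ) (x y : R3) :
    ‖E t x - E t y‖ ≤ δ * (1 + |t|) ^ (-(α + 2)) * ‖x - y‖ :=
  convex_univ.norm_image_sub_le_of_norm_fderiv_le (fun z _ => (hE.diff t) z)
    (fun z _ => hE.bound_deriv t z) (mem_univ y) (mem_univ x)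

theorem IsDecayField.remainder (hE : IsDecayField α δ d E) {ε : ℝ} (hε : 0 < ε) (t : ℝ) (x h : R3)
    (hh : ‖h‖ ≤ d ε) : ‖E t (x + h) - E t x - fderiv ℝ (E t) x h‖ ≤ ε * ‖h‖ :=
  norm_remainder_le (fun y => (hE.diff t y).hasFDerivAt)
    (fun y hy => hE.modulus ε hε t y x hy) hh

theorem IsDecayField.continuous_fderiv (hE : IsDecayField α δ d E) :
    Continuous fun q : ℝ × R3 => fderiv ℝ (E q.1) q.2 :=
  continuous_deriv_of_uniform_remainder (G' := fun t x => fderiv ℝ (E t) x) hE.cont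
    fun _ ε hε => ⟨d ε, hE.modulus_pos ε hε, fun t z h _ hh => hE.remainder hε t z h hh⟩

theorem IsDecayField.isDiffField (hα : 1 < α) (hδ : δ ≤ 1) (ha : 0 ≤ a) (ha1 : a ≤ 1)
    (hE : IsDecayField α δ d E) : IsDiffField 1 1 (phaseField a E) (phaseDeriv a E) := by
  have hδ0 := hE.delta_nonneg
  refine ⟨⟨le_rfl, ?_, fun t z w => ?_, fun t => ?_⟩, ?_, fun ε hε => ?_⟩
  · have h1 := continuous_vel ha
    have h2 : Continuous fun q : ℝ × R3 × R3 => E q.1 q.2.1 :=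
      hE.cont.comp (by fun_prop : Continuous fun q : ℝ × R3 × R3 => (q.1, q.2.1))
    exact (h1.comp (by fun_prop : Continuous fun q : ℝ × R3 × R3 => q.2.2)).prodMk h2
  · rw [one_mul, phaseField, phaseField, Prod.mk_sub_mk, Prod.norm_mk]
    refine max_le ((norm_vel_sub_le ha _ _).trans (norm_snd_le (z - w))) ?_
    refine (hE.norm_sub_le t _ _).trans (le_trans ?_ (norm_fst_le (z - w)))
    have := one_add_abs_rpow_le_one (q := α + 2) (by linarith) t
    have h3 : δ * (1 + |t|) ^ (-(α + 2)) ≤ 1 * 1 := by gcongr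
    rw [Prod.fst_sub]
    nlinarith [norm_nonneg (z.1 - w.1)]
  · have h1 : vel a (0 : R3) = 0 := by simp [vel]
    rw [phaseField, Prod.norm_mk, Prod.snd_zero, h1, norm_zero]
    refine max_le zero_le_one ((hE.bound t _).trans ?_)
    have := one_add_abs_rpow_le_one (q := α + 1) (by linarith) t
    have h3 : δ * (1 + |t|) ^ (-(α + 1)) ≤ 1 * 1 := by gcongr
    linarith
  · have h1 : Continuous fun q : ℝ × R3 × R3 => fderiv ℝ (E q.1) q.2.1 :=
      hE.continuous_fderiv.comp (by fun_prop : Continuous fun q : ℝ × R3 × R3 => (q.1, q.2.1))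
    have h2 : Continuous fun q : ℝ × R3 × R3 => velDeriv a q.2.2 :=
      (continuous_velDeriv ha).comp (by fun_prop)
    rw [continuous_clm_apply]
    intro e
    simp only [phaseDeriv, ContinuousLinearMap.prod_apply, ContinuousLinearMap.comp_apply]
    exact (h2.clm_apply continuous_const).prodMk (h1.clm_apply continuous_const)
  · refine ⟨min (ε / 3) (d ε), lt_min (by positivity) (hE.modulus_pos ε hε), fun t z h hh => ?_⟩
    have hv : ‖vel a (z.2 + h.2) - vel a z.2 - velDeriv a z.2 h.2‖ ≤ ε * ‖h.2‖ := by
      refine norm_remainder_le (d := ε / 3) (fun y => hasFDerivAt_vel ha y) (fun y hy => ?_)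
        ((norm_snd_le h).trans (hh.trans (min_le_left _ _)))
      refine ContinuousLinearMap.opNorm_le_bound _ hε.le fun k => ?_
      refine (norm_velDeriv_sub_le ha ha1 y z.2 k).trans ?_
      gcongr
      linarith
    have he := hE.remainder hε t z.1 h.1 ((norm_fst_le h).trans (hh.trans (min_le_right _ _)))
    have e1 : phaseField a E t (z + h) - phaseField a E t z - phaseDeriv a E t z h
        = (vel a (z.2 + h.2) - vel a z.2 - velDeriv a z.2 h.2,
          E t (z.1 + h.1) - E t z.1 - fderiv ℝ (E t) z.1 h.1) := rfl
    rw [e1, Prod.norm_mk]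
    refine max_le (hv.trans ?_) (he.trans ?_)
    · gcongr; exact norm_snd_le h
    · gcongr; exact norm_fst_le h

/-- A fencing theorem backward in time. -/
theorem norm_le_of_backward_fence {V : Type*} [NormedAddCommGroup V] [NormedSpace ℝ V]
    {u u' : ℝ → V} {B b : ℝ → ℝ} {t : ℝ}
    (hu : ∀ s, HasDerivAt u (u' s) s) (hB : ∀ s, 0 ≤ s → HasDerivAt B (-(b s)) s)
    (h0 : ‖u t‖ ≤ B t) (h : ∀ s, 0 ≤ s → s ≤ t → ‖u s‖ = B s → ‖u' s‖ < b s) {s : ℝ} (hs : 0 ≤ s)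
    (hst : s ≤ t) : ‖u s‖ ≤ B s := by
  have hw : ∀ σ, HasDerivAt (fun σ => u (t - σ)) (-(u' (t - σ))) σ := fun σ => by
    simpa [Function.comp_def] using (hu (t - σ)).scomp σ ((hasDerivAt_id σ).const_sub t)
  have hC : ∀ σ, σ ≤ t → HasDerivAt (fun σ => B (t - σ)) (b (t - σ)) σ := fun σ hσ => by
    simpa [Function.comp_def] using
      (hB (t - σ) (by linarith)).scomp σ ((hasDerivAt_id σ).const_sub t)
  have := image_norm_le_of_norm_deriv_right_lt_deriv_boundary' (f := fun σ => u (t - σ))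
    (B := fun σ => B (t - σ)) (a := 0) (b := t)
    (fun σ _ => (hw σ).continuousAt.continuousWithinAt) (fun σ _ => (hw σ).hasDerivWithinAt)
    (by simpa using h0) (fun σ hσ => (hC σ hσ.2).continuousAt.continuousWithinAt)
    (fun σ hσ => (hC σ hσ.2.le).hasDerivWithinAt)
    (fun σ hσ he => by
      rw [norm_neg]
      exact h _ (by linarith [hσ.2]) (by linarith [hσ.1]) he)
    (x := t - s) ⟨by linarith, by linarith⟩
  simpa using this

theorem hasDerivAt_one_add_rpow (q : ℝ) {s : ℝ} (hs : 0 ≤ s) :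
    HasDerivAt (fun s : ℝ => (1 + s) ^ q) (q * (1 + s) ^ (q - 1)) s := by
  have := ((hasDerivAt_id s).const_add 1).rpow_const (p := q)
    (Or.inl (by simp only [id]; positivity))
  simpa using this

theorem hasDerivAt_fst {z : ℝ → R3 × R3} {z' : R3 × R3} {s : ℝ} (h : HasDerivAt z z' s) :
    HasDerivAt (fun s => (z s).1) z'.1 s :=
  (ContinuousLinearMap.fst ℝ R3 R3).hasFDerivAt.comp_hasDerivAt s h

theorem hasDerivAt_snd {z : ℝ → R3 × R3} {z' : R3 × R3} {s : ℝ} (h : HasDerivAt z z' s) :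
    HasDerivAt (fun s => (z s).2) z'.2 s :=
  (ContinuousLinearMap.snd ℝ R3 R3).hasFDerivAt.comp_hasDerivAt s h

/-- The coordinates `(x - t v(p), p)` that are constant along the free flow. -/
def freeCoord (a t : ℝ) (z : R3 × R3) : R3 × R3 := (z.1 - t • vel a z.2, z.2)

/-- Small decaying fields move the free coordinates by at most `1`; this uses that
`(1+t)^{-(α+1)}` is integrable twice. -/
theorem IsDecayField.norm_sub_freeCoord_le (hα : 1 < α) (hδ : δ ≤ (α - 1) / 2) (ha : 0 ≤ a)
    (hE : IsDecayField α δ d E) {Z : ℝ → R3 × R3}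
    (hZ : ∀ s, HasDerivAt Z (phaseField a E s (Z s)) s) {t : ℝ} (ht : 0 ≤ t) :
    ‖Z 0 - freeCoord a t (Z t)‖ ≤ 1 := by
  have hX := fun s => hasDerivAt_fst (hZ s)
  have hP := fun s => hasDerivAt_snd (hZ s)
  have h1 : ∀ s, 0 ≤ s → s ≤ t →
      ‖(Z s).2 - (Z t).2‖ ≤ (α - 1) / α * (1 + s) ^ (-α) := by
    intro s hs hst
    refine norm_le_of_backward_fence (u := fun s => (Z s).2 - (Z t).2)
      (B := fun s => (α - 1) / α * (1 + s) ^ (-α)) (b := fun s => (α - 1) * (1 + s) ^ (-(α + 1)))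
      (fun s => (hP s).sub_const _) (fun s hs => ?_) ?_ (fun s hs _ _ => ?_) hs hst
    · convert! (hasDerivAt_one_add_rpow (-α) hs).const_mul ((α - 1) / α) using 1
      rw [show -(α + 1) = -α - 1 by ring]
      field_simp
    · simp only [sub_self, norm_zero]
      have : 0 < α - 1 := by linarith
      positivity
    · have := hE.bound s (Z s).1
      rw [abs_of_nonneg hs] at this
      refine this.trans_lt ?_
      have : 0 < (1 + s) ^ (-(α + 1)) := by positivity
      have : δ < α - 1 := by linarith
      gcongr
  have h2 : ‖(Z 0).1 - (Z t).1 + (t - 0) • vel a (Z t).2‖ ≤ (1 + 0) ^ (1 - α) := by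
    refine norm_le_of_backward_fence (u := fun s => (Z s).1 - (Z t).1 + (t - s) • vel a (Z t).2)
      (B := fun s => (1 + s) ^ (1 - α)) (b := fun s => (α - 1) * (1 + s) ^ (-α))
      (fun s => ((hX s).sub_const _).add
        (((hasDerivAt_id s).const_sub t).smul_const (vel a (Z t).2))) (fun s hs => ?_) ?_
        (fun s hs hst _ => ?_) le_rfl ht
    · convert! hasDerivAt_one_add_rpow (1 - α) hs using 1
      rw [show 1 - α - 1 = -α by ring]
      ring
    · simp only [sub_self, zero_smul, add_zero, norm_zero]
      positivity
    · have h3 : (phaseField a E s (Z s)).1 + (-1 : ℝ) • vel a (Z t).2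
          = vel a (Z s).2 - vel a (Z t).2 := by
        simp [phaseField, sub_eq_add_neg]
      rw [h3]
      refine ((norm_vel_sub_le ha _ _).trans (h1 s hs hst)).trans_lt ?_
      have : 0 < (1 + s) ^ (-α) := by positivity
      gcongr
      exact div_lt_self (by linarith) hα
  have h3 := h1 0 le_rfl ht
  simp only [add_zero, Real.one_rpow, mul_one, sub_zero] at h2 h3
  have e : Z 0 - freeCoord a t (Z t)
      = ((Z 0).1 - (Z t).1 + t • vel a (Z t).2, (Z 0).2 - (Z t).2) := by
    ext1
    · simp [freeCoord]; abel
    · simp [freeCoord]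
  rw [e, Prod.norm_mk]
  refine max_le h2 (h3.trans ?_)
  rw [div_le_one (by linarith)]
  linarith

/-- Trajectories of two fields whose difference is at most `D (1+t)^{-(α+1)}`: the distance at time
`0` is controlled by the distance at time `t` in the free coordinates. In these coordinates the
separation `u` satisfies `|u'| ≤ (1+s)^{-α} (4|u| + D)`, with an integrable rate. -/
theorem IsDecayField.norm_sub_le_exp (hα : 1 < α) (hδ : δ ≤ 1) (ha : 0 ≤ a) (ha1 : a ≤ 1)
    {E₁ E₂ : ℝ → R3 → R3} {d₁ d₂ : ℝ → ℝ} (hE₁ : IsDecayField α δ d₁ E₁)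
    (hE₂ : IsDecayField α δ d₂ E₂) {D : ℝ} (hD : 0 ≤ D)
    (hE : ∀ t, 0 ≤ t → ∀ x, ‖E₁ t x - E₂ t x‖ ≤ D * (1 + t) ^ (-(α + 1))) {Z₁ Z₂ : ℝ → R3 × R3}
    (hZ₁ : ∀ s, HasDerivAt Z₁ (phaseField a E₁ s (Z₁ s)) s)
    (hZ₂ : ∀ s, HasDerivAt Z₂ (phaseField a E₂ s (Z₂ s)) s) {t : ℝ} (ht : 0 ≤ t) :
    ‖Z₁ 0 - Z₂ 0‖
      ≤ Real.exp (5 / (α - 1)) * (‖freeCoord a t (Z₁ t) - freeCoord a t (Z₂ t)‖ + D) := by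
  have hα1 : 0 < α - 1 := by linarith
  have hδ0 := hE₁.delta_nonneg
  let u : ℝ → R3 × R3 := fun s => freeCoord a s (Z₁ s) - freeCoord a s (Z₂ s)
  let u' : ℝ → R3 × R3 := fun s =>
    (-(s • (velDeriv a (Z₁ s).2 (E₁ s (Z₁ s).1) - velDeriv a (Z₂ s).2 (E₂ s (Z₂ s).1))),
      E₁ s (Z₁ s).1 - E₂ s (Z₂ s).1)
  have hfree : ∀ {E : ℝ → R3 → R3} {Z : ℝ → R3 × R3},
      (∀ s, HasDerivAt Z (phaseField a E s (Z s)) s) → ∀ s, HasDerivAt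
        (fun s => freeCoord a s (Z s))
        (-(s • velDeriv a (Z s).2 (E s (Z s).1)), E s (Z s).1) s := by
    intro E Z hZ s
    have hX := hasDerivAt_fst (hZ s)
    have hP := hasDerivAt_snd (hZ s)
    have hv := (hasFDerivAt_vel ha (Z s).2).comp_hasDerivAt s hP
    have h1 := (hX.sub ((hasDerivAt_id s).smul hv)).prodMk hP
    convert! h1 using 1
    simp [phaseField]
  have hu : ∀ s, HasDerivAt u (u' s) s := fun s => by
    convert! (hfree hZ₁ s).sub (hfree hZ₂ s) using 1
    simp only [u', Prod.mk_sub_mk]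
    congr 1
    rw [smul_sub]
    abel
  have hu' : ∀ s, 0 ≤ s → ‖u' s‖ ≤ (1 + s) ^ (-α) * (4 * ‖u s‖ + D) := by
    intro s hs
    have hs1 : 0 < 1 + s := by linarith
    have hp1 : (1 + s) ^ (-α) = (1 + s) * (1 + s) ^ (-(α + 1)) := by
      rw [← Real.rpow_one_add' (by linarith) (by linarith)]
      congr 1; ring
    have hp2 : (1 + s) ^ (-(α + 1)) = (1 + s) * (1 + s) ^ (-(α + 2)) := by
      rw [← Real.rpow_one_add' (by linarith) (by linarith)]
      congr 1; ring
    have hq : 0 < (1 + s) ^ (-(α + 1)) := by positivity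
    have hb : ‖(Z₁ s).2 - (Z₂ s).2‖ ≤ ‖u s‖ := norm_snd_le (u s)
    have hx : ‖(Z₁ s).1 - (Z₂ s).1‖ ≤ (1 + s) * ‖u s‖ := by
      have e : (Z₁ s).1 - (Z₂ s).1 = (u s).1 + s • (vel a (Z₁ s).2 - vel a (Z₂ s).2) := by
        simp only [u, freeCoord, Prod.fst_sub, smul_sub]
        abel
      rw [e]
      refine (norm_add_le _ _).trans ?_
      rw [norm_smul, Real.norm_of_nonneg hs]
      have h1 := norm_fst_le (u s)
      have h2 := (norm_vel_sub_le ha (Z₁ s).2 (Z₂ s).2).trans hb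
      nlinarith
    have hEd : ‖E₁ s (Z₁ s).1 - E₂ s (Z₂ s).1‖ ≤ (1 + s) ^ (-(α + 1)) * (‖u s‖ + D) := by
      have h1 := hE₁.norm_sub_le s (Z₁ s).1 (Z₂ s).1
      have h2 := hE s hs (Z₂ s).1
      rw [abs_of_nonneg hs] at h1
      have h3 : δ * (1 + s) ^ (-(α + 2)) * ‖(Z₁ s).1 - (Z₂ s).1‖
          ≤ 1 * (1 + s) ^ (-(α + 2)) * ((1 + s) * ‖u s‖) := by gcongr
      calc _ ≤ ‖E₁ s (Z₁ s).1 - E₁ s (Z₂ s).1‖ + ‖E₁ s (Z₂ s).1 - E₂ s (Z₂ s).1‖ :=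
            norm_sub_le_norm_sub_add_norm_sub _ _ _
        _ ≤ 1 * (1 + s) ^ (-(α + 2)) * ((1 + s) * ‖u s‖) + D * (1 + s) ^ (-(α + 1)) :=
            add_le_add (h1.trans h3) h2
        _ = _ := by rw [hp2]; ring
    have hvd : ‖velDeriv a (Z₁ s).2 (E₁ s (Z₁ s).1) - velDeriv a (Z₂ s).2 (E₂ s (Z₂ s).1)‖
        ≤ (1 + s) ^ (-(α + 1)) * (4 * ‖u s‖ + D) := by
      have e : velDeriv a (Z₁ s).2 (E₁ s (Z₁ s).1) - velDeriv a (Z₂ s).2 (E₂ s (Z₂ s).1)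
          = velDeriv a (Z₁ s).2 (E₁ s (Z₁ s).1 - E₂ s (Z₂ s).1)
            + (velDeriv a (Z₁ s).2 (E₂ s (Z₂ s).1) - velDeriv a (Z₂ s).2 (E₂ s (Z₂ s).1)) := by
        rw [map_sub]; abel
      have h1 := (norm_velDeriv_apply_le ha (Z₁ s).2 _).trans hEd
      have h2 := norm_velDeriv_sub_le ha ha1 (Z₁ s).2 (Z₂ s).2 (E₂ s (Z₂ s).1)
      have h3 := hE₂.bound s (Z₂ s).1
      rw [abs_of_nonneg hs] at h3
      have h4 : 3 * ‖(Z₁ s).2 - (Z₂ s).2‖ * ‖E₂ s (Z₂ s).1‖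
          ≤ 3 * ‖u s‖ * (1 * (1 + s) ^ (-(α + 1))) := by
        gcongr
        exact h3.trans (by gcongr)
      rw [e]
      refine (norm_add_le _ _).trans ((add_le_add h1 (h2.trans h4)).trans_eq ?_)
      ring
    rw [Prod.norm_mk]
    have hn := norm_nonneg (u s)
    refine max_le ?_ (hEd.trans ?_)
    · rw [norm_neg, norm_smul, Real.norm_of_nonneg hs, hp1]
      calc s * _ ≤ (1 + s) * ((1 + s) ^ (-(α + 1)) * (4 * ‖u s‖ + D)) := by
            gcongr
            linarith
        _ = _ := by ring
    · rw [hp1]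
      have h5 : 0 ≤ (1 + s) ^ (-(α + 1)) * (4 * ‖u s‖ + D) := by positivity
      nlinarith
  have key : ∀ ε : ℝ, 0 < ε → ‖u 0‖ ≤ (‖u t‖ + D + ε) * Real.exp (5 / (α - 1)) := by
    intro ε hε
    let c : ℝ := ‖u t‖ + D + ε
    have hc : 0 < c := by positivity
    let B : ℝ → ℝ := fun s => c * Real.exp (5 / (α - 1) * (1 + s) ^ (1 - α))
    have hBc : ∀ s, 0 ≤ s → c ≤ B s := fun s hs =>
      le_mul_of_one_le_right hc.le (Real.one_le_exp (by positivity))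
    have := norm_le_of_backward_fence (B := B) (b := fun s => 5 * (1 + s) ^ (-α) * B s) hu
      (fun s hs => ?_) ?_ (fun s hs _ he => ?_) le_rfl ht
    · simpa [B, c] using this
    · have h1 := (((hasDerivAt_one_add_rpow (1 - α) hs).const_mul (5 / (α - 1))).exp).const_mul c
      convert! h1 using 1
      rw [show 1 - α - 1 = -α by ring]
      simp only [B]
      field_simp
      ring
    · have : ‖u t‖ ≤ c := by simp only [c]; linarith
      exact this.trans (hBc t ht)
    · refine (hu' s hs).trans_lt ?_
      rw [he]
      have h1 := hBc s hs
      have h2 : D < c := by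
        simp only [c]
        linarith [norm_nonneg (u t)]
      have h3 : 0 < (1 + s) ^ (-α) := by positivity
      nlinarith
  have h0 : u 0 = Z₁ 0 - Z₂ 0 := by simp [u, freeCoord]; rfl
  rw [← h0]
  refine le_of_forall_pos_le_add fun ε hε => ?_
  have hexp := Real.exp_pos (5 / (α - 1))
  have := key (ε / Real.exp (5 / (α - 1))) (by positivity)
  refine this.trans_eq ?_
  simp only [u]
  field_simp

end Characteristics

/-! ### Transport of the initial datum -/

section Transport

open Filter Topology

/-- Continuously differentiable data of size `η` with respect to the weights
`⟨x⟩^κ ⟨p⟩^8` (for the values) and `⟨x⟩^κ ⟨p⟩^9` (for the derivative). -/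
structure IsDatum (κ η : ℝ) (f₀ : R3 → R3 → ℝ) : Prop where
  contDiff : ContDiff ℝ 1 fun z : R3 × R3 => f₀ z.1 z.2
  bound : ∀ x p, |f₀ x p| ≤ η * (bracket x ^ (-κ) * (bracket p ^ 8)⁻¹)
  bound_deriv : ∀ z : R3 × R3, ‖fderiv ℝ (fun z : R3 × R3 => f₀ z.1 z.2) z‖
    ≤ η * (bracket z.1 ^ (-κ) * (bracket z.2 ^ 9)⁻¹)

/-- The datum `f₀` transported along the characteristics of the force field `E`. -/
def transported (a : ℝ) (E : ℝ → R3 → R3) (f₀ : R3 → R3 → ℝ) (t : ℝ) (x p : R3) : ℝ :=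
  f₀ (flow (phaseField a E) t (x, p) 0).1 (flow (phaseField a E) t (x, p) 0).2

/-- The constant in the pointwise bounds of the transported datum. -/
def transConst (α κ : ℝ) : ℝ := 2 ^ κ * 2 ^ 9 * Real.exp (5 / (α - 1))

theorem transConst_pos (α κ : ℝ) : 0 < transConst α κ := by unfold transConst; positivity

variable {α δ a κ η : ℝ} {d : ℝ → ℝ} {E : ℝ → R3 → R3} {f₀ : R3 → R3 → ℝ}

theorem IsDatum.eta_nonneg (hf : IsDatum κ η f₀) : 0 ≤ η := by
  have := (abs_nonneg _).trans (hf.bound 0 0)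
  simpa [bracket] using this

/-- Weights are essentially constant on unit balls around the free coordinates. -/
theorem datum_weight_le (hκ : 0 < κ) {j : ℕ} (hj : j ≤ 4) {t : ℝ} {x p : R3} {z : R3 × R3}
    (hz : ‖z - freeCoord a t (x, p)‖ ≤ 1) : bracket z.1 ^ (-κ) * (bracket z.2 ^ (5 + j))⁻¹
      ≤ 2 ^ κ * 2 ^ 9 * (weight κ a t x p * (bracket p ^ j)⁻¹) := by
  have h1 := bracket_weight_le (r := 1) hκ (5 + j) (x := x - t • vel a p) (y := z.1) (p := p)
    (q := z.2) (by rw [norm_sub_rev]; exact (norm_fst_le _).trans hz)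
    (by rw [norm_sub_rev]; exact (norm_snd_le _).trans hz)
  have hb := bracket_pos p
  have hw := weight_pos (κ := κ) (a := a) t x p
  have e : bracket (x - t • vel a p) ^ (-κ) * (bracket p ^ (5 + j))⁻¹
      = weight κ a t x p * (bracket p ^ j)⁻¹ := by
    rw [weight, pow_add, mul_inv, mul_assoc]
  rw [e] at h1
  refine h1.trans ?_
  have : ((2 : ℝ)) ^ (5 + j) ≤ 2 ^ 9 := pow_le_pow_right₀ (by norm_num) (by omega)
  norm_num at this ⊢
  gcongr

theorem flow_freeCoord_le (hα : 1 < α) (hδ : δ ≤ (α - 1) / 2) (hδ1 : δ ≤ 1) (ha : 0 ≤ a)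
    (ha1 : a ≤ 1) (hE : IsDecayField α δ d E) {t : ℝ} (ht : 0 ≤ t) (x p : R3) :
    ‖flow (phaseField a E) t (x, p) 0 - freeCoord a t (x, p)‖ ≤ 1 := by
  have hF := (hE.isDiffField hα hδ1 ha ha1).toIsLipField
  have := hE.norm_sub_freeCoord_le hα hδ ha (hF.hasDerivAt_flow t (x, p)) ht
  rwa [hF.flow_self] at this

theorem abs_transported_le (hα : 1 < α) (hδ : δ ≤ (α - 1) / 2) (hδ1 : δ ≤ 1) (ha : 0 ≤ a)
    (ha1 : a ≤ 1) (hκ : 0 < κ) (hE : IsDecayField α δ d E) (hf : IsDatum κ η f₀) {t : ℝ}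
    (ht : 0 ≤ t) (x p : R3) : |transported a E f₀ t x p|
      ≤ transConst α κ * η * (weight κ a t x p * (bracket p ^ 3)⁻¹) := by
  have hη := hf.eta_nonneg
  have h1 := hf.bound (flow (phaseField a E) t (x, p) 0).1 (flow (phaseField a E) t (x, p) 0).2
  have h2 := datum_weight_le hκ (j := 3) (by norm_num)
    (flow_freeCoord_le hα hδ hδ1 ha ha1 hE ht x p)
  have h3 : (1 : ℝ) ≤ Real.exp (5 / (α - 1)) :=
    Real.one_le_exp (div_nonneg (by norm_num) (by linarith))
  have hb := bracket_pos p
  have hw := weight_pos (κ := κ) (a := a) t x p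
  calc _ ≤ η * (2 ^ κ * 2 ^ 9 * (weight κ a t x p * (bracket p ^ 3)⁻¹)) :=
        h1.trans (by gcongr)
    _ ≤ η * (2 ^ κ * 2 ^ 9 * (weight κ a t x p * (bracket p ^ 3)⁻¹)) * Real.exp (5 / (α - 1)) :=
        le_mul_of_one_le_right (by positivity) h3
    _ = _ := by unfold transConst; ring

/-- Two fields: the transported data differ by the weighted distance of the fields. -/
theorem abs_transported_sub_le (hα : 1 < α) (hδ : δ ≤ (α - 1) / 2) (hδ1 : δ ≤ 1) (ha : 0 ≤ a)
    (ha1 : a ≤ 1) (hκ : 0 < κ) {E₁ E₂ : ℝ → R3 → R3} {d₁ d₂ : ℝ → ℝ}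
    (hE₁ : IsDecayField α δ d₁ E₁) (hE₂ : IsDecayField α δ d₂ E₂) {D : ℝ} (hD : 0 ≤ D)
    (hE : ∀ t, 0 ≤ t → ∀ x, ‖E₁ t x - E₂ t x‖ ≤ D * (1 + t) ^ (-(α + 1)))
    (hf : IsDatum κ η f₀) {t : ℝ} (ht : 0 ≤ t) (x p : R3) :
    |transported a E₁ f₀ t x p - transported a E₂ f₀ t x p|
      ≤ transConst α κ * η * D * weight κ a t x p := by
  have hη := hf.eta_nonneg
  have hF₁ := (hE₁.isDiffField hα hδ1 ha ha1).toIsLipField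
  have hF₂ := (hE₂.isDiffField hα hδ1 ha ha1).toIsLipField
  have h1 := hE₁.norm_sub_le_exp hα hδ1 ha ha1 hE₂ hD hE (hF₁.hasDerivAt_flow t (x, p))
    (hF₂.hasDerivAt_flow t (x, p)) ht
  rw [hF₁.flow_self, hF₂.flow_self, sub_self, norm_zero, zero_add] at h1
  have hb := bracket_pos p
  have hw := weight_pos (κ := κ) (a := a) t x p
  have h2 := (convex_closedBall (freeCoord a t (x, p)) 1).norm_image_sub_le_of_norm_fderiv_le
    (𝕜 := ℝ) (f := fun z : R3 × R3 => f₀ z.1 z.2)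
    (C := η * (2 ^ κ * 2 ^ 9 * (weight κ a t x p * (bracket p ^ 4)⁻¹)))
    (fun z _ => (hf.contDiff.differentiable one_ne_zero) z)
    (fun z hz => (hf.bound_deriv z).trans (by
      have := datum_weight_le hκ (j := 4) (x := x) (p := p) (a := a) (t := t) le_rfl
        (by rwa [← dist_eq_norm])
      gcongr))
    (by rw [Metric.mem_closedBall, dist_eq_norm]
        exact flow_freeCoord_le hα hδ hδ1 ha ha1 hE₂ ht x p)
    (by rw [Metric.mem_closedBall, dist_eq_norm]
        exact flow_freeCoord_le hα hδ hδ1 ha ha1 hE₁ ht x p)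
  rw [Real.norm_eq_abs] at h2
  have hb1 : (bracket p ^ 4)⁻¹ ≤ 1 := inv_le_one_of_one_le₀ (one_le_pow₀ (one_le_bracket p))
  calc _ ≤ _ := h2
    _ ≤ η * (2 ^ κ * 2 ^ 9 * (weight κ a t x p * 1)) * (Real.exp (5 / (α - 1)) * D) := by gcongr
    _ = _ := by unfold transConst; ring

theorem hasFDerivAt_freeCoord (ha : 0 ≤ a) (t : ℝ) (z : R3 × R3) : HasFDerivAt (freeCoord a t)
    ((ContinuousLinearMap.fst ℝ R3 R3 - t • (velDeriv a z.2).comp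
      (ContinuousLinearMap.snd ℝ R3 R3)).prod (ContinuousLinearMap.snd ℝ R3 R3)) z := by
  have h1 : HasFDerivAt (fun z : R3 × R3 => vel a z.2)
      ((velDeriv a z.2).comp (ContinuousLinearMap.snd ℝ R3 R3)) z :=
    (hasFDerivAt_vel ha z.2).comp z (ContinuousLinearMap.snd ℝ R3 R3).hasFDerivAt
  exact ((ContinuousLinearMap.fst ℝ R3 R3).hasFDerivAt.sub (h1.const_smul t)).prodMk
    (ContinuousLinearMap.snd ℝ R3 R3).hasFDerivAt

/-- Domination of increments passes to derivatives. -/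
theorem norm_fderiv_apply_le_of_increment {V W Y : Type*} [NormedAddCommGroup V] [NormedSpace ℝ V]
    [NormedAddCommGroup W] [NormedSpace ℝ W] [NormedAddCommGroup Y] [NormedSpace ℝ Y]
    {g : V → W} {u : V → Y} {g' : V →L[ℝ] W} {u' : V →L[ℝ] Y} {z : V} {c : ℝ}
    (hg : HasFDerivAt g g' z) (hu : HasFDerivAt u u' z)
    (h : ∀ w, ‖g w - g z‖ ≤ c * ‖u w - u z‖) (ξ : V) : ‖g' ξ‖ ≤ c * ‖u' ξ‖ := by
  have h1 := ((hg.hasLineDerivAt ξ).tendsto_slope_zero).norm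
  have h2 := ((hu.hasLineDerivAt ξ).tendsto_slope_zero).norm.const_mul c
  refine le_of_tendsto_of_tendsto' h1 h2 fun r => ?_
  simp only [norm_smul]
  rw [mul_left_comm]
  gcongr
  exact h _

theorem IsDecayField.contDiff_transported (hα : 1 < α) (hδ1 : δ ≤ 1) (ha : 0 ≤ a)
    (ha1 : a ≤ 1) (hE : IsDecayField α δ d E) (hf : IsDatum κ η f₀) :
    ContDiff ℝ 1 fun q : ℝ × R3 × R3 => transported a E f₀ q.1 q.2.1 q.2.2 :=
  hf.contDiff.comp (hE.isDiffField hα hδ1 ha ha1).contDiff_flow_zero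

/-- The space-time derivative of the transported datum is determined by its derivative in phase
space: the transport equation. -/
theorem IsDecayField.hasFDerivAt_transported (hα : 1 < α) (hδ1 : δ ≤ 1) (ha : 0 ≤ a)
    (ha1 : a ≤ 1) (hE : IsDecayField α δ d E) (hf : IsDatum κ η f₀) (t : ℝ) (z : R3 × R3) :
    HasFDerivAt (fun q : ℝ × R3 × R3 => transported a E f₀ q.1 q.2.1 q.2.2)
      ((fderiv ℝ (fun z : R3 × R3 => transported a E f₀ t z.1 z.2) z).comp
        (ContinuousLinearMap.snd ℝ ℝ (R3 × R3)
          - (ContinuousLinearMap.fst ℝ ℝ (R3 × R3)).smulRight (phaseField a E t z))) (t, z) := by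
  have hF := hE.isDiffField hα hδ1 ha ha1
  have h0 := (hf.contDiff.differentiable one_ne_zero
    (flow (phaseField a E) t z 0)).hasFDerivAt
  have h1 := h0.comp (t, z) (f := fun q : ℝ × R3 × R3 => flow (phaseField a E) q.1 q.2 0)
    (hF.hasFDerivAt_flow_zero t z)
  have h2 : HasFDerivAt (fun z : R3 × R3 => transported a E f₀ t z.1 z.2) _ z :=
    h1.comp z (f := fun z : R3 × R3 => (t, z)) (hasFDerivAt_prodMk_right t z)
  have e := h2.fderiv
  rw [e]
  exact h1.congr_fderiv (ContinuousLinearMap.ext fun ξ => by simp)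

/-- The derivative of the transported datum in the direction `ξ` is controlled by the derivative of
the free coordinates in the same direction. -/
theorem IsDecayField.abs_fderiv_transported_le (hα : 1 < α) (hδ : δ ≤ (α - 1) / 2) (hδ1 : δ ≤ 1)
    (ha : 0 ≤ a) (ha1 : a ≤ 1) (hκ : 0 < κ) (hE : IsDecayField α δ d E) (hf : IsDatum κ η f₀)
    {t : ℝ} (ht : 0 ≤ t) (x p : R3) (ξ : R3 × R3) :
    |fderiv ℝ (fun z : R3 × R3 => transported a E f₀ t z.1 z.2) (x, p) ξ|
      ≤ transConst α κ * η * (weight κ a t x p * (bracket p ^ 4)⁻¹)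
        * max ‖ξ.1 - t • velDeriv a p ξ.2‖ ‖ξ.2‖ := by
  have hη := hf.eta_nonneg
  have hF := hE.isDiffField hα hδ1 ha ha1
  have hb := bracket_pos p
  have hw := weight_pos (κ := κ) (a := a) t x p
  have hflow : HasFDerivAt (fun w => flow (phaseField a E) t w 0)
      (flowDeriv (phaseField a E) (phaseDeriv a E) t (x, p) 0) (x, p) :=
    hasFDerivAt_of_remainder fun ε hε => by
      obtain ⟨d', hd', H⟩ := hF.flow_remainder |0 - t| ε hε
      exact ⟨d', hd', fun h hh => H t 0 (x, p) h le_rfl hh⟩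
  have h1 := norm_fderiv_apply_le_of_increment hflow (hasFDerivAt_freeCoord ha t (x, p))
    (c := Real.exp (5 / (α - 1))) (fun w => by
      have := hE.norm_sub_le_exp hα hδ1 ha ha1 hE le_rfl (fun t _ x => by simp)
        (hF.hasDerivAt_flow t w) (hF.hasDerivAt_flow t (x, p)) ht
      rwa [hF.flow_self, hF.flow_self, add_zero] at this) ξ
  have h0 := (hf.contDiff.differentiable one_ne_zero
    (flow (phaseField a E) t (x, p) 0)).hasFDerivAt
  have h2 := h0.comp (x, p) hflow
  have e : fderiv ℝ (fun z : R3 × R3 => transported a E f₀ t z.1 z.2) (x, p) = _ := h2.fderiv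
  rw [e, ContinuousLinearMap.comp_apply, ← Real.norm_eq_abs]
  have h3 := (hf.bound_deriv (flow (phaseField a E) t (x, p) 0)).trans
    (mul_le_mul_of_nonneg_left (datum_weight_le hκ (j := 4) le_rfl
      (flow_freeCoord_le hα hδ hδ1 ha ha1 hE ht x p)) hη)
  refine (ContinuousLinearMap.le_opNorm _ _).trans ((mul_le_mul h3 h1 (norm_nonneg _)
    (by positivity)).trans_eq ?_)
  simp only [ContinuousLinearMap.prod_apply, Prod.norm_mk, transConst, sub_apply, smul_apply,
    ContinuousLinearMap.comp_apply, ContinuousLinearMap.coe_fst', ContinuousLinearMap.coe_snd']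
  ring

end Transport

/-! ### Macroscopic densities of dispersed phase-space functions -/

section Dispersed

open Filter Topology

variable {α κ a t N : ℝ} {K : R3 → R3} {F : R3 → R3 → ℝ}

theorem continuous_weight_right (ha : 0 ≤ a) (t : ℝ) (x : R3) :
    Continuous fun p => weight κ a t x p := by
  have h : Continuous fun p : R3 => (t, x, p) := by fun_prop
  have h2 := (continuous_weight (κ := κ) ha).comp h
  simpa only [Function.comp_def] using h2

theorem integrable_weight (ha : 0 ≤ a) (hκ : 0 < κ) (t : ℝ) (x : R3) :
    Integrable fun p => weight κ a t x p :=
  (integrable_bracket_pow_inv (n := 5) (by norm_num)).mono'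
    (continuous_weight_right ha t x).aestronglyMeasurable
    (Eventually.of_forall fun p => by
      rw [Real.norm_of_nonneg (weight_pos t x p).le]
      exact weight_le hκ t x p)

/-- Functions controlled by the macroscopic density of the weight have the dispersive sup bound and
a uniformly bounded mass. -/
theorem exists_isDensity (hκ : 3 < κ) :
    ∃ C : ℝ, 0 < C ∧ ∀ a : ℝ, 0 ≤ a → a ≤ 1 → ∀ t : ℝ, 0 ≤ t →
    ∀ {W : Type} [NormedAddCommGroup W] (N : ℝ) (g : R3 → W), 0 ≤ N → Continuous g →
      (∀ x, ‖g x‖ ≤ N * ∫ p, weight κ a t x p) →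
      IsDensity (C * N * ((1 + t) ^ 3)⁻¹) (C * N) g := by
  obtain ⟨C, hC, h⟩ := exists_weight_bound hκ
  refine ⟨C, hC, fun a ha ha1 t ht W _ N g hN hg hb => ?_⟩
  obtain ⟨h1, h2⟩ := h a ha ha1 t ht
  have e : ∀ x, ∫⁻ p, ENNReal.ofReal (weight κ a t x p) = ENNReal.ofReal (∫ p, weight κ a t x p) :=
    fun x => lintegral_ofReal_eq_ofReal_integral (integrable_weight ha (by linarith) t x)
      fun p => (weight_pos t x p).le
  simp_rw [e] at h1 h2
  refine ⟨by positivity, by positivity, hg, fun x => ?_, ?_⟩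
  · have := (ENNReal.ofReal_le_ofReal_iff (by positivity)).1 (h1 x)
    calc _ ≤ _ := hb x
      _ ≤ N * (C * ((1 + t) ^ 3)⁻¹) := by gcongr
      _ = _ := by ring
  · calc ∫⁻ x, ‖g x‖ₑ ≤ ∫⁻ x, ENNReal.ofReal N * ENNReal.ofReal (∫ p, weight κ a t x p) := by
          refine lintegral_mono fun x => ?_
          rw [← ofReal_norm, ← ENNReal.ofReal_mul hN]
          exact ENNReal.ofReal_le_ofReal (hb x)
      _ ≤ ENNReal.ofReal N * ENNReal.ofReal C := by
          rw [lintegral_const_mul' _ _ ENNReal.ofReal_ne_top]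
          gcongr
      _ = _ := by rw [← ENNReal.ofReal_mul hN, mul_comm]

/-- A phase-space function bounded by the transported weight at time `t` has a force field of size
`(1 + t)^{-(α+1)}`: the kernel is split at radius `1 + t`. -/
theorem IsKernel.exists_field_bound (hα₁ : 1 < α) (hα₂ : α < 2) (hκ : 3 < κ) (hK : IsKernel α K) :
    ∃ C : ℝ, 0 < C ∧ ∀ a : ℝ, 0 ≤ a → a ≤ 1 → ∀ t : ℝ, 0 ≤ t →
      ∀ (N : ℝ) (h : R3 → R3 → ℝ), 0 ≤ N →
      AEStronglyMeasurable (fun z : R3 × R3 => h z.1 z.2) volume →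
      (∀ y p, |h y p| ≤ N * weight κ a t y p) → ∀ x,
      Integrable (fun z : R3 × R3 => h z.1 z.2 • K (x - z.1)) volume ∧
      ‖∫ z : R3 × R3, h z.1 z.2 • K (x - z.1)‖ ≤ C * N * (1 + t) ^ (-(α + 1)) := by
  obtain ⟨C₁, hC₁, h1⟩ := exists_weight_bound hκ
  obtain ⟨C₂, hC₂, h2⟩ := hK.exists_lintegral_le hα₁ hα₂
  refine ⟨2 * C₂ * C₁, by positivity, fun a ha ha1 t ht N h hN hm hb x => ?_⟩
  obtain ⟨hsup, hmass⟩ := h1 a ha ha1 t ht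
  have hmw : Measurable fun z : R3 × R3 => ENNReal.ofReal (weight κ a t z.1 z.2) :=
    ((continuous_weight ha).comp (by fun_prop : Continuous fun q : R3 × R3 =>
      (t, q.1, q.2))).measurable.ennreal_ofReal
  have h3 := h2 (N * (C₁ * ((1 + t) ^ 3)⁻¹)) (N * C₁) (1 + t)
    (fun y => ENNReal.ofReal N * ∫⁻ p, ENNReal.ofReal (weight κ a t y p))
    (by positivity) (by positivity) (by linarith)
    (hmw.lintegral_prod_right'.const_mul _).aemeasurable
    (fun y => by rw [ENNReal.ofReal_mul hN]; gcongr; exact hsup y)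
    (by rw [lintegral_const_mul' _ _ ENNReal.ofReal_ne_top, ENNReal.ofReal_mul hN]; gcongr) x
  have hle : ∫⁻ z : R3 × R3, ‖h z.1 z.2 • K (x - z.1)‖ₑ
      ≤ ENNReal.ofReal (2 * C₂ * C₁ * N * (1 + t) ^ (-(α + 1))) := by
    have e : C₂ * ((1 + t) ^ (2 - α) * (N * (C₁ * ((1 + t) ^ 3)⁻¹))
        + (1 + t) ^ (-(α + 1)) * (N * C₁)) = 2 * C₂ * C₁ * N * (1 + t) ^ (-(α + 1)) := by
      have : (1 + t) ^ (2 - α) * ((1 + t) ^ 3)⁻¹ = (1 + t) ^ (-(α + 1)) := by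
        rw [← Real.rpow_natCast, ← Real.rpow_neg (by positivity), ← Real.rpow_add (by positivity)]
        congr 1; push_cast; ring
      rw [← this]; ring
    rw [← e]
    refine le_trans ?_ h3
    rw [Measure.volume_eq_prod]
    refine (lintegral_prod_le _).trans (lintegral_mono fun y => ?_)
    simp only [enorm_smul]
    rw [mul_comm, ← lintegral_const_mul' _ _ ENNReal.ofReal_ne_top,
      ← lintegral_mul_const' _ _ enorm_ne_top]
    refine lintegral_mono fun p => ?_
    rw [← ENNReal.ofReal_mul hN]
    gcongr
    rw [← ofReal_norm]
    exact ENNReal.ofReal_le_ofReal (hb y p)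
  have hmK : AEStronglyMeasurable (fun z : R3 × R3 => K (x - z.1)) volume := by
    rw [Measure.volume_eq_prod]
    exact (hK.aestronglyMeasurable_sub_left x).comp_fst
  exact ⟨⟨hm.smul hmK, lt_of_le_of_lt hle ENNReal.ofReal_lt_top⟩,
    norm_integral_le_of_lintegral_le (by positivity) hle⟩

/-- Fubini: the force field is the convolution of the kernel with the macroscopic density. -/
theorem integral_smul_kernel_eq_conv {h : R3 → R3 → ℝ} {x : R3}
    (hi : Integrable (fun z : R3 × R3 => h z.1 z.2 • K (x - z.1)) volume) :
    ∫ z : R3 × R3, h z.1 z.2 • K (x - z.1) = conv smulL K (fun y => ∫ p, h y p) x := by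
  rw [Measure.volume_eq_prod] at hi ⊢
  rw [integral_prod _ hi, conv]
  exact integral_congr_ae (Eventually.of_forall fun y =>
    integral_smul_const (fun p => h y p) (K (x - y)))

/-- Differentiable phase-space functions `F` that look like a free solution at time `t`: they are
bounded by the transported weight with a gain `⟨p⟩^{-3}`, and their derivative in the direction
`ξ` is bounded, with a gain `⟨p⟩^{-4}`, by the variation of the free coordinates in that
direction. -/
structure IsDispersed (κ a t N : ℝ) (F : R3 → R3 → ℝ) : Prop where
  contDiff : ContDiff ℝ 1 fun z : R3 × R3 => F z.1 z.2
  bound : ∀ x p, |F x p| ≤ N * (weight κ a t x p * (bracket p ^ 3)⁻¹)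
  bound_deriv : ∀ x p (ξ : R3 × R3), |fderiv ℝ (fun z : R3 × R3 => F z.1 z.2) (x, p) ξ|
    ≤ N * (weight κ a t x p * (bracket p ^ 4)⁻¹) * max ‖ξ.1 - t • velDeriv a p ξ.2‖ ‖ξ.2‖

theorem IsDispersed.N_nonneg (hF : IsDispersed κ a t N F) : 0 ≤ N := by
  have h1 := (abs_nonneg _).trans (hF.bound 0 0)
  have h2 := weight_pos (κ := κ) (a := a) t 0 0
  have h3 := bracket_pos (0 : R3)
  exact nonneg_of_mul_nonneg_left h1 (by positivity)

/-- The derivative in the space variable. -/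
def spaceDeriv (F : R3 → R3 → ℝ) (x p : R3) : R3 →L[ℝ] ℝ :=
  (fderiv ℝ (fun z : R3 × R3 => F z.1 z.2) (x, p)).comp (ContinuousLinearMap.inl ℝ R3 R3)

theorem IsDispersed.continuous_fderiv (hF : IsDispersed κ a t N F) :
    Continuous (fderiv ℝ fun z : R3 × R3 => F z.1 z.2) :=
  hF.contDiff.continuous_fderiv one_ne_zero

theorem IsDispersed.hasFDerivAt (hF : IsDispersed κ a t N F) (z : R3 × R3) :
    HasFDerivAt (fun z : R3 × R3 => F z.1 z.2) (fderiv ℝ (fun z : R3 × R3 => F z.1 z.2) z) z :=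
  (hF.contDiff.differentiable one_ne_zero z).hasFDerivAt

theorem IsDispersed.hasFDerivAt_space (hF : IsDispersed κ a t N F) (x p : R3) :
    HasFDerivAt (fun x => F x p) (spaceDeriv F x p) x :=
  (hF.hasFDerivAt (x, p)).comp x (f := fun x : R3 => (x, p)) (hasFDerivAt_prodMk_left x p)

theorem IsDispersed.hasFDerivAt_momentum (hF : IsDispersed κ a t N F) (x p : R3) :
    HasFDerivAt (fun p => F x p) ((fderiv ℝ (fun z : R3 × R3 => F z.1 z.2) (x, p)).comp
      (ContinuousLinearMap.inr ℝ R3 R3)) p :=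
  (hF.hasFDerivAt (x, p)).comp p (f := fun p : R3 => (x, p)) (hasFDerivAt_prodMk_right x p)

theorem IsDispersed.continuous_spaceDeriv (hF : IsDispersed κ a t N F) :
    Continuous fun z : R3 × R3 => spaceDeriv F z.1 z.2 :=
  hF.continuous_fderiv.clm_comp continuous_const

theorem inv_bracket_pow_le_one (p : R3) (n : ℕ) : (bracket p ^ n)⁻¹ ≤ 1 :=
  inv_le_one_of_one_le₀ (one_le_pow₀ (one_le_bracket p))

theorem IsDispersed.abs_le (hF : IsDispersed κ a t N F) (x p : R3) :
    |F x p| ≤ N * weight κ a t x p := by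
  have hN := hF.N_nonneg
  have hw := weight_pos (κ := κ) (a := a) t x p
  refine (hF.bound x p).trans ?_
  gcongr
  exact mul_le_of_le_one_right hw.le (inv_bracket_pow_le_one p 3)

theorem IsDispersed.norm_spaceDeriv_le (hF : IsDispersed κ a t N F) (x p : R3) :
    ‖spaceDeriv F x p‖ ≤ N * weight κ a t x p := by
  have hN := hF.N_nonneg
  have hw := weight_pos (κ := κ) (a := a) t x p
  refine ContinuousLinearMap.opNorm_le_bound _ (by positivity) fun e => ?_
  have := hF.bound_deriv x p (e, 0)
  simp only [map_zero, smul_zero, sub_zero, norm_zero] at this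
  rw [max_eq_left (norm_nonneg e)] at this
  refine this.trans ?_
  gcongr
  exact mul_le_of_le_one_right hw.le (inv_bracket_pow_le_one p 4)

theorem IsDispersed.integrable (ha : 0 ≤ a) (hκ : 0 < κ) (hF : IsDispersed κ a t N F) (x : R3) :
    Integrable (F x) :=
  ((integrable_weight ha hκ t x).const_mul N).mono'
    (hF.contDiff.continuous.comp (by fun_prop : Continuous fun p : R3 =>
      (x, p))).aestronglyMeasurable
    (Eventually.of_forall (hF.abs_le x))

theorem IsDispersed.integrable_spaceDeriv (ha : 0 ≤ a) (hκ : 0 < κ) (hF : IsDispersed κ a t N F)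
    (x : R3) : Integrable (spaceDeriv F x) :=
  ((integrable_weight ha hκ t x).const_mul N).mono'
    (hF.continuous_spaceDeriv.comp
      (by fun_prop : Continuous fun p : R3 => (x, p))).aestronglyMeasurable
    (Eventually.of_forall (hF.norm_spaceDeriv_le x))

theorem integrable_const_mul_bracket (N : ℝ) : Integrable fun p : R3 => N * (bracket p ^ 5)⁻¹ :=
  (integrable_bracket_pow_inv (by norm_num)).const_mul N

theorem IsDispersed.hasFDerivAt_density (ha : 0 ≤ a) (hκ : 0 < κ) (hF : IsDispersed κ a t N F)
    (x : R3) : HasFDerivAt (fun x => ∫ p, F x p) (∫ p, spaceDeriv F x p) x := by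
  have hN := hF.N_nonneg
  refine hasFDerivAt_integral_of_dominated_of_fderiv_le (s := univ) (𝕜 := ℝ)
    (bound := fun p => N * (bracket p ^ 5)⁻¹) univ_mem
    (Eventually.of_forall fun y => (hF.integrable ha hκ y).aestronglyMeasurable)
    (hF.integrable ha hκ x) (hF.integrable_spaceDeriv ha hκ x).aestronglyMeasurable
    (Eventually.of_forall fun p y _ => (hF.norm_spaceDeriv_le y p).trans ?_)
    (integrable_const_mul_bracket N)
    (Eventually.of_forall fun p y _ => hF.hasFDerivAt_space y p)
  gcongr
  exact weight_le hκ t y p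

theorem IsDispersed.continuous_densityDeriv (ha : 0 ≤ a) (hκ : 0 < κ)
    (hF : IsDispersed κ a t N F) : Continuous fun x => ∫ p, spaceDeriv F x p := by
  have hN := hF.N_nonneg
  refine continuous_of_dominated (bound := fun p => N * (bracket p ^ 5)⁻¹)
    (fun x => (hF.integrable_spaceDeriv ha hκ x).aestronglyMeasurable)
    (fun x => Eventually.of_forall fun p => (hF.norm_spaceDeriv_le x p).trans ?_)
    (integrable_const_mul_bracket N)
    (Eventually.of_forall fun p => hF.continuous_spaceDeriv.comp
      (by fun_prop : Continuous fun x : R3 => (x, p)))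
  gcongr
  exact weight_le hκ t x p

theorem continuous_velInv (ha : 0 ≤ a) (e : R3) : Continuous (velInv a e) :=
  continuous_iff_continuousAt.2 fun p => (hasFDerivAt_velInv ha e p).continuousAt

theorem continuous_velInvDeriv (ha : 0 ≤ a) (e : R3) : Continuous (velInvDeriv a e) := by
  have h1 := continuous_lorentz ha
  have h2 : ∀ p : R3, lorentz a p ≠ 0 := fun p => (lorentz_pos ha p).ne'
  have h3 : Continuous fun p : R3 => innerSL ℝ p := (innerSL ℝ).continuous
  unfold velInvDeriv
  refine Continuous.add ?_ (h1.smul (Continuous.add ?_ ?_))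
  · rw [continuous_clm_apply]
    intro y
    simp only [ContinuousLinearMap.smulRight_apply, smul_apply, innerSL_apply_apply]
    fun_prop (disch := exact h2)
  · fun_prop
  · rw [continuous_clm_apply]
    intro y
    simp only [ContinuousLinearMap.smulRight_apply, smul_apply, innerSL_apply_apply]
    fun_prop

/-- Integration by parts in one momentum coordinate. -/
theorem IsDispersed.integral_velInv_mul_fderiv (ha : 0 ≤ a) (ha1 : a ≤ 1) (hκ : 0 < κ)
    (hF : IsDispersed κ a t N F) (ht : 0 ≤ t) (x e : R3) (i : Fin 3) :
    Integrable (fun p => velInv a e p i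
      * fderiv ℝ (fun z : R3 × R3 => F z.1 z.2) (x, p) (0, EuclideanSpace.single i 1)) ∧
    ‖∫ p, velInv a e p i
      * fderiv ℝ (fun z : R3 × R3 => F z.1 z.2) (x, p) (0, EuclideanSpace.single i 1)‖
      ≤ 3 * N * ‖e‖ * ∫ p, weight κ a t x p := by
  have hN := hF.N_nonneg
  let b : R3 := EuclideanSpace.single i 1
  have hb : ‖b‖ = 1 := by simp [b]
  have hpr : ∀ y : R3, ‖y i‖ ≤ ‖y‖ := fun y => PiLp.norm_apply_le y i
  have hw := integrable_weight (κ := κ) ha hκ t x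
  have hv : ∀ p, HasFDerivAt (fun p => velInv a e p i)
      ((EuclideanSpace.proj i).comp (velInvDeriv a e p)) p := fun p =>
    (EuclideanSpace.proj i : R3 →L[ℝ] ℝ).hasFDerivAt.comp p (hasFDerivAt_velInv ha e p)
  have hm := hF.hasFDerivAt_momentum x
  have hcF : Continuous (F x) :=
    hF.contDiff.continuous.comp (by fun_prop : Continuous fun p : R3 => (x, p))
  have hcD : Continuous fun p => fderiv ℝ (fun z : R3 × R3 => F z.1 z.2) (x, p) (0, b) :=
    (hF.continuous_fderiv.comp (by fun_prop : Continuous fun p : R3 => (x, p))).clm_apply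
      continuous_const
  have hcp : Continuous fun y : R3 => y i := (EuclideanSpace.proj i : R3 →L[ℝ] ℝ).continuous
  have hcv : Continuous fun p => velInv a e p i := hcp.comp (continuous_velInv ha e)
  have hcd : Continuous fun p => velInvDeriv a e p b i :=
    hcp.comp ((continuous_velInvDeriv ha e).clm_apply continuous_const)
  have hB1 : ∀ p, ‖velInvDeriv a e p b i * F x p‖ ≤ 3 * N * ‖e‖ * weight κ a t x p := by
    intro p
    have hbp := bracket_pos p
    have h1 : ‖velInvDeriv a e p b i‖ ≤ 3 * bracket p ^ 3 * ‖e‖ := by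
      refine (hpr _).trans ((ContinuousLinearMap.le_opNorm _ _).trans ?_)
      rw [hb, mul_one]
      exact norm_velInvDeriv_le ha ha1 e p
    rw [norm_mul]
    refine (mul_le_mul h1 (hF.bound x p) (abs_nonneg _) (by positivity)).trans_eq ?_
    field_simp
  have hI1 : Integrable fun p => velInvDeriv a e p b i * F x p :=
    (hw.const_mul _).mono' (hcd.mul hcF).aestronglyMeasurable (Eventually.of_forall hB1)
  have hvb : ∀ p, ‖velInv a e p i‖ ≤ bracket p ^ 3 * ‖e‖ := fun p =>
    (hpr _).trans (norm_velInv_le ha ha1 e p)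
  have hI2 : Integrable fun p => velInv a e p i
      * fderiv ℝ (fun z : R3 × R3 => F z.1 z.2) (x, p) (0, b) := by
    refine (hw.const_mul (N * (1 + t) * ‖e‖)).mono' (hcv.mul hcD).aestronglyMeasurable
      (Eventually.of_forall fun p => ?_)
    have hbp := bracket_pos p
    have hwp := weight_pos (κ := κ) (a := a) t x p
    have h1 := hF.bound_deriv x p (0, b)
    have h2 : max ‖(0 : R3) - t • velDeriv a p b‖ ‖b‖ ≤ 1 + t := by
      have := norm_velDeriv_apply_le ha p b
      rw [hb] at this ⊢
      rw [zero_sub, norm_neg, norm_smul, Real.norm_of_nonneg ht]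
      exact max_le (by nlinarith) (by linarith)
    rw [norm_mul]
    calc _ ≤ (bracket p ^ 3 * ‖e‖) * (N * (weight κ a t x p * (bracket p ^ 4)⁻¹) * (1 + t)) :=
          mul_le_mul (hvb p) (h1.trans (by gcongr)) (abs_nonneg _) (by positivity)
      _ = (bracket p)⁻¹ * (N * (1 + t) * ‖e‖ * weight κ a t x p) := by field_simp
      _ ≤ _ := mul_le_of_le_one_left (by positivity)
          (by simpa using inv_bracket_pow_le_one p 1)
  have hI3 : Integrable fun p => velInv a e p i * F x p := by
    refine (hw.const_mul (N * ‖e‖)).mono' (hcv.mul hcF).aestronglyMeasurable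
      (Eventually.of_forall fun p => ?_)
    have hbp := bracket_pos p
    rw [norm_mul]
    refine (mul_le_mul (hvb p) (hF.bound x p) (abs_nonneg _) (by positivity)).trans_eq ?_
    field_simp
  have e1 : ∀ p, fderiv ℝ (fun p => velInv a e p i) p b = velInvDeriv a e p b i := fun p => by
    rw [(hv p).fderiv]; rfl
  have e2 : ∀ p, fderiv ℝ (F x) p b
      = fderiv ℝ (fun z : R3 × R3 => F z.1 z.2) (x, p) (0, b) := fun p => by
    rw [(hm p).fderiv]; rfl
  have key := integral_mul_fderiv_eq_neg_fderiv_mul_of_integrable (μ := volume)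
    (f := fun p => velInv a e p i) (g := F x) (v := b)
    (by simpa only [e1] using hI1) (by simpa only [e2] using hI2) hI3
    (fun p _ => (hv p).differentiableAt) (fun p _ => (hm p).differentiableAt)
  simp only [e1, e2] at key
  refine ⟨hI2, ?_⟩
  rw [key, norm_neg, ← integral_const_mul]
  exact norm_integral_le_of_norm_le (hw.const_mul _) (Eventually.of_forall hB1)

/-- The derivative of the macroscopic density gains a power of `t`. The direction `t e` in space
equals, up to the direction `A(p) e` in momentum with `A = (Dv)⁻¹`, a direction in which the free
coordinates barely move; the momentum derivative is integrated by parts. -/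
theorem IsDispersed.norm_densityDeriv_le (ha : 0 ≤ a) (ha1 : a ≤ 1) (hκ : 0 < κ)
    (hF : IsDispersed κ a t N F) (ht : 0 ≤ t) (x : R3) :
    ‖∫ p, spaceDeriv F x p‖ ≤ 20 * N * (1 + t)⁻¹ * ∫ p, weight κ a t x p := by
  have hN := hF.N_nonneg
  have hw := integrable_weight (κ := κ) ha hκ t x
  have hw0 : 0 ≤ ∫ p, weight κ a t x p := integral_nonneg fun p => (weight_pos t x p).le
  let G := fun p => fderiv ℝ (fun z : R3 × R3 => F z.1 z.2) (x, p)
  rcases le_total t 1 with h | h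
  · have h1 : ‖∫ p, spaceDeriv F x p‖ ≤ N * ∫ p, weight κ a t x p := by
      rw [← integral_const_mul]
      exact norm_integral_le_of_norm_le (hw.const_mul _)
        (Eventually.of_forall (hF.norm_spaceDeriv_le x))
    refine h1.trans ?_
    gcongr
    rw [← div_eq_mul_inv, le_div_iff₀ (by positivity)]
    nlinarith
  · have ht0 : 0 < t := by linarith
    refine ContinuousLinearMap.opNorm_le_bound _ (by positivity) fun e => ?_
    rw [ContinuousLinearMap.integral_apply (hF.integrable_spaceDeriv ha hκ x)]
    have hsum : ∀ p, G p (0, velInv a e p)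
        = ∑ i, velInv a e p i * G p (0, EuclideanSpace.single i 1) := fun p => by
      have h1 := (EuclideanSpace.basisFun (Fin 3) ℝ).sum_repr (velInv a e p)
      have h2 : ((0 : R3), velInv a e p)
          = ContinuousLinearMap.inr ℝ R3 R3 (velInv a e p) := rfl
      rw [h2]
      nth_rewrite 1 [← h1]
      simp only [map_sum, map_smul, EuclideanSpace.basisFun_repr, EuclideanSpace.basisFun_apply,
        smul_eq_mul]
      rfl
    have hsplit : ∀ p, t * spaceDeriv F x p e = G p (t • e, velInv a e p)
        - ∑ i, velInv a e p i * G p (0, EuclideanSpace.single i 1) := fun p => by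
      rw [← hsum, ← map_sub, Prod.mk_sub_mk, sub_zero, sub_self]
      have : (t • e, (0 : R3)) = t • ContinuousLinearMap.inl ℝ R3 R3 e := by
        ext1 <;> simp
      rw [this, map_smul]
      rfl
    have hB : ∀ p, ‖G p (t • e, velInv a e p)‖ ≤ N * ‖e‖ * weight κ a t x p := fun p => by
      have hbp := bracket_pos p
      have hwp := weight_pos (κ := κ) (a := a) t x p
      have h1 := hF.bound_deriv x p (t • e, velInv a e p)
      simp only [velDeriv_velInv ha, sub_self, norm_zero] at h1
      rw [max_eq_right (norm_nonneg _)] at h1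
      calc _ ≤ _ := h1
        _ ≤ N * (weight κ a t x p * (bracket p ^ 4)⁻¹) * (bracket p ^ 3 * ‖e‖) := by
            gcongr
            exact norm_velInv_le ha ha1 e p
        _ = (bracket p)⁻¹ * (N * ‖e‖ * weight κ a t x p) := by field_simp
        _ ≤ _ := mul_le_of_le_one_left (by positivity)
            (by simpa using inv_bracket_pow_le_one p 1)
    have hGc : Continuous fun p => G p (t • e, velInv a e p) :=
      (hF.continuous_fderiv.comp (by fun_prop : Continuous fun p : R3 => (x, p))).clm_apply
        (continuous_const.prodMk (continuous_velInv ha e))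
    have hGi : Integrable fun p => G p (t • e, velInv a e p) :=
      (hw.const_mul _).mono' hGc.aestronglyMeasurable (Eventually.of_forall hB)
    have hIBP := fun i => hF.integral_velInv_mul_fderiv ha ha1 hκ ht x e i
    have key : t * ∫ p, spaceDeriv F x p e = (∫ p, G p (t • e, velInv a e p))
        - ∑ i, ∫ p, velInv a e p i * G p (0, EuclideanSpace.single i 1) := by
      rw [← integral_const_mul]
      simp only [hsplit]
      rw [integral_sub hGi (integrable_finsetSum _ fun i _ => (hIBP i).1),
        integral_finsetSum _ fun i _ => (hIBP i).1]
    have h1 : ‖∫ p, G p (t • e, velInv a e p)‖ ≤ N * ‖e‖ * ∫ p, weight κ a t x p := by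
      rw [← integral_const_mul]
      exact norm_integral_le_of_norm_le (hw.const_mul _) (Eventually.of_forall hB)
    have h2 : ‖∑ i, ∫ p, velInv a e p i * G p (0, EuclideanSpace.single i 1)‖
        ≤ 9 * N * ‖e‖ * ∫ p, weight κ a t x p := by
      refine (norm_sum_le_of_le _ fun i _ => (hIBP i).2).trans_eq ?_
      rw [Finset.sum_const, Finset.card_fin, nsmul_eq_mul]
      push_cast; ring
    have h3 : t * ‖∫ p, spaceDeriv F x p e‖ ≤ 10 * (N * ‖e‖ * ∫ p, weight κ a t x p) := by
      calc t * ‖∫ p, spaceDeriv F x p e‖ = ‖t * ∫ p, spaceDeriv F x p e‖ := by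
            rw [norm_mul, Real.norm_of_nonneg ht]
        _ ≤ _ := by
            rw [key]
            refine (norm_sub_le _ _).trans ((add_le_add h1 h2).trans_eq ?_)
            ring
    have h4 : (1 + t) * ‖∫ p, spaceDeriv F x p e‖ ≤ 20 * (N * ‖e‖ * ∫ p, weight κ a t x p) := by
      nlinarith [norm_nonneg (∫ p, spaceDeriv F x p e)]
    calc _ ≤ (1 + t)⁻¹ * (20 * (N * ‖e‖ * ∫ p, weight κ a t x p)) :=
          (le_inv_mul_iff₀ (by positivity)).2 h4
      _ = _ := by ring

/-- The force field of a dispersed function is differentiable, its derivative is of size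
`(1 + t)^{-(α+2)}` and has a modulus of continuity that only depends on the kernel. -/
theorem IsKernel.exists_field_deriv_bound (hα₁ : 1 < α) (hα₂ : α < 2) (hκ : 3 < κ)
    (hK : IsKernel α K) : ∃ C : ℝ, 0 < C ∧ ∃ d : ℝ → ℝ, (∀ ε, 0 < ε → 0 < d ε) ∧
      ∀ a : ℝ, 0 ≤ a → a ≤ 1 → ∀ t : ℝ, 0 ≤ t → ∀ (N : ℝ) (F : R3 → R3 → ℝ), N ≤ 1 →
      IsDispersed κ a t N F → ∃ D : R3 → R3 →L[ℝ] R3,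
      (∀ x, HasFDerivAt (fun x => ∫ z : R3 × R3, F z.1 z.2 • K (x - z.1)) (D x) x) ∧
      (∀ x, ‖D x‖ ≤ C * N * (1 + t) ^ (-(α + 2))) ∧
      ∀ ε, 0 < ε → ∀ x y, ‖x - y‖ ≤ d ε → ‖D x - D y‖ ≤ ε := by
  obtain ⟨C₁, hC₁, h1⟩ := exists_isDensity hκ
  obtain ⟨C₂, hC₂, h2⟩ := hK.exists_norm_conv_le hα₁ hα₂
  obtain ⟨C₃, -, h3⟩ := hK.exists_field_bound hα₁ hα₂ hκ
  have h4 : ∀ ε : ℝ, ∃ d : ℝ, 0 < ε → 0 < d ∧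
      ∀ {W Z : Type} [NormedAddCommGroup W] [NormedSpace ℝ W] [NormedAddCommGroup Z]
      [NormedSpace ℝ Z] (L : W →L[ℝ] R3 →L[ℝ] Z) (g : R3 → W) (A B : ℝ),
      (∀ u k, ‖L u k‖ ≤ ‖u‖ * ‖k‖) → IsDensity A B g → ∀ x y, ‖x - y‖ ≤ d →
      ‖conv L K g x - conv L K g y‖ ≤ ε / (40 * C₁) * (A + B) := by
    intro ε
    by_cases hε : 0 < ε
    · obtain ⟨d, hd, h⟩ := hK.exists_conv_modulus hα₁ hα₂ (ε := ε / (40 * C₁)) (by positivity)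
      exact ⟨d, fun _ => ⟨hd, h⟩⟩
    · exact ⟨0, fun h => absurd h hε⟩
  choose d hd using h4
  refine ⟨40 * C₁ * C₂, by positivity, d, fun ε hε => (hd ε hε).1,
    fun a ha ha1 t ht N F hN1 hF => ?_⟩
  have hN := hF.N_nonneg
  have hκ0 : 0 < κ := by linarith
  have hρ : IsDensity _ _ fun x => ∫ p, F x p := h1 a ha ha1 t ht N _ hN
    (continuous_iff_continuousAt.2 fun x => (hF.hasFDerivAt_density ha hκ0 x).continuousAt)
    fun x => by
      rw [← integral_const_mul]
      exact norm_integral_le_of_norm_le ((integrable_weight ha hκ0 t x).const_mul _)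
        (Eventually.of_forall (hF.abs_le x))
  have hρ' := h1 a ha ha1 t ht (20 * N * (1 + t)⁻¹) _ (by positivity)
    (hF.continuous_densityDeriv ha hκ0) (hF.norm_densityDeriv_le ha ha1 hκ0 ht)
  have hconv : (fun x => ∫ z : R3 × R3, F z.1 z.2 • K (x - z.1))
      = conv smulL K fun y => ∫ p, F y p := funext fun x =>
    integral_smul_kernel_eq_conv (h3 a ha ha1 t ht N F hN
      hF.contDiff.continuous.aestronglyMeasurable hF.abs_le x).1
  have ht1 : (1 + t)⁻¹ ≤ 1 := inv_le_one_of_one_le₀ (by linarith)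
  refine ⟨conv gradL K fun x => ∫ p, spaceDeriv F x p, fun x => ?_, fun x => ?_,
    fun ε hε x y h => ?_⟩
  · rw [hconv]
    exact hK.hasFDerivAt_conv hα₁ hα₂ hρ hρ' (hF.hasFDerivAt_density ha hκ0) x
  · refine (h2 gradL _ _ _ (1 + t) norm_gradL_le hρ' (by linarith) x).trans_eq ?_
    have e1 : (1 + t) ^ (2 - α) * ((1 + t) ^ 3)⁻¹ = (1 + t) ^ (-(α + 1)) := by
      rw [← Real.rpow_natCast, ← Real.rpow_neg (by positivity), ← Real.rpow_add (by positivity)]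
      congr 1; push_cast; ring
    have e2 : (1 + t) ^ (-(α + 1)) * (1 + t)⁻¹ = (1 + t) ^ (-(α + 2)) := by
      rw [← Real.rpow_neg_one, ← Real.rpow_add (by positivity)]
      congr 1; ring
    calc _ = C₂ * (C₁ * (20 * N) * ((1 + t) ^ (2 - α) * ((1 + t) ^ 3)⁻¹ * (1 + t)⁻¹
          + (1 + t) ^ (-(α + 1)) * (1 + t)⁻¹)) := by ring
      _ = _ := by rw [e1, e2]; ring
  · refine ((hd ε hε).2 gradL _ _ _ norm_gradL_le hρ' x y h).trans ?_
    have h5 : C₁ * (20 * N * (1 + t)⁻¹) ≤ C₁ * (20 * 1 * 1) := by gcongr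
    have h6 : C₁ * (20 * N * (1 + t)⁻¹) * ((1 + t) ^ 3)⁻¹ ≤ C₁ * (20 * 1 * 1) * 1 := by
      gcongr
      exact inv_le_one_of_one_le₀ (one_le_pow₀ (by linarith))
    calc _ ≤ ε / (40 * C₁) * (C₁ * (20 * 1 * 1) * 1 + C₁ * (20 * 1 * 1)) := by gcongr
      _ = ε := by field_simp; ring

end Dispersed

/-! ### The self-consistent field as a fixed point -/

section FixedPoint

open Filter Topology

/-- The field generated by the phase-space density `f` through the kernel `K`. -/
def selfField (K : R3 → R3) (f : ℝ → R3 → R3 → ℝ) (t : ℝ) (x : R3) : R3 :=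
  ∫ z : R3 × R3, f t z.1 z.2 • K (x - z.1)

/-- The field generated by the datum transported along a given field `E`, extended evenly to
negative times. -/
def fieldMap (K : R3 → R3) (a : ℝ) (f₀ : R3 → R3 → ℝ) (E : ℝ → R3 → R3) (t : ℝ) (x : R3) : R3 :=
  selfField K (transported a E f₀) |t| x

variable {α κ a η δ : ℝ} {K : R3 → R3} {f₀ : R3 → R3 → ℝ} {E : ℝ → R3 → R3} {d : ℝ → ℝ}

theorem IsDecayField.isDispersed_transported (hα : 1 < α) (hδ : δ ≤ (α - 1) / 2) (hδ1 : δ ≤ 1)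
    (ha : 0 ≤ a) (ha1 : a ≤ 1) (hκ : 0 < κ) (hE : IsDecayField α δ d E) (hf : IsDatum κ η f₀)
    {t : ℝ} (ht : 0 ≤ t) : IsDispersed κ a t (transConst α κ * η) (transported a E f₀ t) where
  contDiff := (hE.contDiff_transported hα hδ1 ha ha1 hf).comp
    (contDiff_const.prodMk contDiff_id : ContDiff ℝ 1 fun z : R3 × R3 => (t, z))
  bound x p := abs_transported_le hα hδ hδ1 ha ha1 hκ hE hf ht x p
  bound_deriv x p ξ := hE.abs_fderiv_transported_le hα hδ hδ1 ha ha1 hκ hf ht x p ξ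

theorem IsDecayField.mono (hE : IsDecayField α δ d E) {δ' : ℝ} (h : δ ≤ δ') :
    IsDecayField α δ' d E where
  cont := hE.cont
  bound t x := (hE.bound t x).trans (by gcongr)
  diff := hE.diff
  bound_deriv t x := (hE.bound_deriv t x).trans (by gcongr)
  modulus_pos := hE.modulus_pos
  modulus := hE.modulus

theorem isDecayField_zero (hδ : 0 ≤ δ) (hd : ∀ ε, 0 < ε → 0 < d ε) :
    IsDecayField α δ d fun _ _ => 0 where
  cont := continuous_const
  bound t x := by rw [norm_zero]; positivity
  diff t := differentiable_const _
  bound_deriv t x := by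
    rw [fderiv_fun_const, Pi.zero_apply, norm_zero]; positivity
  modulus_pos := hd
  modulus ε hε t x y _ := by simpa using hε.le

theorem IsDecayField.continuous_fieldMap (hα₁ : 1 < α) (hα₂ : α < 2) (hκ : 3 < κ)
    (hK : IsKernel α K) (hδ : δ ≤ (α - 1) / 2) (hδ1 : δ ≤ 1)
    (ha : 0 ≤ a) (ha1 : a ≤ 1) (hE : IsDecayField α δ d E) (hf : IsDatum κ η f₀) :
    Continuous fun q : ℝ × R3 => fieldMap K a f₀ E q.1 q.2 := by
  obtain ⟨C₁, hC₁, h1⟩ := exists_isDensity hκ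
  obtain ⟨C₃, -, h3⟩ := hK.exists_field_bound hα₁ hα₂ hκ
  have hκ0 : 0 < κ := by linarith
  let N := transConst α κ * η
  have hN : 0 ≤ N := mul_nonneg (transConst_pos α κ).le hf.eta_nonneg
  have hD : ∀ t : ℝ, IsDispersed κ a |t| N (transported a E f₀ |t|) := fun t =>
    hE.isDispersed_transported hα₁ hδ hδ1 ha ha1 hκ0 hf (abs_nonneg t)
  have hc : Continuous fun q : ℝ × R3 => ∫ p, transported a E f₀ |q.1| q.2 p := by
    refine continuous_of_dominated (bound := fun p => N * (bracket p ^ 5)⁻¹)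
      (fun q => ((hD q.1).integrable ha hκ0 q.2).aestronglyMeasurable)
      (fun q => Eventually.of_forall fun p => ((hD q.1).abs_le q.2 p).trans ?_)
      (integrable_const_mul_bracket N) (Eventually.of_forall fun p => ?_)
    · gcongr
      exact weight_le hκ0 _ _ _
    · exact (hE.contDiff_transported hα₁ hδ1 ha ha1 hf).continuous.comp
        (by fun_prop : Continuous fun q : ℝ × R3 => (|q.1|, q.2, p))
  have hρ : ∀ t : ℝ, IsDensity (C₁ * N) (C₁ * N) fun x => ∫ p, transported a E f₀ |t| x p := by
    intro t
    have h := h1 a ha ha1 |t| (abs_nonneg t) N (fun x => ∫ p, transported a E f₀ |t| x p) hN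
      (hc.comp (by fun_prop : Continuous fun x : R3 => (t, x))) fun x => by
        rw [← integral_const_mul]
        exact norm_integral_le_of_norm_le ((integrable_weight ha hκ0 |t| x).const_mul _)
          (Eventually.of_forall ((hD t).abs_le x))
    refine ⟨by positivity, by positivity, h.cont, fun y => (h.sup_le y).trans ?_, h.mass_le⟩
    exact mul_le_of_le_one_right (by positivity)
      (inv_le_one_of_one_le₀ (one_le_pow₀ (by linarith [abs_nonneg t])))
  have he : (fun q : ℝ × R3 => fieldMap K a f₀ E q.1 q.2)
      = fun q : ℝ × R3 => conv smulL K (fun y => ∫ p, transported a E f₀ |q.1| y p) q.2 :=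
    funext fun q => integral_smul_kernel_eq_conv (h3 a ha ha1 |q.1| (abs_nonneg _) N _ hN
      (hD q.1).contDiff.continuous.aestronglyMeasurable (hD q.1).abs_le q.2).1
  rw [he]
  exact hK.continuous_conv hα₁ hα₂ norm_smulL_le
    (g := fun t y => ∫ p, transported a E f₀ |t| y p) hc hρ

/-- The field map preserves the class of small decaying fields and is Lipschitz continuous with a
constant proportional to the size of the datum. -/
theorem IsKernel.exists_fieldMap_bound (hα₁ : 1 < α) (hα₂ : α < 2) (hκ : 3 < κ)
    (hK : IsKernel α K) : ∃ C : ℝ, 0 < C ∧ ∃ d : ℝ → ℝ, (∀ ε, 0 < ε → 0 < d ε) ∧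
      ∀ (a η : ℝ) (f₀ : R3 → R3 → ℝ), 0 ≤ a → a ≤ 1 → IsDatum κ η f₀ → C * η ≤ 1 →
      (∀ (E : ℝ → R3 → R3) (d' : ℝ → ℝ), IsDecayField α ((α - 1) / 2) d' E →
        IsDecayField α (C * η) d (fieldMap K a f₀ E)) ∧
      (∀ (E₁ E₂ : ℝ → R3 → R3) (d₁ d₂ : ℝ → ℝ) (D : ℝ), 0 ≤ D →
        IsDecayField α ((α - 1) / 2) d₁ E₁ → IsDecayField α ((α - 1) / 2) d₂ E₂ →
        (∀ t x, ‖E₁ t x - E₂ t x‖ ≤ D * (1 + |t|) ^ (-(α + 1))) → ∀ t x,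
        ‖fieldMap K a f₀ E₁ t x - fieldMap K a f₀ E₂ t x‖
          ≤ C * η * D * (1 + |t|) ^ (-(α + 1))) := by
  obtain ⟨C₁, hC₁, h1⟩ := hK.exists_field_bound hα₁ hα₂ hκ
  obtain ⟨C₂, hC₂, d, hd, h2⟩ := hK.exists_field_deriv_bound hα₁ hα₂ hκ
  have hT := transConst_pos α κ
  have hκ0 : 0 < κ := by linarith
  have hδ1 : (α - 1) / 2 ≤ 1 := by linarith
  refine ⟨(C₁ + C₂ + 1) * transConst α κ, by positivity, d, hd, fun a η f₀ ha ha1 hf hη => ?_⟩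
  have hη0 := hf.eta_nonneg
  have hN : 0 ≤ transConst α κ * η := by positivity
  have hN1 : transConst α κ * η ≤ 1 := by nlinarith
  have hw : ∀ (t q : ℝ), 0 ≤ (1 + |t|) ^ q := fun t q => by positivity
  refine ⟨fun E d' hE => ?_, fun E₁ E₂ d₁ d₂ D hD hE₁ hE₂ hE t x => ?_⟩
  · have hdis : ∀ t : ℝ, IsDispersed κ a |t| (transConst α κ * η) (transported a E f₀ |t|) :=
      fun t => hE.isDispersed_transported hα₁ le_rfl hδ1 ha ha1 hκ0 hf (abs_nonneg t)
    have h3 := fun t : ℝ => h1 a ha ha1 |t| (abs_nonneg t) _ _ hN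
      (hdis t).contDiff.continuous.aestronglyMeasurable (hdis t).abs_le
    choose A hA hAb hAm using fun t : ℝ => h2 a ha ha1 |t| (abs_nonneg t) _ _ hN1 (hdis t)
    have hA' : ∀ t x, HasFDerivAt (fieldMap K a f₀ E t) (A t x) x := hA
    have e : ∀ t x, fderiv ℝ (fieldMap K a f₀ E t) x = A t x := fun t x => (hA' t x).fderiv
    refine ⟨hE.continuous_fieldMap hα₁ hα₂ hκ hK le_rfl hδ1 ha ha1 hf, fun t x => ?_,
      fun t x => (hA' t x).differentiableAt, fun t x => ?_, hd, fun ε hε t x y h => ?_⟩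
    · refine ((h3 t x).2).trans ?_
      have := hw t (-(α + 1))
      rw [mul_assoc (C₁ + C₂ + 1)]
      gcongr
      linarith
    · rw [e]
      refine (hAb t x).trans ?_
      have := hw t (-(α + 2))
      rw [mul_assoc (C₁ + C₂ + 1)]
      gcongr
      linarith
    · rw [e, e]
      exact hAm t ε hε x y h
  · have hd₁ := hE₁.isDispersed_transported hα₁ le_rfl hδ1 ha ha1 hκ0 hf (abs_nonneg t)
    have hd₂ := hE₂.isDispersed_transported hα₁ le_rfl hδ1 ha ha1 hκ0 hf (abs_nonneg t)
    have hm₁ := hd₁.contDiff.continuous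
    have hm₂ := hd₂.contDiff.continuous
    have i₁ := (h1 a ha ha1 |t| (abs_nonneg t) _ _ hN hm₁.aestronglyMeasurable hd₁.abs_le x).1
    have i₂ := (h1 a ha ha1 |t| (abs_nonneg t) _ _ hN hm₂.aestronglyMeasurable hd₂.abs_le x).1
    have h3 := (h1 a ha ha1 |t| (abs_nonneg t) (transConst α κ * η * D)
      (fun y p => transported a E₁ f₀ |t| y p - transported a E₂ f₀ |t| y p) (by positivity)
      (hm₁.sub hm₂).aestronglyMeasurable
      (abs_transported_sub_le hα₁ le_rfl hδ1 ha ha1 hκ0 hE₁ hE₂ hD (fun s hs y => by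
        have := hE s y
        rwa [abs_of_nonneg hs] at this) hf (abs_nonneg t)) x).2
    rw [fieldMap, fieldMap, selfField, selfField, ← integral_sub i₁ i₂]
    simp only [← sub_smul]
    refine h3.trans ?_
    have := hw t (-(α + 1))
    have h4 : C₁ * (transConst α κ * η * D) ≤ (C₁ + C₂ + 1) * transConst α κ * η * D := by
      have : 0 ≤ transConst α κ * η * D := by positivity
      nlinarith
    gcongr

/-- Derivatives with a common modulus of continuity are controlled by the functions themselves. -/
theorem norm_fderiv_sub_le_of_modulus {V W : Type*} [NormedAddCommGroup V] [NormedSpace ℝ V]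
    [NormedAddCommGroup W] [NormedSpace ℝ W] {f g : V → W} (hf : Differentiable ℝ f)
    (hg : Differentiable ℝ g) {r ε S : ℝ} (hr : 0 < r) (hε : 0 ≤ ε) (hS : 0 ≤ S)
    (hfm : ∀ x y, ‖x - y‖ ≤ r → ‖fderiv ℝ f x - fderiv ℝ f y‖ ≤ ε)
    (hgm : ∀ x y, ‖x - y‖ ≤ r → ‖fderiv ℝ g x - fderiv ℝ g y‖ ≤ ε) (h : ∀ x, ‖f x - g x‖ ≤ S)
    (x : V) :
    ‖fderiv ℝ f x - fderiv ℝ g x‖ ≤ 2 * ε + 2 * S / r := by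
  refine ContinuousLinearMap.opNorm_le_bound _ (by positivity) fun e => ?_
  rcases eq_or_ne e 0 with rfl | he
  · simp
  have he0 : 0 < ‖e‖ := norm_pos_iff.2 he
  let k : V := (r / ‖e‖) • e
  have hk : ‖k‖ = r := by
    rw [norm_smul, Real.norm_of_nonneg (by positivity)]
    field_simp
  have h1 := norm_remainder_le (fun y => (hf y).hasFDerivAt) (fun y hy => hfm y x hy) hk.le
  have h2 := norm_remainder_le (fun y => (hg y).hasFDerivAt) (fun y hy => hgm y x hy) hk.le
  have h3 : ‖(fderiv ℝ f x - fderiv ℝ g x) k‖ ≤ 2 * ε * r + 2 * S := by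
    have e1 : (fderiv ℝ f x - fderiv ℝ g x) k
        = (g (x + k) - g x - fderiv ℝ g x k) - (f (x + k) - f x - fderiv ℝ f x k)
          + ((f (x + k) - g (x + k)) - (f x - g x)) := by
      rw [sub_apply]; abel
    rw [e1]
    refine (norm_add_le _ _).trans ((add_le_add ((norm_sub_le _ _).trans (add_le_add h2 h1))
      ((norm_sub_le _ _).trans (add_le_add (h (x + k)) (h x)))).trans_eq ?_)
    rw [hk]; ring
  have e2 : e = (‖e‖ / r) • k := by
    simp only [k, smul_smul]
    field_simp
    simp
  conv_lhs => rw [e2]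
  rw [map_smul, norm_smul, Real.norm_of_nonneg (by positivity)]
  calc _ ≤ ‖e‖ / r * (2 * ε * r + 2 * S) := by gcongr
    _ = _ := by field_simp

/-- The class of decaying fields with a given modulus is closed under uniform convergence. -/
theorem exists_isDecayField_limit (hα : 0 < α) {E : ℕ → ℝ → R3 → R3}
    (hE : ∀ n, IsDecayField α δ d (E n)) {c : ℕ → ℝ} (hc0 : ∀ n, 0 ≤ c n)
    (hc : Tendsto c atTop (𝓝 0))
    (h : ∀ n m, n ≤ m → ∀ t x, ‖E n t x - E m t x‖ ≤ c n * (1 + |t|) ^ (-(α + 1))) :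
    ∃ E' : ℝ → R3 → R3, IsDecayField α δ d E' ∧
      ∀ n t x, ‖E n t x - E' t x‖ ≤ c n * (1 + |t|) ^ (-(α + 1)) := by
  have h' : ∀ n m, n ≤ m → ∀ t x, ‖E n t x - E m t x‖ ≤ c n := fun n m hnm t x =>
    (h n m hnm t x).trans (mul_le_of_le_one_right (hc0 n)
      (one_add_abs_rpow_le_one (by linarith) t))
  have hcau : ∀ t x, CauchySeq fun n => E n t x := fun t x =>
    cauchySeq_of_le_tendsto_0' c (fun n m hnm => by rw [dist_eq_norm]; exact h' n m hnm t x) hc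
  choose E' hlim using fun t x => cauchySeq_tendsto_of_complete (hcau t x)
  have hE' : ∀ n t x, ‖E n t x - E' t x‖ ≤ c n * (1 + |t|) ^ (-(α + 1)) := fun n t x =>
    le_of_tendsto ((hlim t x).const_sub (E n t x)).norm
      (eventually_atTop.2 ⟨n, fun m hm => h n m hm t x⟩)
  have hE'1 : ∀ n t x, ‖E n t x - E' t x‖ ≤ c n := fun n t x =>
    (hE' n t x).trans (mul_le_of_le_one_right (hc0 n)
      (one_add_abs_rpow_le_one (by linarith) t))
  -- The derivatives form a uniform Cauchy sequence.
  have hD : ∀ ε, 0 < ε → ∃ n₀, ∀ n, n₀ ≤ n → ∀ m, n ≤ m → ∀ t x,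
      ‖fderiv ℝ (E n t) x - fderiv ℝ (E m t) x‖ ≤ ε := by
    intro ε hε
    have hd := (hE 0).modulus_pos (ε / 4) (by positivity)
    obtain ⟨n₀, hn₀⟩ := eventually_atTop.1
      (hc.eventually_le_const (show 0 < ε * d (ε / 4) / 4 by positivity))
    refine ⟨n₀, fun n hn m hm t x => ?_⟩
    refine (norm_fderiv_sub_le_of_modulus ((hE n).diff t) ((hE m).diff t) hd
      (by positivity) (hc0 n) ((hE n).modulus _ (by positivity) t)
      ((hE m).modulus _ (by positivity) t) (h' n m hm t) x).trans ?_
    have h1 : 2 * c n / d (ε / 4) ≤ ε / 2 := by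
      rw [div_le_iff₀ hd]
      linarith [hn₀ n hn]
    linarith
  have hcau' : ∀ t x, CauchySeq fun n => fderiv ℝ (E n t) x := fun t x => by
    refine Metric.cauchySeq_iff'.2 fun ε hε => ?_
    obtain ⟨n₀, hn₀⟩ := hD (ε / 2) (by positivity)
    refine ⟨n₀, fun n hn => ?_⟩
    rw [dist_comm, dist_eq_norm]
    exact (hn₀ n₀ le_rfl n hn t x).trans_lt (by linarith)
  choose A hA using fun t x => cauchySeq_tendsto_of_complete (hcau' t x)
  have hA' : ∀ t, TendstoUniformly (fun n => fderiv ℝ (E n t)) (A t) atTop := fun t => by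
    rw [Metric.tendstoUniformly_iff]
    intro ε hε
    obtain ⟨n₀, hn₀⟩ := hD (ε / 2) (by positivity)
    filter_upwards [eventually_ge_atTop n₀] with n hn x
    rw [dist_comm, dist_eq_norm]
    refine lt_of_le_of_lt (le_of_tendsto ((hA t x).const_sub _).norm
      (eventually_atTop.2 ⟨n, fun m hm => hn₀ n hn m hm t x⟩)) (by linarith)
  have hdA : ∀ t x, HasFDerivAt (E' t) (A t x) x := fun t x =>
    hasFDerivAt_of_tendstoUniformly (hA' t) (fun n x => ((hE n).diff t x).hasFDerivAt)
      (fun x => hlim t x) x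
  have e : ∀ t x, fderiv ℝ (E' t) x = A t x := fun t x => (hdA t x).fderiv
  refine ⟨E', ⟨?_, fun t x => ?_, fun t x => (hdA t x).differentiableAt, fun t x => ?_,
    (hE 0).modulus_pos, fun ε hε t x y hxy => ?_⟩, hE'⟩
  · have hu : TendstoUniformly (fun n (q : ℝ × R3) => E n q.1 q.2) (fun q => E' q.1 q.2)
        atTop := by
      rw [Metric.tendstoUniformly_iff]
      intro ε hε
      filter_upwards [hc.eventually_lt_const hε] with n hn q
      rw [dist_comm, dist_eq_norm]
      exact (hE'1 n q.1 q.2).trans_lt hn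
    exact hu.continuous (Frequently.of_forall fun n => (hE n).cont)
  · exact le_of_tendsto (hlim t x).norm (Eventually.of_forall fun n => (hE n).bound t x)
  · rw [e]
    exact le_of_tendsto (hA t x).norm (Eventually.of_forall fun n => (hE n).bound_deriv t x)
  · rw [e, e]
    exact le_of_tendsto ((hA t x).sub (hA t y)).norm
      (Eventually.of_forall fun n => (hE n).modulus ε hε t x y hxy)

/-- Small data generate a self-consistent decaying field. -/
theorem IsKernel.exists_selfConsistent (hα₁ : 1 < α) (hα₂ : α < 2) (hκ : 3 < κ)
    (hK : IsKernel α K) : ∃ ε : ℝ, 0 < ε ∧ ∃ C : ℝ, 0 < C ∧ C * ε ≤ (α - 1) / 2 ∧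
      ∀ (a η : ℝ) (f₀ : R3 → R3 → ℝ), 0 ≤ a → a ≤ 1 → IsDatum κ η f₀ → η ≤ ε →
      ∃ (d : ℝ → ℝ) (E : ℝ → R3 → R3), IsDecayField α (C * η) d E ∧
        ∀ t x, E t x = fieldMap K a f₀ E t x := by
  obtain ⟨C, hC, d, hd, H⟩ := hK.exists_fieldMap_bound hα₁ hα₂ hκ
  have hδ : 0 < (α - 1) / 2 := by linarith
  have hδ1 : (α - 1) / 2 < 1 / 2 := by linarith
  refine ⟨(α - 1) / 2 / C, by positivity, C, hC, by rw [mul_div_cancel₀ _ hC.ne'],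
    fun a η f₀ ha ha1 hf hη => ?_⟩
  have hη' : C * η ≤ (α - 1) / 2 := by
    rw [le_div_iff₀ hC] at hη
    linarith
  have hη0 := hf.eta_nonneg
  obtain ⟨hmap, hcon⟩ := H a η f₀ ha ha1 hf (by linarith)
  let E : ℕ → ℝ → R3 → R3 := fun n => (fieldMap K a f₀)^[n] fun _ _ => 0
  have hsucc : ∀ n, E (n + 1) = fieldMap K a f₀ (E n) := fun n =>
    Function.iterate_succ_apply' _ _ _
  have hE : ∀ n, IsDecayField α ((α - 1) / 2) d (E n) := by
    intro n
    induction n with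
    | zero => exact isDecayField_zero hδ.le hd
    | succ n ih => rw [hsucc]; exact (hmap _ _ ih).mono hη'
  have hw : ∀ t : ℝ, 0 ≤ (1 + |t|) ^ (-(α + 1)) := fun t => by positivity
  have hstep : ∀ n t x, ‖E n t x - E (n + 1) t x‖ ≤ (1 / 2) ^ n * (1 + |t|) ^ (-(α + 1)) := by
    intro n
    induction n with
    | zero =>
      intro t x
      have h1 := (hE 1).bound t x
      have h2 : E 0 t x = 0 := rfl
      rw [h2, zero_sub, norm_neg, pow_zero]
      refine h1.trans ?_
      have := hw t
      gcongr
      linarith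
    | succ n ih =>
      intro t x
      rw [hsucc (n + 1)]
      nth_rewrite 1 [hsucc n]
      refine (hcon _ _ d d _ (by positivity) (hE n) (hE (n + 1)) ih t x).trans ?_
      have := hw t
      gcongr
      rw [pow_succ, mul_comm]
      gcongr
      linarith
  have hgeom : ∀ n m, n ≤ m → ∀ t x,
      ‖E n t x - E m t x‖ ≤ (2 * (1 / 2) ^ n - 2 * (1 / 2) ^ m) * (1 + |t|) ^ (-(α + 1)) := by
    intro n m hnm t x
    induction m, hnm using Nat.le_induction with
    | base => simp
    | succ m hm ih =>
      refine (norm_sub_le_norm_sub_add_norm_sub _ (E m t x) _).trans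
        ((add_le_add ih (hstep m t x)).trans_eq ?_)
      rw [pow_succ]; ring
  have hlim0 : Tendsto (fun n : ℕ => 2 * (1 / 2 : ℝ) ^ n) atTop (𝓝 0) := by
    simpa using (tendsto_pow_atTop_nhds_zero_of_lt_one (r := (1 / 2 : ℝ)) (by norm_num)
      (by norm_num)).const_mul 2
  obtain ⟨E', hE', hconv⟩ := exists_isDecayField_limit (by linarith) hE
    (c := fun n => 2 * (1 / 2) ^ n) (fun n => by positivity) hlim0 fun n m hnm t x => by
      refine (hgeom n m hnm t x).trans ?_
      have := hw t
      gcongr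
      have : (0 : ℝ) < (1 / 2) ^ m := by positivity
      linarith
  have hfix : ∀ t x, E' t x = fieldMap K a f₀ E' t x := by
    intro t x
    rw [← sub_eq_zero, ← norm_le_zero_iff]
    have hlim1 : Tendsto (fun n : ℕ => 2 * (2 * (1 / 2 : ℝ) ^ n)) atTop (𝓝 0) := by
      simpa using hlim0.const_mul 2
    refine ge_of_tendsto' hlim1 fun n => ?_
    have h1 := hconv (n + 1) t x
    have h2 := hcon _ _ d d _ (by positivity) (hE n) hE' (hconv n) t x
    rw [← hsucc] at h2
    have h3 : (1 + |t|) ^ (-(α + 1)) ≤ 1 := one_add_abs_rpow_le_one (by linarith) t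
    have h4 : (0 : ℝ) < (1 / 2) ^ n := by positivity
    have h5 := hw t
    calc ‖E' t x - fieldMap K a f₀ E' t x‖
        ≤ ‖E (n + 1) t x - E' t x‖ + ‖E (n + 1) t x - fieldMap K a f₀ E' t x‖ := by
          rw [← norm_neg (E (n + 1) t x - E' t x), neg_sub]
          exact norm_sub_le_norm_sub_add_norm_sub _ _ _
      _ ≤ 2 * (1 / 2) ^ (n + 1) * 1 + 1 * (2 * (1 / 2) ^ n) * 1 := by
          refine add_le_add (h1.trans (by gcongr)) (h2.trans ?_)
          gcongr
          linarith
      _ ≤ _ := by rw [pow_succ]; linarith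
  have he : fieldMap K a f₀ E' = E' := funext fun t => funext fun x => (hfix t x).symm
  refine ⟨d, E', ?_, hfix⟩
  have := hmap E' d hE'
  rwa [he] at this

end FixedPoint

/-! ### Comparison principle and uniqueness -/

section Uniqueness

open Filter Topology

variable {α κ a η δ : ℝ} {K : R3 → R3} {f₀ : R3 → R3 → ℝ} {E : ℝ → R3 → R3} {d : ℝ → ℝ}

theorem exists_hasFDerivAt_bracket (x : R3) :
    ∃ b' : R3 →L[ℝ] ℝ, HasFDerivAt bracket b' x ∧ ∀ e, |b' e| ≤ ‖e‖ := by
  have hb := bracket_pos x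
  have h1 : HasFDerivAt (fun x : R3 => 1 + ‖x‖ ^ 2) (2 • innerSL ℝ x) x :=
    (hasStrictFDerivAt_norm_sq x).hasFDerivAt.const_add 1
  refine ⟨_, h1.sqrt (by positivity), fun e => ?_⟩
  change |(1 / (2 * bracket x)) * ((2 • innerSL ℝ x) e)| ≤ ‖e‖
  have h2 : (2 • innerSL ℝ x) e = 2 * inner ℝ x e := by
    rw [two_smul, two_mul]; rfl
  rw [h2, show 1 / (2 * bracket x) * (2 * inner ℝ x e) = (bracket x)⁻¹ * inner ℝ x e by
    field_simp,
    abs_mul, abs_of_pos (inv_pos.2 hb), inv_mul_le_iff₀ hb]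
  exact (abs_real_inner_le_norm x e).trans
    (mul_le_mul_of_nonneg_right (norm_le_bracket x) (norm_nonneg e))

theorem exists_hasFDerivAt_bracket_rpow {s : ℝ} (hs : 0 ≤ s) (x : R3) :
    ∃ b' : R3 →L[ℝ] ℝ, HasFDerivAt (fun x => bracket x ^ (-s)) b' x ∧
      ∀ e, |b' e| ≤ s * bracket x ^ (-s) * ‖e‖ := by
  obtain ⟨b', hb', hle⟩ := exists_hasFDerivAt_bracket x
  have hb := bracket_pos x
  refine ⟨_, hb'.rpow_const (Or.inl hb.ne'), fun e => ?_⟩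
  change |(-s * bracket x ^ (-s - 1)) * b' e| ≤ _
  have h1 : bracket x ^ (-s - 1) ≤ bracket x ^ (-s) :=
    Real.rpow_le_rpow_of_exponent_le (one_le_bracket x) (by linarith)
  have h2 : 0 < bracket x ^ (-s - 1) := by positivity
  rw [abs_mul, abs_mul, abs_neg, abs_of_nonneg hs, abs_of_pos h2]
  gcongr
  exact hle e

/-- The derivative of the weight along the characteristics of a field with value `F`: the free
transport annihilates the weight. -/
theorem exists_hasFDerivAt_weight (ha : 0 ≤ a) (hκ : 0 < κ) {t : ℝ} (ht : 0 ≤ t) (x p : R3) :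
    ∃ W' : ℝ × R3 × R3 →L[ℝ] ℝ,
      HasFDerivAt (fun q : ℝ × R3 × R3 => weight κ a q.1 q.2.1 q.2.2) W' (t, x, p) ∧
      ∀ F : R3, |W' (1, vel a p, F)| ≤ (κ + 5) * (1 + t) * ‖F‖ * weight κ a t x p := by
  obtain ⟨b, hb, hble⟩ := exists_hasFDerivAt_bracket_rpow hκ.le (x - t • vel a p)
  obtain ⟨c, hc, hcle⟩ := exists_hasFDerivAt_bracket_rpow (s := 5) (by norm_num) p
  let pr1 := ContinuousLinearMap.fst ℝ ℝ (R3 × R3)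
  let pr2 := (ContinuousLinearMap.fst ℝ R3 R3).comp (ContinuousLinearMap.snd ℝ ℝ (R3 × R3))
  let pr3 := (ContinuousLinearMap.snd ℝ R3 R3).comp (ContinuousLinearMap.snd ℝ ℝ (R3 × R3))
  have hv : HasFDerivAt (fun q : ℝ × R3 × R3 => vel a q.2.2) ((velDeriv a p).comp pr3)
      (t, x, p) :=
    HasFDerivAt.comp (g := vel a) (f := fun q : ℝ × R3 × R3 => q.2.2) (t, x, p)
      (hasFDerivAt_vel ha p) pr3.hasFDerivAt
  have hy : HasFDerivAt (fun q : ℝ × R3 × R3 => q.2.1 - q.1 • vel a q.2.2)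
      (pr2 - (t • (velDeriv a p).comp pr3 + pr1.smulRight (vel a p))) (t, x, p) :=
    (pr2.hasFDerivAt (x := (t, x, p))).sub ((pr1.hasFDerivAt (x := (t, x, p))).smul hv)
  have h1 : HasFDerivAt (fun q : ℝ × R3 × R3 => bracket (q.2.1 - q.1 • vel a q.2.2) ^ (-κ))
      (b.comp (pr2 - (t • (velDeriv a p).comp pr3 + pr1.smulRight (vel a p)))) (t, x, p) :=
    HasFDerivAt.comp (g := fun y => bracket y ^ (-κ))
      (f := fun q : ℝ × R3 × R3 => q.2.1 - q.1 • vel a q.2.2) (t, x, p) hb hy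
  have h2 : HasFDerivAt (fun q : ℝ × R3 × R3 => bracket q.2.2 ^ (-(5 : ℝ))) (c.comp pr3)
      (t, x, p) :=
    HasFDerivAt.comp (g := fun y => bracket y ^ (-(5 : ℝ))) (f := fun q : ℝ × R3 × R3 => q.2.2)
      (t, x, p) hc (pr3.hasFDerivAt (x := (t, x, p)))
  have e5 : ∀ p : R3, bracket p ^ (-(5 : ℝ)) = (bracket p ^ 5)⁻¹ := fun p => by
    rw [Real.rpow_neg (bracket_pos p).le]
    norm_cast
  have h3 := h1.mul h2
  simp only [e5] at h3 hcle
  refine ⟨_, h3, fun F => ?_⟩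
  have hY := bracket_pos (x - t • vel a p)
  have hp := bracket_pos p
  have e : (bracket (x - t • vel a p) ^ (-κ) • c.comp pr3 + (bracket p ^ 5)⁻¹ •
      b.comp (pr2 - (t • (velDeriv a p).comp pr3 + pr1.smulRight (vel a p)))) (1, vel a p, F)
      = bracket (x - t • vel a p) ^ (-κ) * c F
        + (bracket p ^ 5)⁻¹ * b (-(t • velDeriv a p F)) := by
    simp [pr1, pr2, pr3]
  have hF : ‖-(t • velDeriv a p F)‖ ≤ t * ‖F‖ := by
    rw [norm_neg, norm_smul, Real.norm_of_nonneg ht]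
    exact mul_le_mul_of_nonneg_left (norm_velDeriv_apply_le ha p F) ht
  calc _ = |bracket (x - t • vel a p) ^ (-κ) * c F
        + (bracket p ^ 5)⁻¹ * b (-(t • velDeriv a p F))| := by rw [← e]
    _ ≤ bracket (x - t • vel a p) ^ (-κ) * (5 * (bracket p ^ 5)⁻¹ * ‖F‖)
        + (bracket p ^ 5)⁻¹ * (κ * bracket (x - t • vel a p) ^ (-κ) * (t * ‖F‖)) := by
      refine (abs_add_le _ _).trans (add_le_add ?_ ?_)
      · rw [abs_mul, abs_of_pos (by positivity : 0 < bracket (x - t • vel a p) ^ (-κ))]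
        gcongr
        exact hcle F
      · rw [abs_mul, abs_of_pos (by positivity : 0 < (bracket p ^ 5)⁻¹)]
        gcongr
        exact (hble _).trans (by gcongr)
    _ = (5 + κ * t) * ‖F‖ * weight κ a t x p := by unfold weight; ring
    _ ≤ _ := by
      have := weight_pos (κ := κ) (a := a) t x p
      gcongr
      nlinarith

/-- Maximum principle for the transport operator `∂ₜ + v(p) · ∇ₓ + F · ∇ₚ` with a bounded, not
necessarily Lipschitz, force `F`. The maximum is taken over the backward tube
`|q - p| ≤ M(t-s)`, `|y - x + (t-s) v(p)| ≤ M(t-s)²/2`, which straight segments in the backward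
characteristic directions do not leave. -/
theorem le_zero_of_transport_le_zero (ha : 0 ≤ a) {h : ℝ → R3 → R3 → ℝ} {F : ℝ → R3 → R3}
    {T M : ℝ} (hc : ContinuousOn (fun q : ℝ × R3 × R3 => h q.1 q.2.1 q.2.2) (Ici 0 ×ˢ univ))
    (hM : ∀ t ∈ Icc 0 T, ∀ x, ‖F t x‖ ≤ M) (h0 : ∀ x p, h 0 x p ≤ 0)
    (hh : ∀ t, 0 < t → t ≤ T → ∀ x p, ∃ h' : ℝ × R3 × R3 →L[ℝ] ℝ,
      HasFDerivAt (fun q : ℝ × R3 × R3 => h q.1 q.2.1 q.2.2) h' (t, x, p) ∧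
      h' (1, vel a p, F t x) ≤ 0) {t : ℝ} (ht : 0 ≤ t) (htT : t ≤ T) (x p : R3) :
    h t x p ≤ 0 := by
  have hM0 : 0 ≤ M := (norm_nonneg _).trans (hM t ⟨ht, htT⟩ x)
  let S : Set (ℝ × R3 × R3) := {q | q.1 ∈ Icc 0 t ∧ ‖q.2.2 - p‖ ≤ M * (t - q.1) ∧
    ‖q.2.1 - x + (t - q.1) • vel a p‖ ≤ M * (t - q.1) ^ 2 / 2}
  have hS0 : S ⊆ Ici 0 ×ˢ univ := fun q hq => ⟨hq.1.1, mem_univ _⟩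
  have hSc : IsClosed S := by
    refine (isClosed_Icc.preimage continuous_fst).inter (IsClosed.inter ?_ ?_)
    · exact isClosed_le (f := fun q : ℝ × R3 × R3 => ‖q.2.2 - p‖)
        (g := fun q => M * (t - q.1)) (by fun_prop) (by fun_prop)
    · exact isClosed_le (f := fun q : ℝ × R3 × R3 => ‖q.2.1 - x + (t - q.1) • vel a p‖)
        (g := fun q => M * (t - q.1) ^ 2 / 2) (by fun_prop) (by fun_prop)
  have hSK : IsCompact S := by
    refine ((isCompact_Icc (a := (0 : ℝ)) (b := t)).prod
      ((isCompact_closedBall x (M * t ^ 2 / 2 + t * ‖vel a p‖)).prod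
        (isCompact_closedBall p (M * t)))).of_isClosed_subset hSc fun q hq => ?_
    obtain ⟨⟨h1, h2⟩, h3, h4⟩ := hq
    refine ⟨⟨h1, h2⟩, ?_, ?_⟩
    · rw [Metric.mem_closedBall, dist_eq_norm]
      have e : q.2.1 - x = (q.2.1 - x + (t - q.1) • vel a p) - (t - q.1) • vel a p := by abel
      rw [e]
      refine (norm_sub_le _ _).trans (add_le_add (h4.trans ?_) ?_)
      · have : t - q.1 ≤ t := by linarith
        have : 0 ≤ t - q.1 := by linarith
        gcongr
      · rw [norm_smul, Real.norm_of_nonneg (by linarith)]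
        gcongr
        linarith
    · rw [Metric.mem_closedBall, dist_eq_norm]
      refine h3.trans ?_
      gcongr
      linarith
  have hmem : (t, x, p) ∈ S := ⟨⟨ht, le_rfl⟩, by simp, by simp⟩
  refine le_of_forall_pos_le_add fun ε hε => ?_
  -- Perturb so that the transport operator becomes strictly negative.
  let δ : ℝ := ε / (1 + t)
  have hδ : 0 < δ := by positivity
  let k : ℝ × R3 × R3 → ℝ := fun q => h q.1 q.2.1 q.2.2 - δ * q.1
  have hk : ContinuousOn k S := (hc.mono hS0).sub (by fun_prop)
  obtain ⟨⟨s, y, q⟩, hq, hmax⟩ := hSK.exists_isMaxOn ⟨_, hmem⟩ hk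
  have hδt : δ * t ≤ ε := by
    have : δ * (1 + t) = ε := by simp only [δ]; field_simp
    nlinarith
  have hle : h t x p - δ * t ≤ h s y q - δ * s := hmax hmem
  obtain ⟨⟨hs0, hst⟩, hq1, hq2⟩ := hq
  simp only at hs0 hst hq1 hq2
  rcases hs0.eq_or_lt with rfl | hs
  · have := h0 y q
    linarith
  exfalso
  obtain ⟨h', hh', hneg⟩ := hh s hs (hst.trans htT) y q
  have hF := hM s ⟨hs.le, hst.trans htT⟩ y
  have hline : HasDerivAt
      (fun τ : ℝ => ((s, y, q) : ℝ × R3 × R3) + τ • -((1 : ℝ), vel a q, F s y))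
      (-((1 : ℝ), vel a q, F s y)) 0 := by
    simpa using ((hasDerivAt_id (0 : ℝ)).smul_const
      (-((1 : ℝ), vel a q, F s y))).const_add ((s, y, q) : ℝ × R3 × R3)
  have hk' : HasFDerivAt k (h' - δ • ContinuousLinearMap.fst ℝ ℝ (R3 × R3))
      (((s, y, q) : ℝ × R3 × R3) + (0 : ℝ) • -((1 : ℝ), vel a q, F s y)) := by
    rw [zero_smul, add_zero]
    exact hh'.sub ((ContinuousLinearMap.fst ℝ ℝ (R3 × R3)).hasFDerivAt.const_mul δ)
  have hφ := hk'.comp_hasDerivAt (0 : ℝ) hline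
  have hpos : 0 < (h' - δ • ContinuousLinearMap.fst ℝ ℝ (R3 × R3))
      (-((1 : ℝ), vel a q, F s y)) := by
    rw [map_neg]
    simp only [sub_apply, smul_apply, ContinuousLinearMap.coe_fst', smul_eq_mul]
    linarith
  have hev : ∀ᶠ τ in 𝓝[>] (0 : ℝ), 0 < slope (k ∘ fun τ : ℝ =>
      ((s, y, q) : ℝ × R3 × R3) + τ • -((1 : ℝ), vel a q, F s y)) 0 τ :=
    (hasDerivAt_iff_tendsto_slope.1 hφ).eventually_const_lt hpos |>.filter_mono
      (nhdsWithin_mono _ fun τ hτ => ne_of_gt hτ)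
  obtain ⟨τ, hτ, hτ0, hτs⟩ := (hev.and (Ioo_mem_nhdsGT hs)).exists
  have hin : ((s, y, q) : ℝ × R3 × R3) + τ • -((1 : ℝ), vel a q, F s y) ∈ S := by
    have e : ((s, y, q) : ℝ × R3 × R3) + τ • -((1 : ℝ), vel a q, F s y)
        = (s - τ, y - τ • vel a q, q - τ • F s y) := by
      ext1
      · simp [sub_eq_add_neg]
      · ext1 <;> simp [sub_eq_add_neg]
    rw [e]
    refine ⟨⟨by simp only; linarith, by simp only; linarith⟩, ?_, ?_⟩
    · simp only
      have e1 : q - τ • F s y - p = (q - p) - τ • F s y := by abel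
      rw [e1]
      refine (norm_sub_le _ _).trans ?_
      rw [norm_smul, Real.norm_of_nonneg hτ0.le]
      nlinarith
    · simp only
      have e1 : y - τ • vel a q - x + (t - (s - τ)) • vel a p
          = (y - x + (t - s) • vel a p) - τ • (vel a q - vel a p) := by
        rw [show t - (s - τ) = (t - s) + τ by ring, add_smul, smul_sub]; abel
      rw [e1]
      refine (norm_sub_le _ _).trans ?_
      rw [norm_smul, Real.norm_of_nonneg hτ0.le]
      have h1 := (norm_vel_sub_le ha q p).trans hq1
      nlinarith [mul_le_mul_of_nonneg_left h1 hτ0.le, mul_nonneg hM0 (sq_nonneg τ)]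
  have h1 := hmax hin
  have h2 : k (((s, y, q) : ℝ × R3 × R3) + τ • -((1 : ℝ), vel a q, F s y)) ≤ k (s, y, q) := h1
  rw [slope_def_field] at hτ
  simp only [Function.comp_apply, zero_smul, add_zero, sub_zero] at hτ
  have := (div_pos_iff_of_pos_right hτ0).1 hτ
  linarith

/-- Comparison with the exponentially growing weight. -/
theorem abs_le_weight_of_transport_le (ha : 0 ≤ a) (hκ : 0 < κ) {h : ℝ → R3 → R3 → ℝ}
    {F : ℝ → R3 → R3} {T M Q R l : ℝ} (hT : 0 ≤ T) (hQ : 0 ≤ Q)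
    (hc : ContinuousOn (fun q : ℝ × R3 × R3 => h q.1 q.2.1 q.2.2) (Ici 0 ×ˢ univ))
    (hM : ∀ t ∈ Icc 0 T, ∀ x, ‖F t x‖ ≤ M) (h0 : ∀ x p, |h 0 x p| ≤ Q * weight κ a 0 x p)
    (hh : ∀ t, 0 < t → t ≤ T → ∀ x p, ∃ h' : ℝ × R3 × R3 →L[ℝ] ℝ,
      HasFDerivAt (fun q : ℝ × R3 × R3 => h q.1 q.2.1 q.2.2) h' (t, x, p) ∧
      |h' (1, vel a p, F t x)| ≤ R * Real.exp (l * t) * weight κ a t x p)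
    (hl : (κ + 5) * (1 + T) * M * Q + R ≤ l * Q) {t : ℝ} (ht : 0 ≤ t) (htT : t ≤ T) (x p : R3) :
    |h t x p| ≤ Q * Real.exp (l * t) * weight κ a t x p := by
  have key : ∀ σ : ℝ, |σ| = 1 → σ * h t x p - Q * Real.exp (l * t) * weight κ a t x p ≤ 0 := by
    intro σ hσ
    refine le_zero_of_transport_le_zero ha (F := F) (T := T) (M := M)
      (h := fun t x p => σ * h t x p - Q * Real.exp (l * t) * weight κ a t x p) ?_ hM
      (fun x p => ?_) (fun t ht htT x p => ?_) ht htT x p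
    · have hw := continuous_weight (κ := κ) ha
      refine (hc.const_smul σ).sub (Continuous.continuousOn ?_)
      exact (continuous_const.mul (by fun_prop)).mul hw
    · have h1 := h0 x p
      have h2 : σ * h 0 x p ≤ |h 0 x p| := by
        refine (le_abs_self _).trans_eq ?_
        rw [abs_mul, hσ, one_mul]
      simp only [mul_zero, Real.exp_zero, mul_one]
      linarith
    · obtain ⟨h', hh', hle⟩ := hh t ht htT x p
      obtain ⟨W', hW', hWle⟩ := exists_hasFDerivAt_weight (κ := κ) ha hκ ht.le x p
      have hE : HasFDerivAt (fun q : ℝ × R3 × R3 => Q * Real.exp (l * q.1))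
          ((Q * (l * Real.exp (l * t))) • ContinuousLinearMap.fst ℝ ℝ (R3 × R3)) (t, x, p) := by
        have h1 : HasDerivAt (fun t : ℝ => Q * Real.exp (l * t)) (Q * (l * Real.exp (l * t)))
            t := by
          have := (((hasDerivAt_id t).const_mul l).exp).const_mul Q
          simpa [mul_comm, mul_assoc, mul_left_comm] using this
        have h2 := h1.comp_hasFDerivAt (t, x, p)
          (ContinuousLinearMap.fst ℝ ℝ (R3 × R3)).hasFDerivAt
        exact h2
      refine ⟨_, (hh'.const_mul σ).sub (hE.mul hW'), ?_⟩
      have hw := weight_pos (κ := κ) (a := a) t x p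
      have h1 := hWle (F t x)
      have h2 := hM t ⟨ht.le, htT⟩ x
      have hM0 : 0 ≤ M := (norm_nonneg _).trans h2
      have h3 : |W' (1, vel a p, F t x)| ≤ (κ + 5) * (1 + T) * M * weight κ a t x p :=
        h1.trans (by gcongr)
      have h4 : σ * h' (1, vel a p, F t x) ≤ R * Real.exp (l * t) * weight κ a t x p := by
        refine ((le_abs_self _).trans_eq ?_).trans hle
        rw [abs_mul, hσ, one_mul]
      have h5 := (neg_le_abs (W' (1, vel a p, F t x))).trans h3
      have hexp := Real.exp_pos (l * t)
      have h6 : -(Q * Real.exp (l * t) * W' (1, vel a p, F t x))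
          ≤ Q * Real.exp (l * t) * ((κ + 5) * (1 + T) * M * weight κ a t x p) := by
        rw [← mul_neg]
        gcongr
      have h7 : ((κ + 5) * (1 + T) * M * Q + R) * (Real.exp (l * t) * weight κ a t x p)
          ≤ l * Q * (Real.exp (l * t) * weight κ a t x p) := by gcongr
      simp only [sub_apply, add_apply, smul_apply, ContinuousLinearMap.coe_fst', smul_eq_mul]
      linarith
  rw [abs_le]
  have h1 := key 1 abs_one
  have h2 := key (-1) (by simp)
  constructor <;> linarith

/-- The self-consistent solution is unique among classical solutions with locally bounded
fields. Such a solution is first bounded by a growing multiple of the weight; then the growth rate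
can be chosen such that every bound on the difference improves by the factor `1/2`. -/
theorem IsDecayField.unique (hα₁ : 1 < α) (hα₂ : α < 2) (hκ : 3 < κ) (hK : IsKernel α K)
    (hδ : δ ≤ (α - 1) / 2) (ha : 0 ≤ a) (ha1 : a ≤ 1) (hE : IsDecayField α δ d E)
    (hf : IsDatum κ η f₀) (hfix : ∀ t, 0 ≤ t → ∀ x, selfField K (transported a E f₀) t x = E t x)
    {g : ℝ → R3 → R3 → ℝ} (hg0 : ∀ x p, g 0 x p = f₀ x p)
    (hgc : ContinuousOn (fun q : ℝ × R3 × R3 => g q.1 q.2.1 q.2.2) (Ici 0 ×ˢ univ))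
    (hgM : ∀ T : ℝ, ∃ M : ℝ, ∀ t ∈ Icc 0 T, ∀ x, ‖selfField K g t x‖ ≤ M)
    (hg : ∀ t, 0 < t → ∀ x p, ∃ g' : ℝ × R3 × R3 →L[ℝ] ℝ,
      HasFDerivAt (fun q : ℝ × R3 × R3 => g q.1 q.2.1 q.2.2) g' (t, x, p) ∧
      g' (1, vel a p, selfField K g t x) = 0) {T : ℝ} (hT : 0 ≤ T) (x p : R3) :
    g T x p = transported a E f₀ T x p := by
  have hκ0 : 0 < κ := by linarith
  have hδ1 : δ ≤ 1 := by linarith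
  have hη := hf.eta_nonneg
  obtain ⟨C, hC, hfield⟩ := hK.exists_field_bound hα₁ hα₂ hκ
  obtain ⟨M, hM⟩ := hgM T
  have hM0 : 0 ≤ M := (norm_nonneg _).trans (hM 0 ⟨le_rfl, hT⟩ 0)
  let f := transported a E f₀
  let N := transConst α κ * η
  have hN : 0 ≤ N := mul_nonneg (transConst_pos α κ).le hη
  have hdis : ∀ t, 0 ≤ t → IsDispersed κ a t N (f t) := fun t ht =>
    hE.isDispersed_transported hα₁ hδ hδ1 ha ha1 hκ0 hf ht
  let B := (κ + 5) * (1 + T) * M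
  have hB : 0 ≤ B := by positivity
  let l := B + 2 * (N * (1 + T) * C)
  have hl : B ≤ l := by
    simp only [l]
    nlinarith [mul_nonneg (mul_nonneg hN (by linarith : 0 ≤ 1 + T)) hC.le]
  have hl0 : 0 ≤ l := hB.trans hl
  have hf0 : ∀ x p, f 0 x p = f₀ x p := fun x p => by
    simp only [f, transported, (hE.isDiffField hα₁ hδ1 ha ha1).toIsLipField.flow_self]
  have hfc : Continuous fun q : ℝ × R3 × R3 => f q.1 q.2.1 q.2.2 :=
    (hE.contDiff_transported hα₁ hδ1 ha ha1 hf).continuous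
  have hgt : ∀ t, 0 ≤ t → Continuous fun z : R3 × R3 => g t z.1 z.2 := fun t ht =>
    hgc.comp_continuous (by fun_prop : Continuous fun z : R3 × R3 => (t, z.1, z.2))
      fun z => ⟨ht, mem_univ _⟩
  have hgb : ∀ t, 0 ≤ t → t ≤ T → ∀ x p, |g t x p| ≤ η * Real.exp (l * t) * weight κ a t x p := by
    intro t ht htT x p
    refine abs_le_weight_of_transport_le ha hκ0 hT hη hgc hM (R := 0) (fun x p => ?_)
      (fun t ht _ x p => ?_) ?_ ht htT x p
    · rw [hg0]
      refine (hf.bound x p).trans ?_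
      rw [weight, zero_smul, sub_zero]
      have h1 := bracket_pos x
      have h2 := bracket_pos p
      have h3 := one_le_bracket p
      gcongr
      norm_num
    · obtain ⟨g', h1, h2⟩ := hg t ht x p
      exact ⟨g', h1, by rw [h2]; simp⟩
    · rw [add_zero]
      exact mul_le_mul_of_nonneg_right hl hη
  have hstep : ∀ n : ℕ, ∀ t, 0 ≤ t → t ≤ T → ∀ x p,
      |g t x p - f t x p| ≤ (η + N) * (1 / 2) ^ n * Real.exp (l * t) * weight κ a t x p := by
    intro n
    induction n with
    | zero =>
      intro t ht htT x p
      have h1 := hgb t ht htT x p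
      have h2 := (hdis t ht).abs_le x p
      have h3 : 1 ≤ Real.exp (l * t) := Real.one_le_exp (by positivity)
      have hw := weight_pos (κ := κ) (a := a) t x p
      have h4 : N * weight κ a t x p ≤ N * Real.exp (l * t) * weight κ a t x p := by
        gcongr
        exact le_mul_of_one_le_right hN h3
      rw [pow_zero, mul_one]
      refine (abs_sub _ _).trans ?_
      linarith
    | succ n ih =>
      intro t ht htT x p
      let Q := (η + N) * (1 / 2) ^ n
      have hQ : 0 ≤ Q := by positivity
      have := abs_le_weight_of_transport_le (κ := κ) (l := l) ha hκ0 hT (Q := Q / 2)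
        (h := fun t x p => g t x p - f t x p) (F := selfField K g) (M := M)
        (R := N * (1 + T) * C * Q) (by positivity) (hgc.sub hfc.continuousOn) hM
        (fun x p => ?_) (fun s hs hsT y q => ?_) ?_ ht htT x p
      · refine this.trans_eq ?_
        simp only [Q]; rw [pow_succ]; ring
      · rw [hg0, hf0, sub_self, abs_zero]
        have := weight_pos (κ := κ) (a := a) 0 x p
        positivity
      · obtain ⟨g', hg1, hg2⟩ := hg s hs y q
        refine ⟨_, hg1.sub (hE.hasFDerivAt_transported hα₁ hδ1 ha ha1 hf s (y, q)), ?_⟩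
        have hw := weight_pos (κ := κ) (a := a) s y q
        have hexp := Real.exp_pos (l * s)
        -- The difference of the two fields is controlled by the previous bound.
        have hi1 := (hfield a ha ha1 s hs.le (η * Real.exp (l * s)) (g s) (by positivity)
          (hgt s hs.le).aestronglyMeasurable (hgb s hs.le hsT) y).1
        have hi2 := (hfield a ha ha1 s hs.le N (f s) hN
          (hdis s hs.le).contDiff.continuous.aestronglyMeasurable (hdis s hs.le).abs_le y).1
        have hd : ‖selfField K g s y - E s y‖ ≤ C * (Q * Real.exp (l * s)) := by
          have h1 := (hfield a ha ha1 s hs.le (Q * Real.exp (l * s))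
            (fun y q => g s y q - f s y q) (by positivity)
            ((hgt s hs.le).sub (hdis s hs.le).contDiff.continuous).aestronglyMeasurable
            (ih s hs.le hsT) y).2
          rw [← hfix s hs.le, selfField, selfField, ← integral_sub hi1 hi2]
          simp only [← sub_smul]
          refine h1.trans (mul_le_of_le_one_right (by positivity) ?_)
          have := one_add_abs_rpow_le_one (q := α + 1) (by linarith) s
          rwa [abs_of_pos hs] at this
        have e1 : (ContinuousLinearMap.snd ℝ ℝ (R3 × R3)
            - (ContinuousLinearMap.fst ℝ ℝ (R3 × R3)).smulRight (phaseField a E s (y, q)))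
            (1, vel a q, selfField K g s y) = (0, selfField K g s y - E s y) := by
          simp [phaseField]
        rw [sub_apply, hg2, ContinuousLinearMap.comp_apply, e1, zero_sub, abs_neg]
        refine ((hdis s hs.le).bound_deriv y q _).trans ?_
        have h2 : max ‖(0 : R3) - s • velDeriv a q (selfField K g s y - E s y)‖
            ‖selfField K g s y - E s y‖ ≤ (1 + T) * ‖selfField K g s y - E s y‖ := by
          have := norm_velDeriv_apply_le ha q (selfField K g s y - E s y)
          have h0 := norm_nonneg (selfField K g s y - E s y)
          rw [zero_sub, norm_neg, norm_smul, Real.norm_of_nonneg hs.le]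
          exact max_le (by nlinarith) (by nlinarith)
        calc _ ≤ N * (weight κ a s y q * 1) * ((1 + T) * (C * (Q * Real.exp (l * s)))) := by
              refine mul_le_mul ?_ (h2.trans (by gcongr)) (by positivity) (by positivity)
              gcongr
              exact inv_bracket_pow_le_one q 4
          _ = _ := by ring
      · simp only [l]
        change B * (Q / 2) + _ ≤ _
        linarith
  have hlim : Tendsto (fun n : ℕ => (η + N) * (1 / 2) ^ n * Real.exp (l * T) * weight κ a T x p)
      atTop (𝓝 0) := by
    have := (((tendsto_pow_atTop_nhds_zero_of_lt_one (r := (1 / 2 : ℝ)) (by norm_num)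
      (by norm_num)).const_mul (η + N)).mul_const (Real.exp (l * T))).mul_const (weight κ a T x p)
    simpa using this
  have := ge_of_tendsto' hlim fun n => hstep n T hT le_rfl x p
  exact sub_eq_zero.1 (abs_nonpos_iff.1 this)

end Uniqueness

/-! ### Classical solutions and the size of the initial datum -/

section Classical

open Filter Topology

variable {α κ a β η : ℝ} {w : R3 → ℝ} {f₀ : R3 → R3 → ℝ}

theorem IsShortRangePotential.isKernel_smul (hw : IsShortRangePotential α w) (β : ℝ) :
    IsKernel α fun x => β • gradient w x := by
  obtain ⟨C, R, h⟩ := hw.decay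
  refine ⟨hw.locallyIntegrable.smul β, |β| * C, R, fun x hx => ?_⟩
  rw [norm_smul, Real.norm_eq_abs, mul_assoc]
  exact mul_le_mul_of_nonneg_left (h x hx) (abs_nonneg β)

theorem forceField_eq_selfField (β : ℝ) (w : R3 → ℝ) (f : ℝ → R3 → R3 → ℝ) :
    forceField β w f = selfField (fun x => β • gradient w x) f := by
  funext t x
  rw [forceField, selfField, ← integral_smul]
  simp only [smul_comm β]

/-- The left-hand side of the Vlasov equation is the derivative in the characteristic direction. -/
theorem transport_eq_fderiv_apply {f : ℝ → R3 → R3 → ℝ} {t : ℝ} {x p : R3}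
    {f' : ℝ × R3 × R3 →L[ℝ] ℝ}
    (hf : HasFDerivAt (fun q : ℝ × R3 × R3 => f q.1 q.2.1 q.2.2) f' (t, x, p))
    (ht : 0 ≤ t) (v F : R3) :
    derivWithin (fun s => f s x p) (Ici 0) t + inner ℝ v (gradient (fun y => f t y p) x)
      + inner ℝ F (gradient (fun q => f t x q) p) = f' (1, v, F) := by
  have h1 : HasDerivAt (fun s => f s x p) (f' (1, 0, 0)) t := by
    have hs : HasDerivAt (fun s : ℝ => (s, x, p)) ((1 : ℝ), (0 : R3), (0 : R3)) t :=
      (hasDerivAt_id t).prodMk (hasDerivAt_const t (x, p))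
    exact hf.comp_hasDerivAt t hs
  have h2 : HasFDerivAt (fun y => f t y p)
      (f'.comp ((ContinuousLinearMap.inr ℝ ℝ (R3 × R3)).comp (ContinuousLinearMap.inl ℝ R3 R3)))
      x :=
    HasFDerivAt.comp x (f := fun y : R3 => (t, y, p)) hf
      (HasFDerivAt.comp x (f := fun y : R3 => (y, p)) (hasFDerivAt_prodMk_right t (x, p))
        (hasFDerivAt_prodMk_left x p))
  have h3 : HasFDerivAt (fun q => f t x q)
      (f'.comp ((ContinuousLinearMap.inr ℝ ℝ (R3 × R3)).comp (ContinuousLinearMap.inr ℝ R3 R3)))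
      p :=
    HasFDerivAt.comp p (f := fun q : R3 => (t, x, q)) hf
      (HasFDerivAt.comp p (f := fun q : R3 => (x, q)) (hasFDerivAt_prodMk_right t (x, p))
        (hasFDerivAt_prodMk_right x p))
  rw [h1.hasDerivWithinAt.derivWithin (uniqueDiffOn_Ici 0 t ht), real_inner_comm,
    real_inner_comm _ F, inner_gradient_left, inner_gradient_left, h2.fderiv, h3.fderiv]
  simp only [ContinuousLinearMap.comp_apply, ← map_add]
  congr 1
  simp

theorem enorm_le_eLpNorm_top_of_continuous {V : Type*} [TopologicalSpace V] [MeasurableSpace V]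
    {μ : Measure V} [μ.IsOpenPosMeasure] {g : V → ℝ} (hg : Continuous g) (z : V) :
    ‖g z‖ₑ ≤ eLpNorm g ∞ μ := by
  have h1 : Dense {z | ‖g z‖ₑ ≤ eLpNorm g ∞ μ} := by
    rw [eLpNorm_exponent_top]
    exact Measure.dense_of_ae (ae_le_eLpNormEssSup (f := g))
  have h2 : IsClosed {z | ‖g z‖ₑ ≤ eLpNorm g ∞ μ} := isClosed_le hg.enorm continuous_const
  have := h1.closure_eq
  rw [h2.closure_eq] at this
  exact this.ge (mem_univ z)

theorem abs_le_of_eLpNorm_top_le {V : Type*} [TopologicalSpace V] [MeasurableSpace V]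
    {μ : Measure V} [μ.IsOpenPosMeasure] {g : V → ℝ} (hg : Continuous g) {c : ℝ≥0∞} (hc : c ≠ ∞)
    (h : eLpNorm g ∞ μ ≤ c) (z : V) : |g z| ≤ c.toReal := by
  have := (ENNReal.toReal_le_toReal enorm_ne_top hc).2
    ((enorm_le_eLpNorm_top_of_continuous hg z).trans h)
  simpa using this

/-- Finite size of the datum gives pointwise bounds; the factor `2` compares the operator norm of
the derivative for the maximum norm on `ℝ³ × ℝ³` with the Euclidean length of the gradient. -/
theorem isDatum_of_initialSize (hf : ContDiff ℝ 1 fun z : R3 × R3 => f₀ z.1 z.2)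
    (h : initialSize κ f₀ ≠ ∞) :
    IsDatum κ (2 * (initialSize κ f₀).toReal) f₀ := by
  have hs : ∀ z : R3 × R3, HasFDerivAt (fun z : R3 × R3 => f₀ z.1 z.2)
      (fderiv ℝ (fun z : R3 × R3 => f₀ z.1 z.2) z) z := fun z =>
    (hf.differentiable one_ne_zero z).hasFDerivAt
  have hD := hf.continuous_fderiv one_ne_zero
  have hx : ∀ z : R3 × R3, gradient (fun y => f₀ y z.2) z.1 = (InnerProductSpace.toDual ℝ R3).symm
      ((fderiv ℝ (fun z : R3 × R3 => f₀ z.1 z.2) z).comp (ContinuousLinearMap.inl ℝ R3 R3)) := by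
    intro z
    have h1 : HasFDerivAt (fun y => f₀ y z.2) _ z.1 :=
      HasFDerivAt.comp z.1 (f := fun y : R3 => (y, z.2)) (hs z) (hasFDerivAt_prodMk_left z.1 z.2)
    rw [gradient, h1.fderiv]
  have hp : ∀ z : R3 × R3, gradient (fun q => f₀ z.1 q) z.2 = (InnerProductSpace.toDual ℝ R3).symm
      ((fderiv ℝ (fun z : R3 × R3 => f₀ z.1 z.2) z).comp (ContinuousLinearMap.inr ℝ R3 R3)) := by
    intro z
    have h1 : HasFDerivAt (fun q => f₀ z.1 q) _ z.2 :=
      HasFDerivAt.comp z.2 (f := fun q : R3 => (z.1, q)) (hs z) (hasFDerivAt_prodMk_right z.1 z.2)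
    rw [gradient, h1.fderiv]
  have hgc : Continuous fun z : R3 × R3 => phaseGradNorm f₀ z.1 z.2 := by
    simp only [phaseGradNorm, hx, hp]
    have h1 : Continuous fun z : R3 × R3 => (InnerProductSpace.toDual ℝ R3).symm
        ((fderiv ℝ (fun z : R3 × R3 => f₀ z.1 z.2) z).comp (ContinuousLinearMap.inl ℝ R3 R3)) :=
      (InnerProductSpace.toDual ℝ R3).symm.continuous.comp (hD.clm_comp continuous_const)
    have h2 : Continuous fun z : R3 × R3 => (InnerProductSpace.toDual ℝ R3).symm
        ((fderiv ℝ (fun z : R3 × R3 => f₀ z.1 z.2) z).comp (ContinuousLinearMap.inr ℝ R3 R3)) :=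
      (InnerProductSpace.toDual ℝ R3).symm.continuous.comp (hD.clm_comp continuous_const)
    fun_prop
  have hb := continuous_bracket
  have hbκ : Continuous fun z : R3 × R3 => bracket z.1 ^ κ :=
    (hb.comp continuous_fst).rpow_const fun z => Or.inl (bracket_pos z.1).ne'
  have hb2 : Continuous fun z : R3 × R3 => bracket z.2 := hb.comp continuous_snd
  have hfc := hf.continuous
  have B1 := abs_le_of_eLpNorm_top_le (μ := volume) ((hbκ.mul (hb2.pow 8)).mul hfc) h le_self_add
  have B2 := abs_le_of_eLpNorm_top_le (μ := volume) ((hbκ.mul (hb2.pow 9)).mul hgc) h le_add_self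
  have hη : 0 ≤ (initialSize κ f₀).toReal := ENNReal.toReal_nonneg
  have conv : ∀ (x p : R3) (n : ℕ) (y c : ℝ), |bracket x ^ κ * bracket p ^ n * y| ≤ c →
      |y| ≤ c * (bracket x ^ (-κ) * (bracket p ^ n)⁻¹) := by
    intro x p n y c hy
    have h1 := bracket_pos x
    have h2 := bracket_pos p
    rw [abs_mul, abs_of_pos (by positivity)] at hy
    rw [Real.rpow_neg h1.le, ← mul_inv, ← div_eq_mul_inv, le_div_iff₀ (by positivity), mul_comm]
    exact hy
  refine ⟨hf, fun x p => ?_, fun z => ?_⟩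
  · have h1 := bracket_pos x
    have h2 := bracket_pos p
    refine (conv x p 8 _ _ (B1 (x, p))).trans ?_
    gcongr
    linarith
  · have h1 := bracket_pos z.1
    have h2 := bracket_pos z.2
    have hg := (le_abs_self _).trans (conv z.1 z.2 9 _ _ (B2 z))
    have hg0 : 0 ≤ phaseGradNorm f₀ z.1 z.2 := Real.sqrt_nonneg _
    have gx : ‖gradient (fun y => f₀ y z.2) z.1‖ ≤ phaseGradNorm f₀ z.1 z.2 :=
      Real.le_sqrt_of_sq_le (by nlinarith [sq_nonneg ‖gradient (fun q => f₀ z.1 q) z.2‖])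
    have gp : ‖gradient (fun q => f₀ z.1 q) z.2‖ ≤ phaseGradNorm f₀ z.1 z.2 :=
      Real.le_sqrt_of_sq_le (by nlinarith [sq_nonneg ‖gradient (fun y => f₀ y z.2) z.1‖])
    rw [hx, LinearIsometryEquiv.norm_map] at gx
    rw [hp, LinearIsometryEquiv.norm_map] at gp
    have hop : ‖fderiv ℝ (fun z : R3 × R3 => f₀ z.1 z.2) z‖ ≤ 2 * phaseGradNorm f₀ z.1 z.2 := by
      refine ContinuousLinearMap.opNorm_le_bound _ (by positivity) fun ξ => ?_
      have e : ξ = ContinuousLinearMap.inl ℝ R3 R3 ξ.1 + ContinuousLinearMap.inr ℝ R3 R3 ξ.2 := by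
        ext1 <;> simp
      conv_lhs => rw [e, map_add]
      have h3 := (ContinuousLinearMap.le_opNorm _ ξ.1).trans
        (mul_le_mul gx (norm_fst_le ξ) (norm_nonneg _) hg0)
      have h4 := (ContinuousLinearMap.le_opNorm _ ξ.2).trans
        (mul_le_mul gp (norm_snd_le ξ) (norm_nonneg _) hg0)
      exact (norm_add_le _ _).trans ((add_le_add h3 h4).trans_eq (by ring))
    refine hop.trans ?_
    rw [mul_assoc]
    gcongr

theorem fieldDecayNorm_le {E : ℝ → R3 → R3} {c : ℝ} (hc : 0 ≤ c)
    (h1 : ∀ t, 0 ≤ t → ∀ x, ‖E t x‖ ≤ c * (1 + t) ^ (-(α + 1)))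
    (h2 : ∀ t, 0 ≤ t → ∀ x, ‖fderiv ℝ (E t) x‖ ≤ c * (1 + t) ^ (-(α + 2))) :
    fieldDecayNorm α E ≤ ENNReal.ofReal (2 * c) := by
  refine iSup_le fun t => ?_
  have ht : (0 : ℝ) ≤ t := t.2
  have ht1 : (0 : ℝ) < 1 + t := by linarith
  have key : ∀ {W : Type} [NormedAddCommGroup W] (g : R3 → W) (q : ℝ),
      (∀ x, ‖g x‖ ≤ c * (1 + (t : ℝ)) ^ (-q)) →
      ENNReal.ofReal ((1 + (t : ℝ)) ^ q) * eLpNorm g ∞ volume ≤ ENNReal.ofReal c := by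
    intro W _ g q hg
    have h3 : eLpNorm g ∞ volume ≤ ENNReal.ofReal (c * (1 + (t : ℝ)) ^ (-q)) := by
      rw [eLpNorm_exponent_top]
      exact eLpNormEssSup_le_of_ae_bound (Eventually.of_forall hg)
    calc _ ≤ ENNReal.ofReal ((1 + (t : ℝ)) ^ q) * ENNReal.ofReal (c * (1 + (t : ℝ)) ^ (-q)) := by
          gcongr
      _ = ENNReal.ofReal c := by
          rw [← ENNReal.ofReal_mul (by positivity), Real.rpow_neg ht1.le]
          congr 1
          have : (1 + (t : ℝ)) ^ q ≠ 0 := by positivity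
          field_simp
  rw [two_mul, ENNReal.ofReal_add hc hc]
  exact add_le_add (key (E t) (α + 1) (h1 t ht)) (key (fderiv ℝ (E t)) (α + 2) (h2 t ht))

/-- The datum transported along a self-consistent decaying field is a global classical solution. -/
theorem IsDecayField.isGlobalSolution (hα₁ : 1 < α) (hα₂ : α < 2) (hκ : 3 < κ)
    (hw : IsShortRangePotential α w) {δ : ℝ} (hδ : δ ≤ (α - 1) / 2) (ha : 0 ≤ a) (ha1 : a ≤ 1)
    {E : ℝ → R3 → R3} {d : ℝ → ℝ} (hE : IsDecayField α δ d E) (hf : IsDatum κ η f₀) {c : ℝ≥0∞}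
    (hv : velocity c = vel a)
    (hfix : ∀ t, 0 ≤ t → ∀ x, forceField β w (transported a E f₀) t x = E t x) :
    IsGlobalSolution β w c f₀ (transported a E f₀) where
  initial x p := by
    simp only [transported, (hE.isDiffField hα₁ (by linarith) ha ha1).toIsLipField.flow_self]
  contDiffOn := (hE.contDiff_transported hα₁ (by linarith) ha ha1 hf).contDiffOn
  integrable t ht x := by
    have hK : IsKernel α (gradient w) := ⟨hw.locallyIntegrable, hw.decay⟩
    obtain ⟨C, -, h⟩ := hK.exists_field_bound hα₁ hα₂ hκ
    have hdis := hE.isDispersed_transported hα₁ hδ (by linarith) ha ha1 (by linarith) hf ht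
    exact (h a ha ha1 t ht _ _ hdis.N_nonneg hdis.contDiff.continuous.aestronglyMeasurable
      hdis.abs_le x).1
  field_continuous := hE.cont.continuousOn.congr fun q hq => hfix q.1 hq.1 q.2
  field_bounded T := ⟨δ, fun t ht x => by
    rw [hfix t ht.1]
    exact (hE.bound t x).trans (mul_le_of_le_one_right hE.delta_nonneg
      (one_add_abs_rpow_le_one (by linarith) t))⟩
  equation t ht x p := by
    rw [hfix t ht, hv, transport_eq_fderiv_apply
      (hE.hasFDerivAt_transported hα₁ (by linarith) ha ha1 hf t (x, p)) ht,
      ContinuousLinearMap.comp_apply]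
    simp [phaseField]

theorem IsGlobalSolution.exists_hasFDerivAt {c : ℝ≥0∞} {g : ℝ → R3 → R3 → ℝ}
    (hg : IsGlobalSolution β w c f₀ g) {t : ℝ} (ht : 0 < t) (x p : R3) :
    ∃ g' : ℝ × R3 × R3 →L[ℝ] ℝ,
      HasFDerivAt (fun q : ℝ × R3 × R3 => g q.1 q.2.1 q.2.2) g' (t, x, p) ∧
      g' (1, velocity c p, forceField β w g t x) = 0 := by
  have h1 := ((hg.contDiffOn (t, x, p) ⟨ht.le, mem_univ _⟩).contDiffAt
    (prod_mem_nhds (Ici_mem_nhds ht) univ_mem)).differentiableAt one_ne_zero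
  refine ⟨_, h1.hasFDerivAt, ?_⟩
  rw [← transport_eq_fderiv_apply h1.hasFDerivAt ht.le]
  exact hg.equation t ht.le x p

end Classical

end Vlasov

end

theorem theorem1 (α : ℝ) (hα₁ : 1 < α) (hα₂ : α < 2)
    (β : ℝ) (hβ : β = -1 ∨ β = 0 ∨ β = 1)
    (w : Vlasov.R3 → ℝ) (hw : Vlasov.IsShortRangePotential α w)
    (κ : ℝ) (hκ : 3 < κ) :
    ∃ ε : ℝ, 0 < ε ∧ ∃ C : ℝ, 0 < C ∧
      ∀ f₀ : Vlasov.R3 → Vlasov.R3 → ℝ,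
        ContDiff ℝ 1 (fun z : Vlasov.R3 × Vlasov.R3 => f₀ z.1 z.2) →
        (∀ x p, 0 ≤ f₀ x p) →
        Vlasov.initialSize κ f₀ < ENNReal.ofReal ε →
        ∀ c : ℝ≥0∞, 1 ≤ c →
          ∃ f : ℝ → Vlasov.R3 → Vlasov.R3 → ℝ,
            Vlasov.IsGlobalSolution β w c f₀ f ∧
            (∀ t, 0 ≤ t → ∀ x p, 0 ≤ f t x p) ∧
            (∀ g : ℝ → Vlasov.R3 → Vlasov.R3 → ℝ, Vlasov.IsGlobalSolution β w c f₀ g →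
              ∀ t, 0 ≤ t → ∀ x p, g t x p = f t x p) ∧
            (∀ t, 0 ≤ t → Differentiable ℝ (Vlasov.forceField β w f t)) ∧
            ∀ η₀ : ℝ, Vlasov.initialSize κ f₀ < ENNReal.ofReal η₀ → η₀ < ε →
              Vlasov.fieldDecayNorm α (Vlasov.forceField β w f) ≤ ENNReal.ofReal (C * η₀) := by
  have hK := hw.isKernel_smul β
  obtain ⟨ε, hε, C, hC, hCε, H⟩ := hK.exists_selfConsistent hα₁ hα₂ hκ
  -- The datum bound costs a factor `2`, and the decay norm is a sum of two suprema.
  refine ⟨ε / 2, by positivity, 4 * C, by positivity, fun f₀ hf hpos hsize c hc => ?_⟩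
  obtain ⟨a, ha, ha1, hv⟩ := Vlasov.velocity_eq_vel hc
  have hfin := (hsize.trans_le le_top).ne
  have hdat := Vlasov.isDatum_of_initialSize hf hfin
  have hη : 2 * (Vlasov.initialSize κ f₀).toReal ≤ ε := by
    have := ENNReal.toReal_le_of_le_ofReal (by positivity) hsize.le
    linarith
  obtain ⟨d, E, hE, hfix⟩ := H a _ f₀ ha ha1 hdat hη
  have hδ : C * (2 * (Vlasov.initialSize κ f₀).toReal) ≤ (α - 1) / 2 :=
    (mul_le_mul_of_nonneg_left hη hC.le).trans hCε
  have hself : ∀ t, 0 ≤ t → ∀ x, Vlasov.selfField (fun x => β • gradient w x)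
      (Vlasov.transported a E f₀) t x = E t x := fun t ht x => by
    rw [hfix t x, Vlasov.fieldMap, abs_of_nonneg ht]
  have hforce : ∀ t, 0 ≤ t → Vlasov.forceField β w (Vlasov.transported a E f₀) t = E t :=
    fun t ht => by
      rw [Vlasov.forceField_eq_selfField]
      exact funext (hself t ht)
  refine ⟨Vlasov.transported a E f₀, ?_, fun t _ x p => hpos _ _, fun g hg t ht x p => ?_,
    fun t ht => ?_, fun η₀ hη₀ _ => ?_⟩
  · exact hE.isGlobalSolution hα₁ hα₂ hκ hw hδ ha ha1 hdat hv
      fun t ht x => congrFun (hforce t ht) x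
  · refine hE.unique hα₁ hα₂ hκ hK hδ ha ha1 hdat hself hg.initial hg.contDiffOn.continuousOn
      (fun T => ?_) (fun s hs y q => ?_) ht x p
    · rw [← Vlasov.forceField_eq_selfField]
      exact hg.field_bounded T
    · rw [← Vlasov.forceField_eq_selfField, ← hv]
      exact hg.exists_hasFDerivAt hs y q
  · rw [hforce t ht]
    exact hE.diff t
  · have h0 : 0 < η₀ := ENNReal.ofReal_pos.1 (zero_le.trans_lt hη₀)
    have h1 := ENNReal.toReal_le_of_le_ofReal h0.le hη₀.le
    refine (Vlasov.fieldDecayNorm_le hE.delta_nonneg (fun t ht x => ?_)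
      (fun t ht x => ?_)).trans (ENNReal.ofReal_le_ofReal ?_)
    · rw [hforce t ht]
      simpa only [abs_of_nonneg ht] using hE.bound t x
    · rw [hforce t ht]
      simpa only [abs_of_nonneg ht] using hE.bound_deriv t x
    · nlinarith
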